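/- Let $\mathbb{S}^2\subset\mathbb{R}^3$ be the unit sphere. The energy space $\dot H^{1/2}(\mathbb{R};\mathbb{S}^2)$ consists of all $\mathbf{u}\in L^1_{\mathrm{loc}}(\mathbb{R};\mathbb{R}^3)$ with $\mathbf{u}(x)\in\mathbb{S}^2$ for almost every $x\in\mathbb{R}$ and $\|\mathbf{u}\|_{\dot H^{1/2}}<\infty$, where $$ \|\mathbf{u}\|_{\dot H^{1/2}}^2=\frac{1}{2\pi}\int_{\mathbb{R}}\int_{\mathbb{R}}\frac{|\mathbf{u}(x)-\mathbf{u}(y)|^2}{|x-y|^2}\,dx\,dy . $$ Let $\mathcal{R}at(\mathbb{R};\mathbb{S}^2)$ be the set of maps $\mathbf{u}=(u_1,u_2,u_3):\mathbb{R}\to\mathbb{S}^2$ whose components are rational functions of $x\in\mathbb{R}$. Let $L^2_+(\mathbb{R};\mathbb{C}^2)$ be the Hardy space of all $f\in L^2(\mathbb{R};\mathbb{C}^2)$ with $\operatorname{supp}\widehat f\subset[0,\infty)$, and let $\Pi_+$ be the orthogonal projection of $L^2(\mathbb{R};\mathbb{C}^2)$ onto it. For $\mathbf{u}\in\mathcal{R}at(\mathbb{R};\mathbb{S}^2)$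 put $$ \mathbf{U}=\begin{pmatrix} u_3 & u_1-\mathrm{i}u_2\\ u_1+\mathrm{i}u_2 & -u_3\end{pmatrix},\qquad T_{\mathbf{U}}f=\Pi_+(\mathbf{U}f)\quad\text{for } f\in L^2_+(\mathbb{R};\mathbb{C}^2). $$ The discrete spectrum $\sigma_{\mathrm d}(T_{\mathbf{U}})$ of the bounded self-adjoint operator $T_{\mathbf{U}}$ on $L^2_+(\mathbb{R};\mathbb{C}^2)$ is the set of isolated points of its spectrum that have finite multiplicity; it is called simple if $\dim\ker(T_{\mathbf{U}}-\lambda)=1$ for every $\lambda\in\sigma_{\mathrm d}(T_{\mathbf{U}})$ (in particular, if it is empty). Theorem. The set $$ \mathcal{R}at_{\mathrm s}(\mathbb{R};\mathbb{S}^2)=\{\mathbf{u}\in\mathcal{R}at(\mathbb{R};\mathbb{S}^2) : \sigma_{\mathrm d}(T_{\mathbf{U}})\text{ is simple}\} $$ is a dense subset of $\dot H^{1/2}(\mathbb{R};\mathbb{S}^2)$: it is contained in $\dot H^{1/2}(\mathbb{R};\mathbb{S}^2)$, and for every $\mathbf{u}\in\dot H^{1/2}(\mathbb{R};\mathbb{S}^2)$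 and every $\varepsilon>0$ there is $\mathbf{w}\in\mathcal{R}at_{\mathrm s}(\mathbb{R};\mathbb{S}^2)$ with $\|\mathbf{w}-\mathbf{u}\|_{\dot H^{1/2}}<\varepsilon$. -/

import Mathlib

open MeasureTheory Filter Topology
open scoped ENNReal FourierTransform

noncomputable section

/-- `ℝ³` with its Euclidean norm. -/
abbrev R3 : Type := EuclideanSpace ℝ (Fin 3)

/-- `ℂ²` with its Hermitian norm. -/
abbrev C2 : Type := EuclideanSpace ℂ (Fin 2)

/-- `L²(ℝ; ℂ²)`. -/
abbrev L2C2 : Type := Lp C2 2 (volume : Measure ℝ)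

/-- The unit sphere `𝕊² ⊆ ℝ³`. -/
def S2 : Set R3 := Metric.sphere 0 1

/-! ### The energy space -/

/-- The Gagliardo semi-norm
`‖u‖ = ((1 / 2π) ∫∫ |u(x) - u(y)|² / |x - y|² dx dy)^(1/2)`, with values in `[0, ∞]`. -/
def gagliardoHalf (u : ℝ → R3) : ℝ≥0∞ :=
  (ENNReal.ofReal (1 / (2 * Real.pi)) *
    ∫⁻ x : ℝ, ∫⁻ y : ℝ, ‖u x - u y‖ₑ ^ 2 / ‖x - y‖ₑ ^ 2) ^ (1 / 2 : ℝ)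

/-- The energy space `Ḣ^{1/2}(ℝ; 𝕊²)`. Its elements are represented by functions; the semi-norm
does not distinguish functions that agree almost everywhere. -/
def energySpace : Set (ℝ → R3) :=
  {u | LocallyIntegrable u volume ∧ (∀ᵐ x : ℝ, u x ∈ S2) ∧ gagliardoHalf u < ∞}

/-! ### Rational maps into the sphere -/

/-- `Rat(ℝ; 𝕊²)`: maps `u : ℝ → 𝕊²` each of whose components is a rational function of `x`. -/
def ratMaps : Set (ℝ → R3) :=
  {u | (∀ x, u x ∈ S2) ∧
    ∀ k : Fin 3, ∃ p q : Polynomial ℝ, ∀ x : ℝ, q.eval x ≠ 0 ∧ u x k = p.eval x / q.eval x}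

/-! ### Toeplitz operators on the Hardy space -/

/-- The matrix `v · σ = v₁ σ₁ + v₂ σ₂ + v₃ σ₃` with the Pauli matrices `σ₁, σ₂, σ₃`. -/
def pauliMatrix (v : R3) : Matrix (Fin 2) (Fin 2) ℂ :=
  !![(v 2 : ℂ), (v 0 : ℂ) - Complex.I * (v 1 : ℂ);
     (v 0 : ℂ) + Complex.I * (v 1 : ℂ), -(v 2 : ℂ)]

/-- The symbol `U = u · σ`; the matrix `U(x)` is viewed as a linear operator on `ℂ²`. -/
def pauliSymbol (u : ℝ → R3) (x : ℝ) : C2 →L[ℂ] C2 :=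
  Matrix.toEuclideanCLM (𝕜 := ℂ) (n := Fin 2) (pauliMatrix (u x))

/-- The Hardy space `L²₊(ℝ; ℂ²)` of all `f ∈ L²(ℝ; ℂ²)` whose Fourier transform is supported in
`[0, ∞)`. -/
def hardySpace : Submodule ℂ L2C2 where
  carrier := {f | ∀ᵐ ξ : ℝ, ξ < 0 → (𝓕 f : L2C2) ξ = 0}
  zero_mem' := by
    have h : (𝓕 (0 : L2C2) : L2C2) = 0 := map_zero (Lp.fourierTransformₗᵢ ℝ C2)
    simp only [Set.mem_ofPred_eq, h]
    filter_upwards [Lp.coeFn_zero C2 2 (volume : Measure ℝ)] with ξ hξ _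
    exact hξ
  add_mem' := by
    intro f g hf hg
    have h : (𝓕 (f + g) : L2C2) = 𝓕 f + 𝓕 g := map_add (Lp.fourierTransformₗᵢ ℝ C2) f g
    simp only [Set.mem_ofPred_eq, h] at hf hg ⊢
    filter_upwards [hf, hg, Lp.coeFn_add (𝓕 f : L2C2) (𝓕 g)] with ξ h1 h2 h3 hξ
    rw [h3, Pi.add_apply, h1 hξ, h2 hξ, add_zero]
  smul_mem' := by
    intro c f hf
    have h : (𝓕 (c • f) : L2C2) = c • 𝓕 f := map_smul (Lp.fourierTransformₗᵢ ℝ C2) c f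
    simp only [Set.mem_ofPred_eq, h] at hf ⊢
    filter_upwards [hf, Lp.coeFn_smul c (𝓕 f : L2C2)] with ξ h1 h3 hξ
    rw [h3, Pi.smul_apply, h1 hξ, smul_zero]

theorem mem_hardySpace_iff (f : L2C2) :
    f ∈ hardySpace ↔ ∀ᵐ ξ : ℝ, ξ < 0 → (𝓕 f : L2C2) ξ = 0 := Iff.rfl

theorem isClosed_hardySpace : IsClosed (hardySpace : Set L2C2) := by
  have h : (hardySpace : Set L2C2) = {f : L2C2 |
      LpToLpRestrictCLM ℝ C2 ℂ volume 2 (Set.Iio (0 : ℝ)) (Lp.fourierTransformₗᵢ ℝ C2 f) = 0} := by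
    ext f
    have h1 := LpToLpRestrictCLM_coeFn (μ := (volume : Measure ℝ)) ℂ (Set.Iio (0 : ℝ))
      (Lp.fourierTransformₗᵢ ℝ C2 f)
    rw [SetLike.mem_coe, mem_hardySpace_iff, Set.mem_ofPred_eq, Lp.eq_zero_iff_ae_eq_zero]
    refine (ae_restrict_iff' (p := fun ξ => (𝓕 f : L2C2) ξ = 0)
      (measurableSet_Iio (a := (0 : ℝ)))).symm.trans ?_
    constructor
    · intro hf
      filter_upwards [hf, h1] with ξ h2 h3
      rw [h3]; exact h2
    · intro hf
      filter_upwards [hf, h1] with ξ h2 h3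
      rw [h3] at h2; exact h2
  rw [h]
  exact isClosed_eq ((LpToLpRestrictCLM ℝ C2 ℂ volume 2 (Set.Iio (0 : ℝ))).continuous.comp
    (Lp.fourierTransformₗᵢ ℝ C2).continuous) continuous_const

instance : CompleteSpace hardySpace := isClosed_hardySpace.completeSpace_coe

/-- Multiplication by a bounded operator-valued function, `f ↦ A f` on `L²(ℝ; ℂ²)`. -/
def mulOp (A : Lp (C2 →L[ℂ] C2) ∞ (volume : Measure ℝ)) : L2C2 →L[ℂ] L2C2 :=
  (ContinuousLinearMap.id ℂ (C2 →L[ℂ] C2)).holderL volume ∞ 2 2 A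

/-- The Toeplitz operator `T_A f = Π₊ (A f)` on the Hardy space, where the Cauchy-Szegő projection
`Π₊` is the orthogonal projection of `L²(ℝ; ℂ²)` onto `L²₊(ℝ; ℂ²)`. -/
def toeplitz (A : Lp (C2 →L[ℂ] C2) ∞ (volume : Measure ℝ)) : hardySpace →L[ℂ] hardySpace :=
  hardySpace.orthogonalProjectionOnto ∘L mulOp A ∘L hardySpace.subtypeL

/-- The symbol of a rational map is essentially bounded. -/
theorem memLp_pauliSymbol {u : ℝ → R3} (hu : u ∈ ratMaps) :
    MemLp (pauliSymbol u) ∞ (volume : Measure ℝ) := by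
  have hcu : Continuous u := by
    refine (PiLp.continuous_toLp 2 (fun _ : Fin 3 => ℝ)).comp
      (continuous_pi (f := fun x k => u x k) fun k => ?_)
    obtain ⟨p, q, h⟩ := hu.2 k
    have : (fun x => u x k) = fun x => p.eval x / q.eval x := funext fun x => (h x).2
    rw [this]
    exact p.continuous.div q.continuous fun x => (h x).1
  have hco (k : Fin 3) : Continuous fun v : R3 => v k := by fun_prop
  have hcm : Continuous pauliMatrix := by
    refine continuous_matrix fun i j => ?_
    have h0 := hco 0
    have h1 := hco 1
    have h2 := hco 2
    fin_cases i <;> fin_cases j <;> simp [pauliMatrix] <;> fun_prop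
  have hcl : Continuous fun v : R3 =>
      Matrix.toEuclideanCLM (𝕜 := ℂ) (n := Fin 2) (pauliMatrix v) :=
    (LinearMap.continuous_of_finiteDimensional
      (Matrix.toEuclideanCLM (𝕜 := ℂ) (n := Fin 2)).toAlgEquiv.toLinearMap).comp hcm
  obtain ⟨C, hC⟩ := (isCompact_sphere (0 : R3) 1).exists_bound_of_continuousOn hcl.continuousOn
  exact memLp_top_of_bound (hcl.comp hcu).aestronglyMeasurable C
    (Eventually.of_forall fun x => hC _ (hu.1 x))

/-- The Toeplitz operator `T_U` with symbol `U = u · σ`, for a rational map `u : ℝ → 𝕊²`. -/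
def toeplitzOfRat (u : ℝ → R3) (hu : u ∈ ratMaps) : hardySpace →L[ℂ] hardySpace :=
  toeplitz (memLp_pauliSymbol hu).toLp

/-! ### Discrete spectrum -/

/-- The eigenspace `ker (T - z)`. -/
def eigenspaceAt (T : hardySpace →L[ℂ] hardySpace) (z : ℂ) : Submodule ℂ hardySpace :=
  Module.End.eigenspace (T : hardySpace →ₗ[ℂ] hardySpace) z

/-- The discrete spectrum: isolated points of the spectrum of finite multiplicity. It is used for
self-adjoint operators, where the multiplicity of an isolated point `z` of the spectrum is the
dimension of `ker (T - z)`. -/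
def discreteSpectrum (T : hardySpace →L[ℂ] hardySpace) : Set ℂ :=
  {z | z ∈ spectrum ℂ T ∧ (∀ᶠ w in 𝓝[≠] z, w ∉ spectrum ℂ T) ∧
    FiniteDimensional ℂ (eigenspaceAt T z)}

/-- The discrete spectrum is simple: all its points have multiplicity one. -/
def HasSimpleDiscreteSpectrum (T : hardySpace →L[ℂ] hardySpace) : Prop :=
  ∀ z ∈ discreteSpectrum T, Module.finrank ℂ (eigenspaceAt T z) = 1

/-- `Rat_s(ℝ; 𝕊²)`: rational maps `u : ℝ → 𝕊²` for which `T_U` has simple discrete spectrum. -/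
def ratMapsSimple : Set (ℝ → R3) :=
  {u | ∃ hu : u ∈ ratMaps, HasSimpleDiscreteSpectrum (toeplitzOfRat u hu)}

end

/-! Write `u = stereo (p / q)`. Then `U` is the pointwise reflection in the complex line spanned by
`(p, q)`, so `U² = 1`, and `(1 - T²) f = 0` holds exactly when `U f` is again a Hardy function
(`defect_toeplitzOfRat_eq_zero_iff`). If `deg p ≤ deg q = N`, then `|p|² + |q|²` has `N` zeros in
each half plane. Only those in the upper one obstruct `U f` from being Hardy, so `1 - T²` has rank
at most `N`, with equality when `p` and `q` are coprime (`finrank_defectSpace_eq`). Hence every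
spectral point other than `±1` is an eigenvalue whose eigenvectors lie in this finite-dimensional
range, while `±1` have infinite multiplicity. It remains to make the eigenvalues away from `±1`
simple.

This is done by induction on the number of poles (`exists_perturbation_simple`). Suppose that `p₂ /
q` is coprime with `N` poles and has simple eigenvalues, and let `z` be a new pole. The symbols with
coordinate `p₂ / q + t e / ((x - z) q)` give operators analytic in the real parameter `t`, of rank
defect `N` at `t = 0` and `N + 1` for generic `t`. For small `t` the `N` simple eigenvalues persist
and leave room for only one more dimension, so the operator is still simple
(`exists_simple_of_norm_sub_lt`). Simplicity yields a cyclic vector on the range of `1 - T²`.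
Cyclicity of a fixed vector is implied by the non-vanishing of an analytic determinant, so it passes
from one `t` to all `t` outside a discrete set (`eventually_codiscrete_simple`). Hence `t` can be
taken close to the value that reproduces a prescribed rational map.

Density of the rational maps is proved on the circle: the substitution `x = tan (θ / 2)` preserves
the energy (`circleKernel_cay`). There the energy is rotation invariant, so averaging translates
does not increase it. Together with pointwise convergence almost everywhere this gives convergence
in energy, even after composition with Lipschitz maps (`tendsto_circleEnergy_sub`). A sphere-valued
map of finite energy has uniformly small mean oscillation at small scales
(`enorm_sq_le_diagonalEnergy`), so its averages stay away from the origin and can be normalized. The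
averages are Lipschitz curves, so an arbitrarily small horizontal shift moves them off the vertical
axis, and they acquire a continuous stereographic coordinate (`exists_stereo_near`). Averaging this
coordinate against powers of `|1 + e^{is}|²` produces trigonometric polynomials, which in `x` are
rational functions with poles at `±i` (`exists_ratU_near`). These are then perturbed as above. -/

/-! ### Self-adjoint operators for which `1 - T²` has finite rank. -/

section OperatorTheory

variable {H : Type*} [NormedAddCommGroup H] [InnerProductSpace ℂ H]

/-- The defect `1 - T²` of an operator. -/
def defect (T : H →L[ℂ] H) : H →L[ℂ] H := 1 - T * T

theorem defect_apply (T : H →L[ℂ] H) (x : H) : defect T x = x - T (T x) := rfl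

/-- The range of `1 - T²`. -/
def defectSpace (T : H →L[ℂ] H) : Submodule ℂ H := LinearMap.range (defect T : H →ₗ[ℂ] H)

theorem defect_mem_defectSpace (T : H →L[ℂ] H) (x : H) : defect T x ∈ defectSpace T := ⟨x, rfl⟩

/-- All eigenvalues of `T` other than `±1` are simple. -/
def SimpleAwayFromOne (T : H →L[ℂ] H) : Prop :=
  ∀ z : ℂ, z ≠ 1 → z ≠ -1 →
    Module.finrank ℂ (Module.End.eigenspace (T : H →ₗ[ℂ] H) z) ≤ 1

theorem one_sub_sq_ne_zero {z : ℂ} (h1 : z ≠ 1) (h2 : z ≠ -1) : 1 - z * z ≠ 0 := by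
  intro h
  have : (z - 1) * (z + 1) = 0 := by linear_combination -h
  rcases mul_eq_zero.1 this with h | h
  · exact h1 (by linear_combination h)
  · exact h2 (by linear_combination h)

theorem mem_eigenspace_clm {T : H →L[ℂ] H} {z : ℂ} {x : H} :
    x ∈ Module.End.eigenspace (T : H →ₗ[ℂ] H) z ↔ T x = z • x :=
  Module.End.mem_eigenspace_iff

/-- On an eigenvector for `z`, the operator `1 - T²` acts as the non-zero scalar `1 - z²`. -/
theorem eigenspace_le_defectSpace {T : H →L[ℂ] H} {z : ℂ} (h1 : z ≠ 1) (h2 : z ≠ -1) :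
    Module.End.eigenspace (T : H →ₗ[ℂ] H) z ≤ defectSpace T := by
  intro x hx
  rw [mem_eigenspace_clm] at hx
  have h0 := one_sub_sq_ne_zero h1 h2
  have h : defect T x = (1 - z * z) • x := by
    rw [defect_apply, hx, map_smul, hx, smul_smul, sub_smul, one_smul]
  refine (Submodule.smul_mem_iff _ h0).1 ?_
  rw [← h]
  exact defect_mem_defectSpace T x

theorem map_mem_defectSpace {T : H →L[ℂ] H} {x : H} (hx : x ∈ defectSpace T) :
    T x ∈ defectSpace T := by
  obtain ⟨y, rfl⟩ := hx
  exact ⟨T y, by simp [defect_apply]⟩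

theorem map_sub_smul_mem_defectSpace {T : H →L[ℂ] H} (z : ℂ) {x : H} (hx : x ∈ defectSpace T) :
    (T - z • 1) x ∈ defectSpace T :=
  Submodule.sub_mem _ (map_mem_defectSpace hx) (Submodule.smul_mem _ _ hx)

theorem finiteDimensional_eigenspace {T : H →L[ℂ] H} [FiniteDimensional ℂ (defectSpace T)]
    {z : ℂ} (h1 : z ≠ 1) (h2 : z ≠ -1) :
    FiniteDimensional ℂ (Module.End.eigenspace (T : H →ₗ[ℂ] H) z) :=
  Submodule.finiteDimensional_of_le (eigenspace_le_defectSpace h1 h2)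

/-- If `1 - T²` has finite rank, then every point of the spectrum other than `±1` is an
eigenvalue. -/
theorem isUnit_sub_of_eigenspace_eq_bot [CompleteSpace H] {T : H →L[ℂ] H}
    [FiniteDimensional ℂ (defectSpace T)] {z : ℂ} (h1 : z ≠ 1) (h2 : z ≠ -1)
    (hz : Module.End.eigenspace (T : H →ₗ[ℂ] H) z = ⊥) : IsUnit (T - z • (1 : H →L[ℂ] H)) := by
  have hinj : Function.Injective (T - z • (1 : H →L[ℂ] H)) := by
    refine (injective_iff_map_eq_zero _).2 fun x hx => ?_
    have : x ∈ Module.End.eigenspace (T : H →ₗ[ℂ] H) z := by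
      rw [mem_eigenspace_clm]
      exact sub_eq_zero.1 hx
    simpa [hz] using this
  rw [ContinuousLinearMap.isUnit_iff_bijective]
  refine ⟨hinj, fun y => ?_⟩
  let A : defectSpace T →ₗ[ℂ] defectSpace T :=
    ((T - z • (1 : H →L[ℂ] H) : H →L[ℂ] H) : H →ₗ[ℂ] H).restrict
      fun x hx => map_sub_smul_mem_defectSpace z hx
  have hA : Function.Injective A := fun x y h => Subtype.ext (hinj (congrArg Subtype.val h))
  -- The range of `1 - T²` is invariant and finite-dimensional, so injectivity of `T - z` on it
  -- gives surjectivity.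
  obtain ⟨x, hx⟩ := LinearMap.injective_iff_surjective.1 hA ⟨_, defect_mem_defectSpace T y⟩
  have hx' : (T - z • (1 : H →L[ℂ] H)) x = defect T y := congrArg Subtype.val hx
  -- Since `(T - z)(T + z) y = (1 - z²) y - (1 - T²) y`, adding `x` cancels the last term.
  refine ⟨(1 - z * z)⁻¹ • ((x : H) + (T y + z • y)), ?_⟩
  have h0 := one_sub_sq_ne_zero h1 h2
  rw [map_smul, map_add, hx', inv_smul_eq_iff₀ h0]
  simp only [defect_apply, sub_apply, smul_apply,
    one_apply_eq_self, map_add, map_smul]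
  module

theorem eigenspace_ne_bot_of_mem_spectrum [CompleteSpace H] {T : H →L[ℂ] H}
    [FiniteDimensional ℂ (defectSpace T)] {z : ℂ} (h1 : z ≠ 1) (h2 : z ≠ -1)
    (hz : z ∈ spectrum ℂ T) : Module.End.eigenspace (T : H →ₗ[ℂ] H) z ≠ ⊥ := by
  intro h
  refine hz ?_
  have := (isUnit_sub_of_eigenspace_eq_bot h1 h2 h).neg
  rwa [neg_sub, ← Algebra.algebraMap_eq_smul_one] at this

/-- A cyclic vector for `T` on the range of `1 - T²` forces the eigenvalues to be simple. -/
theorem simpleAwayFromOne_of_linearIndependent {T : H →L[ℂ] H}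
    [FiniteDimensional ℂ (defectSpace T)] {R : ℕ} (hR : Module.finrank ℂ (defectSpace T) ≤ R)
    {v : H} (hv : LinearIndependent ℂ fun j : Fin R => (T ^ (j : ℕ)) (defect T v)) :
    SimpleAwayFromOne T := by
  intro z h1 h2
  have hmem : ∀ j : ℕ, (T ^ j) (defect T v) ∈ defectSpace T := by
    intro j
    induction j with
    | zero => exact defect_mem_defectSpace T v
    | succ j ih => rw [pow_succ']; exact map_mem_defectSpace ih
  let b : Fin R → defectSpace T := fun j => ⟨_, hmem j⟩
  have hb : LinearIndependent ℂ b := LinearIndependent.of_comp (defectSpace T).subtype hv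
  have hspan : Submodule.span ℂ (Set.range b) = ⊤ := by
    refine hb.span_eq_top_of_card_eq_finrank' ?_
    have := hb.fintype_card_le_finrank
    simp only [Fintype.card_fin] at this ⊢
    omega
  let A : defectSpace T →ₗ[ℂ] defectSpace T :=
    ((T - z • (1 : H →L[ℂ] H) : H →L[ℂ] H) : H →ₗ[ℂ] H).restrict
      fun x hx => map_sub_smul_mem_defectSpace z hx
  let w : defectSpace T := ⟨_, hmem 0⟩
  -- From `T^(j+1) w = (T - z) T^j w + z T^j w`, all iterates lie in `range (T - z)` plus the line
  -- of `w`. So the range has codimension at most one, and the kernel dimension at most one.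
  have htop : LinearMap.range A ⊔ Submodule.span ℂ {w} = ⊤ := by
    rw [eq_top_iff, ← hspan, Submodule.span_le]
    rintro _ ⟨j, rfl⟩
    have : ∀ j : ℕ, (⟨_, hmem j⟩ : defectSpace T) ∈ LinearMap.range A ⊔ Submodule.span ℂ {w} := by
      intro j
      induction j with
      | zero => exact Submodule.mem_sup_right (Submodule.mem_span_singleton_self w)
      | succ j ih =>
        have : (⟨_, hmem (j + 1)⟩ : defectSpace T) = A ⟨_, hmem j⟩ + z • ⟨_, hmem j⟩ := by
          apply Subtype.ext
          simp [A, pow_succ']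
        rw [this]
        exact Submodule.add_mem _ (Submodule.mem_sup_left (LinearMap.mem_range_self _ _))
          (Submodule.smul_mem _ _ ih)
    exact this j
  have h3 := LinearMap.finrank_range_add_finrank_ker A
  have h4 : Module.finrank ℂ (defectSpace T) ≤ Module.finrank ℂ (LinearMap.range A) + 1 := by
    rw [← finrank_top ℂ (defectSpace T), ← htop]
    refine (Submodule.finrank_add_le_finrank_add_finrank _ _).trans ?_
    gcongr
    exact (finrank_span_le_card _).trans (by simp)
  have h5 : Module.finrank ℂ (Module.End.eigenspace (T : H →ₗ[ℂ] H) z) ≤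
      Module.finrank ℂ (LinearMap.ker A) := by
    let j : Module.End.eigenspace (T : H →ₗ[ℂ] H) z →ₗ[ℂ] LinearMap.ker A :=
      (Submodule.inclusion (eigenspace_le_defectSpace h1 h2)).codRestrict _ (by
        intro x
        rw [LinearMap.mem_ker]
        apply Subtype.ext
        exact sub_eq_zero.2 (mem_eigenspace_clm.1 x.2))
    refine LinearMap.finrank_le_finrank_of_injective (f := j) fun x y h => ?_
    exact Subtype.ext (congrArg (fun s : LinearMap.ker A => ((s : defectSpace T) : H)) h)
  omega

theorem inner_map_of_isSelfAdjoint [CompleteSpace H] {T : H →L[ℂ] H} (hT : IsSelfAdjoint T)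
    (x y : H) : inner ℂ (T x) y = inner ℂ x (T y) :=
  hT.isSymmetric x y

theorem isSelfAdjoint_defect [CompleteSpace H] {T : H →L[ℂ] H} (hT : IsSelfAdjoint T) :
    IsSelfAdjoint (defect T) :=
  (IsSelfAdjoint.one _).sub (by simpa [hT.star_eq] using IsSelfAdjoint.mul_star_self T)

/-- An orthonormal eigenbasis of the range of `1 - T²`. -/
theorem exists_eigenbasis [CompleteSpace H] {T : H →L[ℂ] H} (hT : IsSelfAdjoint T)
    [FiniteDimensional ℂ (defectSpace T)] {R : ℕ} (hR : Module.finrank ℂ (defectSpace T) = R)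
    (hs : SimpleAwayFromOne T) :
    ∃ (e : Fin R → H) (l : Fin R → ℝ), Orthonormal ℂ e ∧ Function.Injective l ∧
      (∀ i, T (e i) = (l i : ℂ) • e i) ∧ ∀ i, (l i : ℂ) ≠ 1 ∧ (l i : ℂ) ≠ -1 := by
  let A : defectSpace T →ₗ[ℂ] defectSpace T :=
    (T : H →ₗ[ℂ] H).restrict fun x hx => map_mem_defectSpace hx
  have hA : A.IsSymmetric := fun x y => hT.isSymmetric x y
  let e : Fin R → H := fun i => hA.eigenvectorBasis hR i
  have he : Orthonormal ℂ e :=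
    (hA.eigenvectorBasis hR).orthonormal.comp_linearIsometry (defectSpace T).subtypeₗᵢ
  let l := hA.eigenvalues hR
  have hTe : ∀ i, T (e i) = (l i : ℂ) • e i := fun i =>
    congrArg Subtype.val (hA.apply_eigenvectorBasis hR i)
  -- An eigenvector for `±1` lies in the kernel of the self-adjoint operator `1 - T²`, which is
  -- orthogonal to its range.
  have hl : ∀ i, 1 - (l i : ℂ) * l i ≠ 0 := by
    intro i h
    have hK : defect T (e i) = 0 := by
      rw [defect_apply, hTe, map_smul, hTe, smul_smul, ← one_smul ℂ (e i), smul_smul, mul_one,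
        ← sub_smul, h, zero_smul]
    obtain ⟨y, hy⟩ := (hA.eigenvectorBasis hR i).2
    have hy' : defect T y = e i := hy
    have : inner ℂ (e i) (e i) = 0 := by
      nth_rewrite 2 [← hy']
      rw [← inner_map_of_isSelfAdjoint (isSelfAdjoint_defect hT), hK, inner_zero_left]
    have h1 := he.1 i
    rw [inner_self_eq_zero] at this
    simp [this] at h1
  have hl' : ∀ i, (l i : ℂ) ≠ 1 ∧ (l i : ℂ) ≠ -1 := fun i =>
    ⟨fun h => hl i (by rw [h]; ring), fun h => hl i (by rw [h]; ring)⟩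
  refine ⟨e, l, he, fun i j hij => ?_, hTe, hl'⟩
  by_contra hne
  have := finiteDimensional_eigenspace (T := T) (hl' i).1 (hl' i).2
  have hfr := hs (l i) (hl' i).1 (hl' i).2
  have hmem : ∀ k : Fin 2, ![e i, e j] k ∈ Module.End.eigenspace (T : H →ₗ[ℂ] H) (l i : ℂ) := by
    intro k
    rw [mem_eigenspace_clm]
    fin_cases k
    · exact hTe i
    · simpa [hij] using hTe j
  have hli : LinearIndependent ℂ (fun k : Fin 2 =>
      (⟨_, hmem k⟩ : Module.End.eigenspace (T : H →ₗ[ℂ] H) (l i : ℂ))) := by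
    refine LinearIndependent.of_comp (Submodule.subtype _) ?_
    have h2 : Function.Injective ![i, j] := by
      intro a b
      fin_cases a <;> fin_cases b <;> simp [hne, Ne.symm hne]
    have h3 := he.linearIndependent.comp _ h2
    have h4 : (Submodule.subtype _ ∘ fun k : Fin 2 =>
        (⟨_, hmem k⟩ : Module.End.eigenspace (T : H →ₗ[ℂ] H) (l i : ℂ))) = e ∘ ![i, j] := by
      ext k
      fin_cases k <;> rfl
    rw [h4]
    exact h3
  have := hli.fintype_card_le_finrank
  simp at this
  omega

/-- A self-adjoint operator with simple eigenvalues has a cyclic vector on the range of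
`1 - T²`. -/
theorem exists_linearIndependent_of_simple [CompleteSpace H] {T : H →L[ℂ] H}
    (hT : IsSelfAdjoint T) [FiniteDimensional ℂ (defectSpace T)] {R : ℕ}
    (hR : Module.finrank ℂ (defectSpace T) = R) (hs : SimpleAwayFromOne T) :
    ∃ v : H, LinearIndependent ℂ fun j : Fin R => (T ^ (j : ℕ)) (defect T v) := by
  obtain ⟨e, l, he, hinj, hTe, hl⟩ := exists_eigenbasis hT hR hs
  -- In the basis `e` the iterates have coordinates `l i ^ j * (1 - l i²)`: a Vandermonde matrix
  -- with distinct nodes, up to non-zero row factors.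
  refine ⟨∑ i, e i, ?_⟩
  have hpow : ∀ (j : ℕ) i, (T ^ j) (e i) = (l i : ℂ) ^ j • e i := by
    intro j i
    induction j with
    | zero => simp
    | succ j ih => rw [pow_succ', mul_apply_eq_comp, ih, map_smul, hTe, smul_smul,
        pow_succ]
  have hTj : ∀ j : ℕ, (T ^ j) (defect T (∑ i, e i)) =
      ∑ i, ((l i : ℂ) ^ j * (1 - (l i : ℂ) * l i)) • e i := by
    intro j
    have : ∀ i, defect T (e i) = (1 - (l i : ℂ) * l i) • e i := by
      intro i
      rw [defect_apply, hTe, map_smul, hTe, smul_smul, sub_smul, one_smul]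
    rw [map_sum, map_sum]
    refine Finset.sum_congr rfl fun i _ => ?_
    rw [this, map_smul, hpow, smul_smul, mul_comm]
  rw [Fintype.linearIndependent_iff]
  intro c hc
  have h0 : c = 0 := by
    refine Matrix.eq_zero_of_forall_index_sum_pow_mul_eq_zero
      (f := fun i => (l i : ℂ)) (fun i j h => hinj (Complex.ofReal_injective h)) fun i => ?_
    have h1 : inner ℂ (e i) (∑ j, c j • (T ^ (j : ℕ)) (defect T (∑ i, e i))) = 0 := by
      rw [hc, inner_zero_right]
    simp only [hTj, inner_sum, inner_smul_right, orthonormal_iff_ite.1 he, mul_ite, mul_one,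
      mul_zero, Finset.sum_ite_eq, Finset.mem_univ, if_true] at h1
    have h2 := one_sub_sq_ne_zero (hl i).1 (hl i).2
    have h3 : (∑ j : Fin R, (l i : ℂ) ^ (j : ℕ) * c j) * (1 - (l i : ℂ) * l i) = 0 := by
      rw [← h1, Finset.sum_mul]
      exact Finset.sum_congr rfl fun j _ => by ring
    exact (mul_eq_zero.1 h3).resolve_right h2
  intro i
  rw [h0, Pi.zero_apply]

/-- Linear independence of `Tʲ (1 - T²) v` persists generically along analytic families. -/
theorem eventually_codiscrete_linearIndependent {T : ℝ → H →L[ℂ] H}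
    (hT : ∀ t, AnalyticAt ℝ T t) {R : ℕ} {v : H} {s : ℝ}
    (hs : LinearIndependent ℂ fun j : Fin R => (T s ^ (j : ℕ)) (defect (T s) v)) :
    ∀ᶠ t in codiscrete ℝ,
      LinearIndependent ℂ fun j : Fin R => (T t ^ (j : ℕ)) (defect (T t) v) := by
  let x : ℝ → Fin R → H := fun t j => (T t ^ (j : ℕ)) (defect (T t) v)
  -- At `t = s` this is the Gram matrix, which is invertible. Pairing with the fixed vectors at `s`
  -- keeps the entries linear in `x t j`, hence analytic in `t`.
  let M : ℝ → Matrix (Fin R) (Fin R) ℂ := fun t => Matrix.of fun i j => inner ℂ (x s i) (x t j)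
  have hM : ∀ t (c : Fin R → ℂ) i, (M t).mulVec c i = inner ℂ (x s i) (∑ j, c j • x t j) := by
    intro t c i
    simp only [Matrix.mulVec, dotProduct, inner_sum, inner_smul_right, M, Matrix.of_apply]
    exact Finset.sum_congr rfl fun j _ => mul_comm _ _
  have hxan : ∀ t j, AnalyticAt ℝ (fun t => x t j) t := by
    intro t j
    have h1 : AnalyticAt ℝ (fun t => T t ^ (j : ℕ) * defect (T t)) t := by
      refine ((hT t).pow _).mul ?_
      exact analyticAt_const.sub ((hT t).mul (hT t))
    exact ((ContinuousLinearMap.apply ℂ H v).restrictScalars ℝ).analyticAt _ |>.comp h1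
  have hdet : AnalyticOnNhd ℝ (fun t => (M t).det) Set.univ := by
    intro t _
    simp only [Matrix.det_apply']
    refine Finset.analyticAt_fun_sum _ fun σ _ => ?_
    refine analyticAt_const.mul (Finset.analyticAt_fun_prod _ fun i _ => ?_)
    exact ((innerSL ℂ (x s (σ i))).restrictScalars ℝ).analyticAt _ |>.comp (hxan t i)
  rcases hdet.eqOn_zero_or_eventually_ne_zero_of_preconnected isPreconnected_univ with h | h
  · exfalso
    obtain ⟨c, hc0, hc⟩ := Matrix.exists_mulVec_eq_zero_iff.2 (h (Set.mem_univ s))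
    refine hc0 ?_
    have h1 : ∑ j, c j • x s j = 0 := by
      rw [← inner_self_eq_zero (𝕜 := ℂ)]
      rw [sum_inner]
      refine Finset.sum_eq_zero fun i _ => ?_
      rw [inner_smul_left, ← hM, hc, Pi.zero_apply, mul_zero]
    exact funext fun i => Fintype.linearIndependent_iff.1 hs c h1 i
  · filter_upwards [h] with t ht
    rw [Fintype.linearIndependent_iff]
    intro c hc
    have : (M t).mulVec c = 0 := funext fun i => by rw [hM, hc, inner_zero_right, Pi.zero_apply]
    have h2 : c = 0 := by
      by_contra h3
      exact ht (Matrix.exists_mulVec_eq_zero_iff.1 ⟨c, h3, this⟩)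
    intro i
    rw [h2, Pi.zero_apply]

/-- For self-adjoint `T` the norm of `(T - l)⁻¹` is its spectral radius. Were there no eigenvalue
within `g` of `l`, this norm would be at most `1/g`, against the approximate eigenvector `e`. The
conditions on `g` keep the disc away from `±1`, so that non-eigenvalues in it are regular points. -/
theorem exists_eigenvalue_near [CompleteSpace H] {T : H →L[ℂ] H} (hT : IsSelfAdjoint T)
    [FiniteDimensional ℂ (defectSpace T)] {l g : ℝ} (hg : 0 < g) (h1 : g < ‖(l : ℂ) - 1‖)
    (h2 : g < ‖(l : ℂ) + 1‖) {e : H} (he : ‖e‖ = 1) (hTe : ‖T e - (l : ℂ) • e‖ < g) :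
    ∃ z : ℂ, ‖z - l‖ ≤ g ∧ z ≠ 1 ∧ z ≠ -1 ∧
      Module.End.eigenspace (T : H →ₗ[ℂ] H) z ≠ ⊥ := by
  by_contra! hcon
  have hunit : ∀ z : ℂ, ‖z - l‖ ≤ g → IsUnit (T - z • (1 : H →L[ℂ] H)) := by
    intro z hz
    have hz1 : z ≠ 1 := by
      rintro rfl
      rw [norm_sub_rev] at hz
      linarith
    have hz2 : z ≠ -1 := by
      rintro rfl
      rw [norm_sub_rev, sub_neg_eq_add] at hz
      linarith
    exact isUnit_sub_of_eigenspace_eq_bot hz1 hz2 (hcon z hz hz1 hz2)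
  obtain ⟨S, hS⟩ := hunit l (by simpa using hg.le)
  have hSsa : IsSelfAdjoint (S : H →L[ℂ] H) := by
    rw [hS]
    refine hT.sub ?_
    rw [isSelfAdjoint_iff, star_smul, star_one]
    simp
  have hSinv : IsSelfAdjoint ((S⁻¹ : (H →L[ℂ] H)ˣ) : H →L[ℂ] H) := by
    have h : star S = S := Units.ext hSsa.star_eq
    rw [isSelfAdjoint_iff, ← Units.coe_star, star_inv, h]
  have hrad : spectralRadius ℂ ((S⁻¹ : (H →L[ℂ] H)ˣ) : H →L[ℂ] H) ≤ ENNReal.ofReal g⁻¹ := by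
    refine iSup₂_le fun k hk => ?_
    rw [← enorm_eq_nnnorm, ← ofReal_norm]
    refine ENNReal.ofReal_le_ofReal ?_
    by_contra! hlt
    have hk0 : k ≠ 0 := by
      rintro rfl
      rw [norm_zero] at hlt
      exact absurd hlt (not_lt.2 (inv_pos.2 hg).le)
    -- A spectral value `k` of the inverse with `‖k‖ > 1/g` would make `l + k⁻¹` a spectral value of
    -- `T` within `g` of `l`.
    have hk1 : k⁻¹ ∈ spectrum ℂ (S : H →L[ℂ] H) := by
      have := spectrum.inv_mem_iff (r := (Units.mk0 k hk0)⁻¹) (a := S)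
      simpa using this.2 (by simpa using hk)
    refine hk1 ?_
    have h3 := (hunit (l + k⁻¹) (by
      rw [add_sub_cancel_left, norm_inv]
      exact (inv_le_comm₀ hg (norm_pos_iff.2 hk0)).1 hlt.le)).neg
    rw [spectrum.mem_resolventSet_iff, hS, Algebra.algebraMap_eq_smul_one]
    convert h3 using 1
    module
  have hnorm : ‖((S⁻¹ : (H →L[ℂ] H)ˣ) : H →L[ℂ] H)‖ ≤ g⁻¹ := by
    rw [hSinv.spectralRadius_eq_nnnorm, ← enorm_eq_nnnorm, ← ofReal_norm] at hrad
    exact (ENNReal.ofReal_le_ofReal_iff (inv_pos.2 hg).le).1 hrad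
  have h4 : ((S⁻¹ : (H →L[ℂ] H)ˣ) : H →L[ℂ] H) ((S : H →L[ℂ] H) e) = e := by
    rw [← mul_apply_eq_comp, S.inv_mul]
    rfl
  have h5 : ‖e‖ ≤ g⁻¹ * ‖T e - (l : ℂ) • e‖ := by
    calc ‖e‖ = ‖((S⁻¹ : (H →L[ℂ] H)ˣ) : H →L[ℂ] H) ((S : H →L[ℂ] H) e)‖ := by rw [h4]
      _ ≤ ‖((S⁻¹ : (H →L[ℂ] H)ˣ) : H →L[ℂ] H)‖ * ‖(S : H →L[ℂ] H) e‖ :=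
        ContinuousLinearMap.le_opNorm _ _
      _ ≤ _ := by
        rw [hS]
        exact mul_le_mul_of_nonneg_right hnorm (norm_nonneg _)
  rw [he] at h5
  have : g⁻¹ * ‖T e - (l : ℂ) • e‖ < 1 := by
    rw [inv_mul_lt_one₀ hg]
    exact hTe
  linarith

/-- Near a simple eigenvalue with eigenvector `e`, the operator is bounded below on `eᗮ`. -/
theorem exists_lower_bound_of_simple [CompleteSpace H] {T : H →L[ℂ] H} (hT : IsSelfAdjoint T)
    [FiniteDimensional ℂ (defectSpace T)] (hs : SimpleAwayFromOne T) {l : ℝ}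
    (h1 : (l : ℂ) ≠ 1) (h2 : (l : ℂ) ≠ -1) {e : H} (he : ‖e‖ = 1) (hTe : T e = (l : ℂ) • e) :
    ∃ c > 0, ∀ f : H, inner ℂ e f = 0 → c * ‖f‖ ≤ ‖T f - (l : ℂ) • f‖ := by
  -- This projection onto `e` moves the simple eigenvalue `l` to `l + 1` and does not change `T` on
  -- `eᗮ`. Thus `T + P - l` is injective, and `1 - (T + P)²` still has finite rank.
  let P : H →L[ℂ] H := (innerSL ℂ e).smulRight e
  have hP : ∀ x, P x = inner ℂ e x • e := fun x => rfl
  have hee : inner ℂ e e = (1 : ℂ) := by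
    rw [inner_self_eq_norm_sq_to_K, he]
    simp
  have hfd : FiniteDimensional ℂ (defectSpace (T + P)) := by
    have hle : defectSpace (T + P) ≤ defectSpace T ⊔ Submodule.span ℂ {e} := by
      rintro _ ⟨x, rfl⟩
      have : (defect (T + P)) x = defect T x +
          (-(inner ℂ e x * (l : ℂ) + inner ℂ e (T x) + inner ℂ e x)) • e := by
        simp only [defect_apply, add_apply, map_add, hP, map_smul, hTe,
          hee]
        module
      refine Submodule.mem_sup.2 ⟨defect T x, defect_mem_defectSpace T x, _,
        Submodule.smul_mem _ _ (Submodule.mem_span_singleton_self e), this.symm⟩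
    exact Submodule.finiteDimensional_of_le hle
  have hbot : Module.End.eigenspace ((T + P : H →L[ℂ] H) : H →ₗ[ℂ] H) (l : ℂ) = ⊥ := by
    rw [eq_bot_iff]
    intro x hx
    rw [mem_eigenspace_clm, add_apply, hP] at hx
    have hx0 : inner ℂ e x = (0 : ℂ) := by
      have h3 : inner ℂ e (T x + inner ℂ e x • e) = inner ℂ e ((l : ℂ) • x) := by rw [hx]
      rw [inner_add_right, ← inner_map_of_isSelfAdjoint hT, hTe, inner_smul_left,
        inner_smul_right, inner_smul_right, hee] at h3
      simpa using h3
    rw [hx0, zero_smul, add_zero] at hx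
    have := finiteDimensional_eigenspace (T := T) h1 h2
    obtain ⟨w, hw⟩ := finrank_le_one_iff.1 (hs l h1 h2)
    obtain ⟨a, ha⟩ := hw ⟨e, mem_eigenspace_clm.2 hTe⟩
    obtain ⟨b, hb⟩ := hw ⟨x, mem_eigenspace_clm.2 hx⟩
    have ha' : a • (w : H) = e := congrArg Subtype.val ha
    have hb' : b • (w : H) = x := congrArg Subtype.val hb
    have ha0 : a ≠ 0 := by
      rintro rfl
      rw [zero_smul] at ha'
      rw [← ha', norm_zero] at he
      exact zero_ne_one he
    have hxe : x = (b * a⁻¹) • e := by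
      rw [← ha', smul_smul, inv_mul_cancel_right₀ ha0, hb']
    rw [hxe, inner_smul_right, hee, mul_one] at hx0
    rw [Submodule.mem_bot, hxe, hx0, zero_smul]
  obtain ⟨S, hS⟩ := isUnit_sub_of_eigenspace_eq_bot h1 h2 hbot
  refine ⟨(‖((S⁻¹ : (H →L[ℂ] H)ˣ) : H →L[ℂ] H)‖ + 1)⁻¹, by positivity, fun f hf => ?_⟩
  have h4 : ((S⁻¹ : (H →L[ℂ] H)ˣ) : H →L[ℂ] H) ((S : H →L[ℂ] H) f) = f := by
    rw [← mul_apply_eq_comp, S.inv_mul]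
    rfl
  have h5 : (S : H →L[ℂ] H) f = T f - (l : ℂ) • f := by
    rw [hS]
    simp [hP, hf]
  rw [inv_mul_le_iff₀ (by positivity), ← h5]
  calc ‖f‖ = ‖((S⁻¹ : (H →L[ℂ] H)ˣ) : H →L[ℂ] H) ((S : H →L[ℂ] H) f)‖ := by rw [h4]
    _ ≤ ‖((S⁻¹ : (H →L[ℂ] H)ˣ) : H →L[ℂ] H)‖ * ‖(S : H →L[ℂ] H) f‖ :=
      ContinuousLinearMap.le_opNorm _ _
    _ ≤ _ := mul_le_mul_of_nonneg_right (by linarith) (norm_nonneg _)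

/-- Simplicity is stable under small perturbations that increase the rank of `1 - T²` by at most
one. -/
theorem exists_simple_of_norm_sub_lt [CompleteSpace H] {T₀ : H →L[ℂ] H} (hT₀ : IsSelfAdjoint T₀)
    [FiniteDimensional ℂ (defectSpace T₀)] (hs : SimpleAwayFromOne T₀) :
    ∃ δ > 0, ∀ T : H →L[ℂ] H, IsSelfAdjoint T → ‖T - T₀‖ < δ →
      FiniteDimensional ℂ (defectSpace T) →
      Module.finrank ℂ (defectSpace T) ≤ Module.finrank ℂ (defectSpace T₀) + 1 →
      SimpleAwayFromOne T := by
  obtain ⟨e, l, he, hinj, hTe, hl⟩ := exists_eigenbasis hT₀ rfl hs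
  choose c hc hlow using fun i => exists_lower_bound_of_simple hT₀ hs (hl i).1 (hl i).2 (he.1 i)
    (hTe i)
  -- `g` is small against the lower bounds `c i`, the distances of the eigenvalues from `±1`, and
  -- half their mutual distances.
  have hev : ∀ᶠ g : ℝ in 𝓝[>] 0, ∀ i, 2 * g < c i ∧ g < ‖(l i : ℂ) - 1‖ ∧ g < ‖(l i : ℂ) + 1‖ ∧
      ∀ j, i ≠ j → 2 * g < ‖(l i : ℂ) - l j‖ := by
    have hlt : ∀ a : ℝ, 0 < a → ∀ᶠ g : ℝ in 𝓝[>] 0, g < a := fun a ha =>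
      mem_nhdsWithin_of_mem_nhds (Iio_mem_nhds ha)
    have hlt2 : ∀ a : ℝ, 0 < a → ∀ᶠ g : ℝ in 𝓝[>] 0, 2 * g < a := fun a ha =>
      (hlt (a / 2) (by positivity)).mono fun g hg => by linarith
    refine eventually_all.2 fun i => ?_
    refine (hlt2 _ (hc i)).and ((hlt _ ?_).and ((hlt _ ?_).and (eventually_all.2 fun j => ?_)))
    · exact norm_pos_iff.2 (sub_ne_zero.2 (hl i).1)
    · rw [← sub_neg_eq_add]
      exact norm_pos_iff.2 (sub_ne_zero.2 (hl i).2)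
    · by_cases hij : i = j
      · simp [hij]
      · have : (l i : ℂ) ≠ l j := fun h => hij (hinj (Complex.ofReal_injective h))
        exact (hlt2 _ (norm_pos_iff.2 (sub_ne_zero.2 this))).mono fun g hg _ => hg
  obtain ⟨g, hg, hg0⟩ := (hev.and self_mem_nhdsWithin).exists
  have hg0 : 0 < g := hg0
  refine ⟨g, hg0, fun T hT hTT hfd hrank z hz1 hz2 => ?_⟩
  have hdiff : ∀ x, x ≠ 0 → ‖T x - T₀ x‖ < g * ‖x‖ := fun x hx =>
    ((T - T₀).le_opNorm x).trans_lt (mul_lt_mul_of_pos_right hTT (norm_pos_iff.2 hx))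
  have hne : ∀ i, e i ≠ 0 := he.ne_zero
  choose m hm hm1 hm2 hmbot using fun i => exists_eigenvalue_near hT hg0 (hg i).2.1 (hg i).2.2.1
    (he.1 i) (by
      rw [← hTe i]
      simpa [he.1 i] using hdiff (e i) (hne i))
  have hfin := fun i => finiteDimensional_eigenspace (T := T) (hm1 i) (hm2 i)
  have hfinz := finiteDimensional_eigenspace (T := T) hz1 hz2
  -- A two-dimensional eigenspace would contain a vector orthogonal to `e i`. There `T₀ - l i` is
  -- bounded below by `c i > 2 g`, whereas `T` is within `g` of `T₀` and `m i` within `g` of `l i`.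
  have hmone : ∀ i, Module.finrank ℂ (Module.End.eigenspace (T : H →ₗ[ℂ] H) (m i)) ≤ 1 := by
    intro i
    by_contra! hlt
    let L : Module.End.eigenspace (T : H →ₗ[ℂ] H) (m i) →ₗ[ℂ] ℂ :=
      (innerSL ℂ (e i) : H →ₗ[ℂ] ℂ) ∘ₗ Submodule.subtype _
    obtain ⟨f, hf, hf0⟩ := Submodule.exists_mem_ne_zero_of_ne_bot
      (LinearMap.ker_ne_bot_of_finrank_lt (f := L) (by rwa [Module.finrank_self]))
    have hf0' : (f : H) ≠ 0 := fun h => hf0 (Subtype.ext h)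
    have h3 := hlow i f hf
    have h4 := mem_eigenspace_clm.1 f.2
    have h5 : T₀ f - (l i : ℂ) • (f : H) = -(T f - T₀ f) + (m i - l i) • (f : H) := by
      rw [h4]
      module
    have h6 : ‖T₀ f - (l i : ℂ) • (f : H)‖ ≤ ‖T f - T₀ f‖ + ‖m i - l i‖ * ‖(f : H)‖ := by
      rw [h5]
      refine (norm_add_le _ _).trans ?_
      rw [norm_neg, norm_smul]
    have h7 := hdiff f hf0'
    have h8 := mul_le_mul_of_nonneg_right (hm i) (norm_nonneg (f : H))
    have h9 := mul_lt_mul_of_pos_right (hg i).1 (norm_pos_iff.2 hf0')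
    linarith
  by_contra! hlt
  have hzm : ∀ i, m i ≠ z := by
    rintro i rfl
    exact absurd (hmone i) (not_le.2 hlt)
  have hminj : Function.Injective m := by
    intro i j hij
    by_contra hne
    have h3 := (hg i).2.2.2 j hne
    have h4 : (l i : ℂ) - l j = (m j - l j) - (m i - l i) := by rw [hij]; ring
    rw [h4] at h3
    have := norm_sub_le (m j - l j) (m i - l i)
    linarith [hm i, hm j]
  choose f hf hf0 using fun i => Submodule.exists_mem_ne_zero_of_ne_bot (hmbot i)
  have hind : LinearIndependent ℂ f :=
    Module.End.eigenvectors_linearIndependent' (T : H →ₗ[ℂ] H) m hminj f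
      fun i => ⟨hf i, hf0 i⟩
  -- A multiple eigenvalue `z` differs from all `m i`. Its eigenspace and the `n` eigenvectors `f i`
  -- are independent, which needs rank at least `n + 2`, one more than allowed.
  have hdisj : Disjoint (Module.End.eigenspace (T : H →ₗ[ℂ] H) z)
      (Submodule.span ℂ (Set.range f)) := by
    refine ((Module.End.eigenspaces_iSupIndep (T : H →ₗ[ℂ] H)) z).mono_right ?_
    rw [Submodule.span_le]
    rintro _ ⟨i, rfl⟩
    exact Submodule.mem_iSup_of_mem (m i) (Submodule.mem_iSup_of_mem (hzm i) (hf i))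
  have : FiniteDimensional ℂ (Submodule.span ℂ (Set.range f)) :=
    FiniteDimensional.span_of_finite ℂ (Set.finite_range f)
  have hsup := Submodule.finrank_sup_add_finrank_inf_eq
    (Module.End.eigenspace (T : H →ₗ[ℂ] H) z) (Submodule.span ℂ (Set.range f))
  rw [hdisj.eq_bot, finrank_bot, finrank_span_eq_card hind, Fintype.card_fin] at hsup
  have hle : Module.End.eigenspace (T : H →ₗ[ℂ] H) z ⊔ Submodule.span ℂ (Set.range f) ≤
      defectSpace T := by
    refine sup_le (eigenspace_le_defectSpace hz1 hz2) ?_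
    rw [Submodule.span_le]
    rintro _ ⟨i, rfl⟩
    exact eigenspace_le_defectSpace (hm1 i) (hm2 i) (hf i)
  have := Submodule.finrank_mono hle
  omega

/-- Along an analytic family of self-adjoint operators for which the rank of `1 - T²` is
generically one more than at `t = 0`, simplicity at `t = 0` implies generic simplicity. -/
theorem eventually_codiscrete_simple [CompleteSpace H] {T : ℝ → H →L[ℂ] H}
    (hT : ∀ t, AnalyticAt ℝ T t) (hsa : ∀ t, IsSelfAdjoint (T t))
    [∀ t, FiniteDimensional ℂ (defectSpace (T t))] {R : ℕ}
    (hR : ∀ t, Module.finrank ℂ (defectSpace (T t)) ≤ R + 1)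
    (hR0 : Module.finrank ℂ (defectSpace (T 0)) = R)
    (hRg : ∀ᶠ t in codiscrete ℝ, Module.finrank ℂ (defectSpace (T t)) = R + 1)
    (hs : SimpleAwayFromOne (T 0)) : ∀ᶠ t in codiscrete ℝ, SimpleAwayFromOne (T t) := by
  obtain ⟨δ, hδ, h⟩ := exists_simple_of_norm_sub_lt (hsa 0) hs
  have hcont : ∀ᶠ t in 𝓝[≠] (0 : ℝ), ‖T t - T 0‖ < δ := by
    have := (hT 0).continuousAt.eventually (Metric.ball_mem_nhds (T 0) hδ)
    refine (this.filter_mono nhdsWithin_le_nhds).mono fun t ht => ?_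
    rwa [← dist_eq_norm]
  have hRg' : ∀ᶠ t in 𝓝[≠] (0 : ℝ), Module.finrank ℂ (defectSpace (T t)) = R + 1 := by
    rw [Filter.Eventually, mem_codiscrete] at hRg
    have h0 := disjoint_principal_right.1 (hRg 0)
    rwa [compl_compl] at h0
  -- One parameter near `0` with full rank is enough: it is simple by stability, and its cyclic
  -- vector then works for generic `t`.
  obtain ⟨s, hs1, hs2⟩ := (hcont.and hRg').exists
  have hsimp := h (T s) (hsa s) hs1 inferInstance (by rw [hs2, hR0])
  obtain ⟨v, hv⟩ := exists_linearIndependent_of_simple (hsa s) hs2 hsimp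
  filter_upwards [eventually_codiscrete_linearIndependent hT hv] with t ht
  exact simpleAwayFromOne_of_linearIndependent (hR t) ht

end OperatorTheory

/-! ### Cauchy kernels and their Fourier transforms. -/

noncomputable section HardySpace

open Complex

/-- On `L¹ ∩ L²` the `L²` inverse Fourier transform is given by the Fourier integral. -/
theorem fourierInv_toLp_eq {f : ℝ → C2} (h1 : Integrable f) (h2 : MemLp f 2)
    (h3 : MemLp (𝓕⁻ f) 2) : 𝓕⁻ (h2.toLp f) = h3.toLp (𝓕⁻ f) := by
  -- The two sides are compared as tempered distributions, where the Fourier integral can be moved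
  -- from the test function to `f`.
  have hinj : Function.Injective (Lp.toTemperedDistributionCLM C2 (volume : Measure ℝ) 2) :=
    LinearMap.ker_eq_bot.1 Lp.ker_toTemperedDistributionCLM_eq_bot
  apply hinj
  rw [Lp.toTemperedDistributionCLM_apply, Lp.toTemperedDistributionCLM_apply,
    ← Lp.fourierInv_toTemperedDistribution_eq]
  ext1 g
  rw [TemperedDistribution.fourierInv_apply, Lp.toTemperedDistribution_apply,
    Lp.toTemperedDistribution_apply]
  have e1 : ∫ x, (𝓕⁻ g : SchwartzMap ℝ ℂ) x • (h2.toLp f) x = ∫ x, (𝓕⁻ (g : ℝ → ℂ)) x • f x := by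
    refine integral_congr_ae ?_
    filter_upwards [h2.coeFn_toLp] with x hx
    rw [hx, SchwartzMap.fourierInv_coe]
  have e2 : ∫ x, g x • (h3.toLp (𝓕⁻ f)) x = ∫ x, g x • (𝓕⁻ f) x := by
    refine integral_congr_ae ?_
    filter_upwards [h3.coeFn_toLp] with x hx
    rw [hx]
  rw [e1, e2]
  have := VectorFourier.integral_fourierIntegral_smul_eq_flip (μ := volume) (ν := volume)
    (L := -innerₗ ℝ) (f := (g : ℝ → ℂ)) (g := f) Real.continuous_fourierChar
    (by simp only [LinearMap.neg_apply, innerₗ_apply_apply]; fun_prop) g.integrable h1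
  have hflip : (-innerₗ ℝ).flip = -innerₗ ℝ := by
    ext
    simp
  rw [hflip] at this
  exact this

/-- The one-sided exponential `ξ ↦ e^{aξ} v` on `ξ > 0`. -/
def expPos (a : ℂ) (v : C2) (ξ : ℝ) : C2 := (Set.Ioi (0 : ℝ)).indicator (fun ξ => cexp (a * ξ) • v) ξ

/-- The one-sided exponential `ξ ↦ e^{aξ} v` on `ξ ≤ 0`. -/
def expNeg (a : ℂ) (v : C2) (ξ : ℝ) : C2 := (Set.Iic (0 : ℝ)).indicator (fun ξ => cexp (a * ξ) • v) ξ

theorem integrable_expPos {a : ℂ} (ha : a.re < 0) (v : C2) : Integrable (expPos a v) := by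
  rw [show expPos a v = (Set.Ioi (0 : ℝ)).indicator (fun ξ => cexp (a * ξ) • v) from rfl,
    integrable_indicator_iff measurableSet_Ioi]
  exact (integrableOn_exp_mul_complex_Ioi ha 0).smul_const v

theorem integrable_expNeg {a : ℂ} (ha : 0 < a.re) (v : C2) : Integrable (expNeg a v) := by
  rw [show expNeg a v = (Set.Iic (0 : ℝ)).indicator (fun ξ => cexp (a * ξ) • v) from rfl,
    integrable_indicator_iff measurableSet_Iic]
  exact (integrableOn_exp_mul_complex_Iic ha 0).smul_const v

theorem norm_exp_smul_sq (a : ℂ) (v : C2) (ξ : ℝ) :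
    ‖cexp (a * ξ) • v‖ ^ 2 = Real.exp (2 * a.re * ξ) * ‖v‖ ^ 2 := by
  rw [norm_smul, mul_pow, norm_exp, ← Real.exp_nat_mul]
  congr 2
  simp
  ring

theorem memLp_expPos {a : ℂ} (ha : a.re < 0) (v : C2) : MemLp (expPos a v) 2 := by
  rw [memLp_two_iff_integrable_sq_norm (integrable_expPos ha v).1]
  have : (fun ξ => ‖expPos a v ξ‖ ^ 2) =
      (Set.Ioi (0 : ℝ)).indicator (fun ξ => Real.exp (2 * a.re * ξ) * ‖v‖ ^ 2) := by
    ext ξ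
    by_cases h : ξ ∈ Set.Ioi (0 : ℝ)
    · simp only [expPos, Set.indicator_of_mem h, norm_exp_smul_sq]
    · simp [expPos, Set.indicator_of_notMem h]
  rw [this, integrable_indicator_iff measurableSet_Ioi]
  exact (integrableOn_exp_mul_Ioi (by linarith) 0).mul_const _

theorem memLp_expNeg {a : ℂ} (ha : 0 < a.re) (v : C2) : MemLp (expNeg a v) 2 := by
  rw [memLp_two_iff_integrable_sq_norm (integrable_expNeg ha v).1]
  have : (fun ξ => ‖expNeg a v ξ‖ ^ 2) =
      (Set.Iic (0 : ℝ)).indicator (fun ξ => Real.exp (2 * a.re * ξ) * ‖v‖ ^ 2) := by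
    ext ξ
    by_cases h : ξ ∈ Set.Iic (0 : ℝ)
    · simp only [expNeg, Set.indicator_of_mem h, norm_exp_smul_sq]
    · simp [expNeg, Set.indicator_of_notMem h]
  rw [this, integrable_indicator_iff measurableSet_Iic]
  exact (integrableOn_exp_mul_Iic (by linarith) 0).mul_const _

theorem fourierInv_expPos {a : ℂ} (ha : a.re < 0) (v : C2) (x : ℝ) :
    𝓕⁻ (expPos a v) x = (-(a + 2 * Real.pi * I * x)⁻¹) • v := by
  rw [Real.fourierInv_eq']
  have h1 : (fun ξ : ℝ => cexp (((2 * Real.pi * inner ℝ ξ x : ℝ) : ℂ) * I) • expPos a v ξ) =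
      (Set.Ioi (0 : ℝ)).indicator (fun ξ => cexp ((a + 2 * Real.pi * I * x) * ξ) • v) := by
    ext1 ξ
    by_cases h : ξ ∈ Set.Ioi (0 : ℝ)
    · simp only [expPos, Set.indicator_of_mem h, smul_smul, ← Complex.exp_add]
      congr 2
      simp
      ring
    · simp [expPos, Set.indicator_of_notMem h]
  have hre : (a + 2 * Real.pi * I * x).re < 0 := by simpa using ha
  rw [h1, integral_indicator measurableSet_Ioi, integral_smul_const,
    integral_exp_mul_complex_Ioi hre]
  congr 1
  simp
  ring

theorem fourierInv_expNeg {a : ℂ} (ha : 0 < a.re) (v : C2) (x : ℝ) :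
    𝓕⁻ (expNeg a v) x = (a + 2 * Real.pi * I * x)⁻¹ • v := by
  rw [Real.fourierInv_eq']
  have h1 : (fun ξ : ℝ => cexp (((2 * Real.pi * inner ℝ ξ x : ℝ) : ℂ) * I) • expNeg a v ξ) =
      (Set.Iic (0 : ℝ)).indicator (fun ξ => cexp ((a + 2 * Real.pi * I * x) * ξ) • v) := by
    ext1 ξ
    by_cases h : ξ ∈ Set.Iic (0 : ℝ)
    · simp only [expNeg, Set.indicator_of_mem h, smul_smul, ← Complex.exp_add]
      congr 2
      simp
      ring
    · simp [expNeg, Set.indicator_of_notMem h]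
  have hre : 0 < (a + 2 * Real.pi * I * x).re := by simpa using ha
  rw [h1, integral_indicator measurableSet_Iic, integral_smul_const,
    integral_exp_mul_complex_Iic hre]
  congr 1
  simp

theorem ofReal_sub_ne_zero {α : ℂ} (hα : α.im ≠ 0) (x : ℝ) : (x : ℂ) - α ≠ 0 := by
  intro h
  have := congrArg Complex.im h
  simp at this
  exact hα this

theorem abs_im_le_norm_ofReal_sub (α : ℂ) (x : ℝ) : |α.im| ≤ ‖(x : ℂ) - α‖ := by
  have := Complex.abs_im_le_norm ((x : ℂ) - α)
  simpa using this

/-- The Cauchy kernel `x ↦ v / (x - α)`. -/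
def cauchyFn (α : ℂ) (v : C2) (x : ℝ) : C2 := ((x : ℂ) - α)⁻¹ • v

theorem continuous_inv_ofReal_sub {α : ℂ} (hα : α.im ≠ 0) :
    Continuous fun x : ℝ => ((x : ℂ) - α)⁻¹ := by
  have := ofReal_sub_ne_zero hα
  fun_prop (disch := assumption)

/-- Comparison with `1 / (1 + x²)`: the bounds `|Im α| ≤ |x - α|` and `|x| ≤ |x - α| + |α|` control
`1` and `x²` by multiples of `|x - α|²`. -/
theorem memLp_cauchyFn {α : ℂ} (hα : α.im ≠ 0) (v : C2) : MemLp (cauchyFn α v) 2 := by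
  have hc : Continuous (cauchyFn α v) := (continuous_inv_ofReal_sub hα).smul continuous_const
  rw [memLp_two_iff_integrable_sq_norm hc.aestronglyMeasurable]
  have hb : 0 < |α.im| := abs_pos.2 hα
  refine ((integrable_inv_one_add_sq.const_mul
    (((1 + 2 * ‖α‖ ^ 2) / |α.im| ^ 2 + 2) * ‖v‖ ^ 2))).mono' (by fun_prop) ?_
  refine Eventually.of_forall fun x => ?_
  have h1 := abs_im_le_norm_ofReal_sub α x
  have h0 : 0 < ‖(x : ℂ) - α‖ := hb.trans_le h1
  rw [Real.norm_of_nonneg (by positivity), cauchyFn, norm_smul, mul_pow, norm_inv]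
  have h2 : 1 + x ^ 2 ≤ ((1 + 2 * ‖α‖ ^ 2) / |α.im| ^ 2 + 2) * ‖(x : ℂ) - α‖ ^ 2 := by
    have h3 : |x| ≤ ‖(x : ℂ) - α‖ + ‖α‖ := by
      have := norm_add_le ((x : ℂ) - α) α
      simpa using this
    have h4 : x ^ 2 ≤ 2 * ‖(x : ℂ) - α‖ ^ 2 + 2 * ‖α‖ ^ 2 := by
      rw [← sq_abs x]
      nlinarith [abs_nonneg x, norm_nonneg α, sq_nonneg (‖(x : ℂ) - α‖ - ‖α‖)]
    have h5 : 1 ≤ ‖(x : ℂ) - α‖ ^ 2 / |α.im| ^ 2 := by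
      rw [one_le_div (by positivity)]
      exact pow_le_pow_left₀ hb.le h1 2
    have h6 : (1 + 2 * ‖α‖ ^ 2) * 1 ≤ (1 + 2 * ‖α‖ ^ 2) * (‖(x : ℂ) - α‖ ^ 2 / |α.im| ^ 2) :=
      mul_le_mul_of_nonneg_left h5 (by positivity)
    calc 1 + x ^ 2 ≤ (1 + 2 * ‖α‖ ^ 2) * (‖(x : ℂ) - α‖ ^ 2 / |α.im| ^ 2)
          + 2 * ‖(x : ℂ) - α‖ ^ 2 := by linarith
      _ = _ := by ring
  have h7 : (‖(x : ℂ) - α‖⁻¹) ^ 2 ≤ ((1 + 2 * ‖α‖ ^ 2) / |α.im| ^ 2 + 2) * (1 + x ^ 2)⁻¹ := by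
    rw [inv_pow, ← div_eq_mul_inv, inv_le_comm₀ (by positivity) (by positivity), inv_div,
      div_le_iff₀ (by positivity), mul_comm]
    exact h2
  calc _ ≤ ((1 + 2 * ‖α‖ ^ 2) / |α.im| ^ 2 + 2) * (1 + x ^ 2)⁻¹ * ‖v‖ ^ 2 :=
        mul_le_mul_of_nonneg_right h7 (by positivity)
    _ = _ := by ring

/-- The Cauchy kernel as an element of `L²`. -/
def cauchyLp {α : ℂ} (hα : α.im ≠ 0) (v : C2) : L2C2 := (memLp_cauchyFn hα v).toLp _

theorem two_pi_I_ne : (2 * Real.pi * I : ℂ) ≠ 0 := by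
  simp [Real.pi_ne_zero, I_ne_zero]

/-- The Cauchy kernel is not integrable, so the computation runs backwards: the inverse Fourier
integral of the integrable one-sided exponential is evaluated. -/
theorem fourier_cauchyLp_of_neg {α : ℂ} (hα : α.im < 0) (v : C2) :
    𝓕 (cauchyLp hα.ne v) =
      (-(2 * Real.pi * I) : ℂ) • (memLp_expPos (a := -(2 * Real.pi * I) * α)
        (by simpa using mul_neg_of_pos_of_neg Real.two_pi_pos hα) v).toLp _ := by
  have ha : (-(2 * Real.pi * I) * α).re < 0 := by
    simpa using mul_neg_of_pos_of_neg Real.two_pi_pos hα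
  have hF : 𝓕⁻ (expPos (-(2 * Real.pi * I) * α) v) =
      (-(2 * Real.pi * I)⁻¹ : ℂ) • cauchyFn α v := by
    ext1 x
    rw [fourierInv_expPos ha, Pi.smul_apply, cauchyFn, smul_smul]
    congr 1
    have : -(2 * Real.pi * I) * α + 2 * Real.pi * I * x = 2 * Real.pi * I * (x - α) := by ring
    rw [this, mul_inv]
    ring
  have h3 : MemLp (𝓕⁻ (expPos (-(2 * Real.pi * I) * α) v)) 2 := by
    rw [hF]
    exact (memLp_cauchyFn hα.ne v).const_smul _
  have h4 := fourierInv_toLp_eq (integrable_expPos ha v) (memLp_expPos ha v) h3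
  have h5 : h3.toLp _ = (-(2 * Real.pi * I)⁻¹ : ℂ) • cauchyLp hα.ne v := by
    rw [cauchyLp, ← MemLp.toLp_const_smul]
    exact MemLp.toLp_congr _ _ (by rw [hF])
  rw [h5] at h4
  have h6 : cauchyLp hα.ne v = (-(2 * Real.pi * I) : ℂ) • 𝓕⁻ ((memLp_expPos ha v).toLp _) := by
    rw [h4, smul_smul, neg_mul_neg, mul_inv_cancel₀ two_pi_I_ne, one_smul]
  rw [h6, FourierTransform.fourier_smul, FourierTransform.fourier_fourierInv_eq]

theorem fourier_cauchyLp_of_pos {α : ℂ} (hα : 0 < α.im) (v : C2) :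
    𝓕 (cauchyLp hα.ne' v) =
      (2 * Real.pi * I : ℂ) • (memLp_expNeg (a := -(2 * Real.pi * I) * α)
        (by simpa using mul_pos Real.two_pi_pos hα) v).toLp _ := by
  have ha : 0 < (-(2 * Real.pi * I) * α).re := by
    simpa using mul_pos Real.two_pi_pos hα
  have hF : 𝓕⁻ (expNeg (-(2 * Real.pi * I) * α) v) =
      ((2 * Real.pi * I)⁻¹ : ℂ) • cauchyFn α v := by
    ext1 x
    rw [fourierInv_expNeg ha, Pi.smul_apply, cauchyFn, smul_smul]
    congr 1
    have : -(2 * Real.pi * I) * α + 2 * Real.pi * I * x = 2 * Real.pi * I * (x - α) := by ring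
    rw [this, mul_inv]
  have h3 : MemLp (𝓕⁻ (expNeg (-(2 * Real.pi * I) * α) v)) 2 := by
    rw [hF]
    exact (memLp_cauchyFn hα.ne' v).const_smul _
  have h4 := fourierInv_toLp_eq (integrable_expNeg ha v) (memLp_expNeg ha v) h3
  have h5 : h3.toLp _ = ((2 * Real.pi * I)⁻¹ : ℂ) • cauchyLp hα.ne' v := by
    rw [cauchyLp, ← MemLp.toLp_const_smul]
    exact MemLp.toLp_congr _ _ (by rw [hF])
  rw [h5] at h4
  have h6 : cauchyLp hα.ne' v = (2 * Real.pi * I : ℂ) • 𝓕⁻ ((memLp_expNeg ha v).toLp _) := by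
    rw [h4, smul_smul, mul_inv_cancel₀ two_pi_I_ne, one_smul]
  rw [h6, FourierTransform.fourier_smul, FourierTransform.fourier_fourierInv_eq]

theorem cauchyLp_mem_hardySpace {α : ℂ} (hα : α.im < 0) (v : C2) :
    cauchyLp hα.ne v ∈ hardySpace := by
  rw [mem_hardySpace_iff, fourier_cauchyLp_of_neg hα]
  have ha : (-(2 * Real.pi * I) * α).re < 0 := by
    simpa using mul_neg_of_pos_of_neg Real.two_pi_pos hα
  filter_upwards [Lp.coeFn_smul (-(2 * Real.pi * I) : ℂ) ((memLp_expPos ha v).toLp _),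
    (memLp_expPos ha v).coeFn_toLp] with ξ h1 h2 hξ
  rw [h1, Pi.smul_apply, h2, expPos, Set.indicator_of_notMem (by simpa using hξ.le), smul_zero]

/-- By Plancherel: the two Fourier transforms live on opposite half lines, which meet in a null set.
-/
theorem inner_cauchyLp_eq_zero {β : ℂ} (hβ : 0 < β.im) (v : C2) {f : L2C2}
    (hf : f ∈ hardySpace) : inner ℂ (cauchyLp hβ.ne' v) f = 0 := by
  rw [← Lp.inner_fourier_eq, fourier_cauchyLp_of_pos hβ, inner_smul_left, L2.inner_def]
  have ha : 0 < (-(2 * Real.pi * I) * β).re := by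
    simpa using mul_pos Real.two_pi_pos hβ
  rw [integral_eq_zero_of_ae, mul_zero]
  filter_upwards [(memLp_expNeg ha v).coeFn_toLp, (mem_hardySpace_iff f).1 hf,
    Measure.ae_ne volume (0 : ℝ)] with ξ h1 h2 h3
  rw [h1, Pi.zero_apply]
  rcases lt_or_gt_of_ne h3 with h | h
  · rw [h2 h, inner_zero_right]
  · rw [expNeg, Set.indicator_of_notMem (by simpa using h), inner_zero_left]

/-- As `a` varies, the pairings are, up to constants, the inverse Fourier transform of `e^{-2πyξ} 𝓕
f`. This function is integrable and in `L²`, so it vanishes, and the exponential weight can be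
divided out. -/
theorem eq_zero_of_inner_cauchyLp {y : ℝ} (hy : 0 < y) {f : L2C2} (hf : f ∈ hardySpace)
    (h : ∀ (a : ℝ) (v : C2), inner ℂ (cauchyLp (α := a - y * I) (by simpa using hy.ne') v) f = 0) :
    f = 0 := by
  let F : ℝ → C2 := fun ξ =>
    (Set.Ioi (0 : ℝ)).indicator (fun ξ => Real.exp (-(2 * Real.pi * y) * ξ)) ξ • (𝓕 f : L2C2) ξ
  have hw2 : MemLp ((Set.Ioi (0 : ℝ)).indicator
      (fun ξ => Real.exp (-(2 * Real.pi * y) * ξ))) 2 (volume : Measure ℝ) := by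
    have hm : AEStronglyMeasurable ((Set.Ioi (0 : ℝ)).indicator
      (fun ξ => Real.exp (-(2 * Real.pi * y) * ξ))) (volume : Measure ℝ) :=
      (Continuous.aestronglyMeasurable (by fun_prop)).indicator measurableSet_Ioi
    rw [memLp_two_iff_integrable_sq_norm hm]
    have : (fun ξ => ‖(Set.Ioi (0 : ℝ)).indicator
        (fun ξ => Real.exp (-(2 * Real.pi * y) * ξ)) ξ‖ ^ 2) =
        (Set.Ioi (0 : ℝ)).indicator (fun ξ => Real.exp (-(4 * Real.pi * y) * ξ)) := by
      ext ξ
      by_cases hξ : ξ ∈ Set.Ioi (0 : ℝ)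
      · simp only [Set.indicator_of_mem hξ, Real.norm_eq_abs, sq_abs, ← Real.exp_nat_mul]
        congr 1
        push_cast
        ring
      · simp [Set.indicator_of_notMem hξ]
    rw [this, integrable_indicator_iff measurableSet_Ioi]
    exact integrableOn_exp_mul_Ioi (by have := Real.pi_pos; nlinarith) 0
  have hwtop : MemLp ((Set.Ioi (0 : ℝ)).indicator
      (fun ξ => Real.exp (-(2 * Real.pi * y) * ξ))) ∞ (volume : Measure ℝ) := by
    refine memLp_top_of_bound hw2.1 1 (Eventually.of_forall fun ξ => ?_)
    by_cases hξ : ξ ∈ Set.Ioi (0 : ℝ)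
    · simp only [Set.indicator_of_mem hξ, Real.norm_eq_abs, Real.abs_exp, Real.exp_le_one_iff]
      have : 0 < 2 * Real.pi * y := by positivity
      have hξ' : 0 < ξ := hξ
      nlinarith
    · simp [Set.indicator_of_notMem hξ]
  have hF1 : Integrable F := memLp_one_iff_integrable.1 ((Lp.memLp (𝓕 f : L2C2)).smul hw2)
  have hF2 : MemLp F 2 := (Lp.memLp (𝓕 f : L2C2)).smul hwtop
  have hFinv : 𝓕⁻ F = 0 := by
    ext1 a
    refine ext_inner_left ℂ fun v => ?_
    have h1 := h a v
    have him : (a - y * I : ℂ).im < 0 := by simpa using hy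
    rw [← Lp.inner_fourier_eq, fourier_cauchyLp_of_neg him, inner_smul_left, mul_eq_zero,
      or_iff_right (by simp [Real.pi_ne_zero]),
      L2.inner_def] at h1
    rw [Pi.zero_apply, inner_zero_right, ← h1, Real.fourierInv_eq', ← integral_inner]
    · refine integral_congr_ae ?_
      have ha : (-(2 * Real.pi * I) * (a - y * I)).re < 0 := by
        simpa using mul_neg_of_pos_of_neg Real.two_pi_pos him
      filter_upwards [(memLp_expPos ha v).coeFn_toLp] with ξ h2
      rw [h2, expPos]
      by_cases hξ : ξ ∈ Set.Ioi (0 : ℝ)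
      · simp only [F, Set.indicator_of_mem hξ, inner_smul_left, inner_smul_right,
          ← Complex.exp_conj]
        rw [← Complex.coe_smul, inner_smul_right, ← mul_assoc, Complex.ofReal_exp,
          ← Complex.exp_add]
        congr 2
        simp only [RCLike.inner_apply, conj_trivial, map_mul, map_neg, map_sub,
          Complex.conj_I, Complex.conj_ofReal, map_ofNat]
        push_cast
        linear_combination (-(2 * Real.pi * y * ξ)) * I_sq
      · simp [F, Set.indicator_of_notMem hξ]
    · have := (Real.fourierIntegral_convergent_iff (μ := volume) (f := F) (-a)).2 hF1
      refine this.congr (Eventually.of_forall fun ξ => ?_)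
      simp [Circle.smul_def, Real.fourierChar_apply]
  have h3 : MemLp (𝓕⁻ F) 2 := by
    rw [hFinv]
    exact MemLp.zero
  have h4 := fourierInv_toLp_eq hF1 hF2 h3
  have h5 : h3.toLp (𝓕⁻ F) = 0 := by
    rw [Lp.eq_zero_iff_ae_eq_zero]
    filter_upwards [h3.coeFn_toLp] with x hx
    rw [hx, hFinv]
  have h6 : hF2.toLp F = 0 := by
    exact (Lp.fourierTransformₗᵢ ℝ C2).symm.map_eq_zero_iff.1 (h4.trans h5)
  have h7 : (𝓕 f : L2C2) = 0 := by
    rw [Lp.eq_zero_iff_ae_eq_zero] at h6 ⊢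
    filter_upwards [h6, hF2.coeFn_toLp, (mem_hardySpace_iff f).1 hf,
      Measure.ae_ne volume (0 : ℝ)] with ξ h8 h9 h10 h11
    rcases lt_or_gt_of_ne h11 with h | h
    · exact h10 h
    · rw [h9] at h8
      have : F ξ = Real.exp (-(2 * Real.pi * y) * ξ) • (𝓕 f : L2C2) ξ := by
        simp [F, Set.indicator_of_mem (show ξ ∈ Set.Ioi (0 : ℝ) from h)]
      rw [this] at h8
      exact (smul_eq_zero.1 h8).resolve_left (Real.exp_pos _).ne'
  exact (Lp.fourierTransformₗᵢ ℝ C2).map_eq_zero_iff.1 h7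

/-- The Hardy space is the closed span of the Cauchy kernels with poles on a horizontal line in
the lower half plane. -/
theorem hardySpace_le_of_cauchyLp_mem {y : ℝ} (hy : 0 < y) (K : Submodule ℂ L2C2)
    (hK : IsClosed (K : Set L2C2))
    (h : ∀ (a : ℝ) (v : C2), cauchyLp (α := a - y * I) (by simpa using hy.ne') v ∈ K) :
    hardySpace ≤ K := by
  intro f hf
  have hcl : IsClosed ((K ⊓ hardySpace : Submodule ℂ L2C2) : Set L2C2) :=
    hK.inter isClosed_hardySpace
  have : CompleteSpace (K ⊓ hardySpace : Submodule ℂ L2C2) := hcl.completeSpace_coe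
  have hP : (K ⊓ hardySpace).starProjection f ∈ K ⊓ hardySpace :=
    Submodule.starProjection_apply_mem _ f
  -- The residual is a Hardy function orthogonal to every kernel with pole on the line.
  have h0 : f - (K ⊓ hardySpace).starProjection f = 0 := by
    refine eq_zero_of_inner_cauchyLp hy (Submodule.sub_mem _ hf hP.2) fun a v => ?_
    exact (Submodule.sub_starProjection_mem_orthogonal f) _
      ⟨h a v, cauchyLp_mem_hardySpace (by simpa using hy) v⟩
  rw [sub_eq_zero.1 h0]
  exact hP.1

end HardySpace

/-! ### Multiplication of Hardy functions by matrices and by Cauchy kernels. -/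

noncomputable section HardyFunctions

open Complex
open scoped BoundedContinuousFunction

theorem coeFn_mulOp (A : Lp (C2 →L[ℂ] C2) ∞ (volume : Measure ℝ)) (f : L2C2) :
    mulOp A f =ᵐ[volume] fun x => A x (f x) := by
  rw [mulOp, ContinuousLinearMap.holderL_apply_apply]
  exact ContinuousLinearMap.coeFn_holder _ _ _

theorem memLp_bddSymbol (m : C2 →L[ℂ] C2) (g : ℝ →ᵇ ℂ) :
    MemLp (fun x => g x • m) ∞ (volume : Measure ℝ) := by
  refine memLp_top_of_bound ?_ (‖m‖ * ‖g‖) (Eventually.of_forall fun x => ?_)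
  · exact (g.continuous.smul continuous_const).aestronglyMeasurable
  · rw [norm_smul, mul_comm]
    exact mul_le_mul_of_nonneg_left (g.norm_coe_le_norm x) (norm_nonneg m)

/-- The symbol `x ↦ g(x) m` for a bounded continuous scalar function `g` and a matrix `m`. -/
def bddSymbol (m : C2 →L[ℂ] C2) : (ℝ →ᵇ ℂ) →L[ℂ] Lp (C2 →L[ℂ] C2) ∞ (volume : Measure ℝ) :=
  LinearMap.mkContinuous
    { toFun := fun g => (memLp_bddSymbol m g).toLp _
      map_add' := by
        intro g h
        rw [← MemLp.toLp_add]
        exact MemLp.toLp_congr _ _ (Eventually.of_forall fun x => add_smul (g x) (h x) m)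
      map_smul' := by
        intro c g
        rw [← MemLp.toLp_const_smul]
        exact MemLp.toLp_congr _ _ (Eventually.of_forall fun x => smul_assoc c (g x) m) } ‖m‖ (by
    intro g
    rw [LinearMap.coe_mk, AddHom.coe_mk, Lp.norm_toLp]
    refine ENNReal.toReal_le_of_le_ofReal (by positivity) ?_
    rw [eLpNorm_exponent_top]
    refine eLpNormEssSup_le_of_ae_bound (Eventually.of_forall fun x => ?_)
    rw [norm_smul, mul_comm]
    exact mul_le_mul_of_nonneg_left (g.norm_coe_le_norm x) (norm_nonneg m))

theorem coeFn_bddSymbol (m : C2 →L[ℂ] C2) (g : ℝ →ᵇ ℂ) :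
    bddSymbol m g =ᵐ[volume] fun x => g x • m :=
  (memLp_bddSymbol m g).coeFn_toLp

theorem coeFn_mulOp_bddSymbol (m : C2 →L[ℂ] C2) (g : ℝ →ᵇ ℂ) (f : L2C2) :
    mulOp (bddSymbol m g) f =ᵐ[volume] fun x => g x • m (f x) := by
  filter_upwards [coeFn_mulOp (bddSymbol m g) f, coeFn_bddSymbol m g] with x h1 h2
  rw [h1, h2]
  rfl

/-- A function `ℝ → ℂ²` that represents an element of the Hardy space. -/
def IsHardy (F : ℝ → C2) : Prop := ∃ h : MemLp F 2 (volume : Measure ℝ), h.toLp F ∈ hardySpace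

theorem IsHardy.congr {F G : ℝ → C2} (hF : IsHardy F) (h : F =ᵐ[volume] G) : IsHardy G := by
  obtain ⟨h1, h2⟩ := hF
  refine ⟨(memLp_congr_ae h).1 h1, ?_⟩
  rwa [← MemLp.toLp_congr h1 _ h]

theorem isHardy_coe {f : L2C2} : IsHardy f ↔ f ∈ hardySpace := by
  constructor
  · rintro ⟨h1, h2⟩
    rwa [Lp.toLp_coeFn] at h2
  · intro h
    exact ⟨Lp.memLp f, by rwa [Lp.toLp_coeFn]⟩

theorem IsHardy.add {F G : ℝ → C2} (hF : IsHardy F) (hG : IsHardy G) :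
    IsHardy fun x => F x + G x := by
  obtain ⟨h1, h2⟩ := hF
  obtain ⟨h3, h4⟩ := hG
  exact ⟨h1.add h3, Submodule.add_mem _ h2 h4⟩

theorem IsHardy.const_smul {F : ℝ → C2} (hF : IsHardy F) (c : ℂ) : IsHardy fun x => c • F x := by
  obtain ⟨h1, h2⟩ := hF
  exact ⟨h1.const_smul c, Submodule.smul_mem _ c h2⟩

theorem IsHardy.sub {F G : ℝ → C2} (hF : IsHardy F) (hG : IsHardy G) :
    IsHardy fun x => F x - G x := by
  simpa [sub_eq_add_neg] using hF.add (hG.const_smul (-1))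

theorem isHardy_cauchyFn {α : ℂ} (hα : α.im < 0) (v : C2) : IsHardy (cauchyFn α v) :=
  ⟨memLp_cauchyFn hα.ne v, cauchyLp_mem_hardySpace hα v⟩

theorem isClosed_comap_mulOp (A : Lp (C2 →L[ℂ] C2) ∞ (volume : Measure ℝ)) {K : Submodule ℂ L2C2}
    (hK : IsClosed (K : Set L2C2)) :
    IsClosed ((K.comap (mulOp A : L2C2 →ₗ[ℂ] L2C2) : Submodule ℂ L2C2) : Set L2C2) :=
  hK.preimage (mulOp A).continuous

/-- The functions with this property form a closed subspace, so Cauchy kernels suffice, and `m` maps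
a kernel to a kernel. The same density argument serves for multiplication by `1 / (x - α)`. -/
theorem IsHardy.clm_apply {F : ℝ → C2} (hF : IsHardy F) (m : C2 →L[ℂ] C2) :
    IsHardy fun x => m (F x) := by
  obtain ⟨h1, h2⟩ := hF
  have h3 := hardySpace_le_of_cauchyLp_mem zero_lt_one _
    (isClosed_comap_mulOp (bddSymbol m 1) isClosed_hardySpace) (by
      intro a v
      rw [Submodule.mem_comap, ContinuousLinearMap.coe_coe, ← isHardy_coe]
      refine (isHardy_cauchyFn (α := a - (1 : ℝ) * I) (by simp) (m v)).congr ?_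
      filter_upwards [coeFn_mulOp_bddSymbol m 1
        (cauchyLp (α := a - (1 : ℝ) * I) (by simp) v),
        (memLp_cauchyFn (α := a - (1 : ℝ) * I) (by simp) v).coeFn_toLp] with x h3 h4
      rw [h3, cauchyLp, h4]
      simp [cauchyFn]) h2
  rw [Submodule.mem_comap, ContinuousLinearMap.coe_coe, ← isHardy_coe] at h3
  refine h3.congr ?_
  filter_upwards [coeFn_mulOp_bddSymbol m 1 (h1.toLp F), h1.coeFn_toLp] with x h4 h5
  rw [h4, h5]
  simp

/-- The Cauchy kernel as a bounded continuous function. -/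
def cauchyBdd {α : ℂ} (hα : α.im ≠ 0) : ℝ →ᵇ ℂ :=
  BoundedContinuousFunction.ofNormedAddCommGroup (fun x : ℝ => ((x : ℂ) - α)⁻¹)
    (continuous_inv_ofReal_sub hα) |α.im|⁻¹ (by
      intro x
      rw [norm_inv]
      exact inv_anti₀ (abs_pos.2 hα) (abs_im_le_norm_ofReal_sub α x))

theorem cauchyBdd_apply {α : ℂ} (hα : α.im ≠ 0) (x : ℝ) : cauchyBdd hα x = ((x : ℂ) - α)⁻¹ := rfl

theorem inv_sub_mul_inv_sub {α β : ℂ} (hα : α.im ≠ 0) (hβ : β.im ≠ 0) (h : α ≠ β) (x : ℝ) :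
    ((x : ℂ) - α)⁻¹ * ((x : ℂ) - β)⁻¹ = (α - β)⁻¹ * (((x : ℂ) - α)⁻¹ - ((x : ℂ) - β)⁻¹) := by
  have h1 := ofReal_sub_ne_zero hα x
  have h2 := ofReal_sub_ne_zero hβ x
  have h3 := sub_ne_zero.2 h
  field_simp
  ring

theorem IsHardy.inv_sub_smul {F : ℝ → C2} (hF : IsHardy F) {α : ℂ} (hα : α.im < 0) :
    IsHardy fun x => ((x : ℂ) - α)⁻¹ • F x := by
  obtain ⟨h1, h2⟩ := hF
  -- The line of poles is put one unit below `α`, so that no kernel has its pole at `α` and partial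
  -- fractions apply.
  have hy : 0 < -α.im + 1 := by linarith
  have h3 := hardySpace_le_of_cauchyLp_mem hy _
    (isClosed_comap_mulOp (bddSymbol 1 (cauchyBdd hα.ne)) isClosed_hardySpace) (by
      intro a v
      have him : (a - (-α.im + 1 : ℝ) * I : ℂ).im < 0 := by
        simp
        linarith
      have hne : α ≠ a - (-α.im + 1 : ℝ) * I := by
        intro h
        have := congrArg Complex.im h
        simp at this
      rw [Submodule.mem_comap, ContinuousLinearMap.coe_coe, ← isHardy_coe]
      refine (((isHardy_cauchyFn hα v).sub (isHardy_cauchyFn him v)).const_smul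
        (α - (a - (-α.im + 1 : ℝ) * I))⁻¹).congr ?_
      filter_upwards [coeFn_mulOp_bddSymbol 1 (cauchyBdd hα.ne) (cauchyLp him.ne v),
        (memLp_cauchyFn him.ne v).coeFn_toLp] with x h3 h4
      rw [h3, cauchyLp, h4, cauchyBdd_apply, one_apply_eq_self, cauchyFn, cauchyFn, ← sub_smul,
        smul_smul, smul_smul, inv_sub_mul_inv_sub hα.ne him.ne hne]) h2
  rw [Submodule.mem_comap, ContinuousLinearMap.coe_coe, ← isHardy_coe] at h3
  refine h3.congr ?_
  filter_upwards [coeFn_mulOp_bddSymbol 1 (cauchyBdd hα.ne) (h1.toLp F), h1.coeFn_toLp]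
    with x h4 h5
  rw [h4, h5]
  rfl

/-- Dividing a Hardy function by `x - β` with `β` in the upper half plane produces a Hardy function
up to a multiple of the Cauchy kernel. -/
theorem IsHardy.exists_inv_sub_smul {F : ℝ → C2} (hF : IsHardy F) {β : ℂ} (hβ : 0 < β.im) :
    ∃ v : C2, IsHardy fun x => ((x : ℂ) - β)⁻¹ • F x - ((x : ℂ) - β)⁻¹ • v := by
  obtain ⟨h1, h2⟩ := hF
  let L : C2 →ₗ[ℂ] L2C2 :=
    { toFun := fun v => cauchyLp hβ.ne' v
      map_add' := by
        intro v w
        rw [cauchyLp, cauchyLp, cauchyLp, ← MemLp.toLp_add]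
        exact MemLp.toLp_congr _ _ (Eventually.of_forall fun x => smul_add _ _ _)
      map_smul' := by
        intro c v
        rw [cauchyLp, cauchyLp, ← MemLp.toLp_const_smul]
        exact MemLp.toLp_congr _ _ (Eventually.of_forall fun x => smul_comm _ _ _) }
  -- A closed subspace plus a finite-dimensional one is closed, so the density argument applies with
  -- the kernels at `β` adjoined.
  have hcl := Submodule.isClosed_sup_finiteDimensional hardySpace (LinearMap.range L)
    isClosed_hardySpace
  have h3 := hardySpace_le_of_cauchyLp_mem zero_lt_one _
    (isClosed_comap_mulOp (bddSymbol 1 (cauchyBdd hβ.ne')) hcl) (by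
      intro a v
      have him : (a - (1 : ℝ) * I : ℂ).im < 0 := by simp
      have hne : β ≠ a - (1 : ℝ) * I := by
        intro h
        have := congrArg Complex.im h
        simp at this
        linarith
      rw [Submodule.mem_comap, ContinuousLinearMap.coe_coe, Submodule.mem_sup]
      refine ⟨-(β - (a - (1 : ℝ) * I))⁻¹ • cauchyLp him.ne v,
        Submodule.smul_mem _ _ (cauchyLp_mem_hardySpace him v),
        (β - (a - (1 : ℝ) * I))⁻¹ • cauchyLp hβ.ne' v,
        Submodule.smul_mem _ _ ⟨v, rfl⟩, ?_⟩
      apply Lp.ext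
      filter_upwards [coeFn_mulOp_bddSymbol 1 (cauchyBdd hβ.ne') (cauchyLp him.ne v),
        (memLp_cauchyFn him.ne v).coeFn_toLp, (memLp_cauchyFn hβ.ne' v).coeFn_toLp,
        Lp.coeFn_add (-(β - (a - (1 : ℝ) * I))⁻¹ • cauchyLp him.ne v)
          ((β - (a - (1 : ℝ) * I))⁻¹ • cauchyLp hβ.ne' v),
        Lp.coeFn_smul (-(β - (a - (1 : ℝ) * I))⁻¹) (cauchyLp him.ne v),
        Lp.coeFn_smul ((β - (a - (1 : ℝ) * I))⁻¹) (cauchyLp hβ.ne' v)]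
        with x h3 h4 h5 h6 h7 h8
      rw [h3, h6, Pi.add_apply, h7, h8, Pi.smul_apply, Pi.smul_apply]
      simp only [cauchyLp]
      rw [h4, h5, cauchyBdd_apply, one_apply_eq_self, cauchyFn, cauchyFn, smul_smul, smul_smul,
        smul_smul, inv_sub_mul_inv_sub hβ.ne' him.ne hne, ← add_smul]
      congr 1
      ring) h2
  rw [Submodule.mem_comap, ContinuousLinearMap.coe_coe, Submodule.mem_sup] at h3
  obtain ⟨g, hg, _, ⟨v, rfl⟩, hgv⟩ := h3
  refine ⟨v, (isHardy_coe.2 hg).congr ?_⟩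
  have hgv' : g + cauchyLp hβ.ne' v = mulOp (bddSymbol 1 (cauchyBdd hβ.ne')) (h1.toLp F) := hgv
  filter_upwards [coeFn_mulOp_bddSymbol 1 (cauchyBdd hβ.ne') (h1.toLp F), h1.coeFn_toLp,
    Lp.coeFn_add g (cauchyLp hβ.ne' v), (memLp_cauchyFn hβ.ne' v).coeFn_toLp] with x h4 h5 h6 h7
  rw [← hgv', h6, Pi.add_apply, h5, cauchyLp, h7, cauchyBdd_apply] at h4
  exact eq_sub_iff_add_eq.2 h4

/-- A scalar function that belongs to the Hardy space. -/
def IsHardyScalar (φ : ℝ → ℂ) : Prop := IsHardy fun x => φ x • EuclideanSpace.single 0 1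

namespace IsHardyScalar

theorem congr {φ χ : ℝ → ℂ} (h : IsHardyScalar φ) (he : φ =ᵐ[volume] χ) : IsHardyScalar χ :=
  IsHardy.congr h (he.mono fun x hx => by simp only [hx])

theorem add {φ χ : ℝ → ℂ} (h : IsHardyScalar φ) (h' : IsHardyScalar χ) :
    IsHardyScalar fun x => φ x + χ x :=
  IsHardy.congr (IsHardy.add h h') (Eventually.of_forall fun _ => (add_smul _ _ _).symm)

theorem sub {φ χ : ℝ → ℂ} (h : IsHardyScalar φ) (h' : IsHardyScalar χ) :
    IsHardyScalar fun x => φ x - χ x :=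
  IsHardy.congr (IsHardy.sub h h') (Eventually.of_forall fun _ => (sub_smul _ _ _).symm)

theorem const_mul {φ : ℝ → ℂ} (h : IsHardyScalar φ) (c : ℂ) : IsHardyScalar fun x => c * φ x :=
  IsHardy.congr (IsHardy.const_smul h c) (Eventually.of_forall fun _ => smul_smul _ _ _)

theorem inv_sub_mul {φ : ℝ → ℂ} (h : IsHardyScalar φ) {α : ℂ} (hα : α.im < 0) :
    IsHardyScalar fun x => ((x : ℂ) - α)⁻¹ * φ x :=
  IsHardy.congr (IsHardy.inv_sub_smul h hα) (Eventually.of_forall fun _ => smul_smul _ _ _)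

theorem exists_inv_sub_mul {φ : ℝ → ℂ} (h : IsHardyScalar φ) {β : ℂ} (hβ : 0 < β.im) :
    ∃ c : ℂ, IsHardyScalar fun x => ((x : ℂ) - β)⁻¹ * φ x - ((x : ℂ) - β)⁻¹ * c := by
  obtain ⟨v, hv⟩ := IsHardy.exists_inv_sub_smul h hβ
  refine ⟨v 0, ?_⟩
  have h1 := hv.clm_apply ((EuclideanSpace.proj (0 : Fin 2) : C2 →L[ℂ] ℂ).smulRight
    (EuclideanSpace.single 0 1))
  refine h1.congr (Eventually.of_forall fun x => ?_)
  simp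

theorem cauchy {α : ℂ} (hα : α.im < 0) : IsHardyScalar fun x => ((x : ℂ) - α)⁻¹ :=
  isHardy_cauchyFn hα _

/-- Such a kernel is orthogonal to the Hardy space. As a member it would be orthogonal to itself. -/
theorem not_cauchy {β : ℂ} (hβ : 0 < β.im) : ¬ IsHardyScalar fun x => ((x : ℂ) - β)⁻¹ := by
  rintro ⟨h1, h2⟩
  have h3 := inner_cauchyLp_eq_zero hβ (EuclideanSpace.single 0 1) h2
  have h4 : cauchyLp hβ.ne' (EuclideanSpace.single 0 1) = 0 := inner_self_eq_zero.1 h3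
  rw [cauchyLp, Lp.eq_zero_iff_ae_eq_zero] at h4
  have h5 : ∀ᵐ x : ℝ, False := by
    filter_upwards [h4, (memLp_cauchyFn hβ.ne' (EuclideanSpace.single 0 1)).coeFn_toLp] with x h6 h7
    rw [h7, cauchyFn] at h6
    have := ofReal_sub_ne_zero hβ.ne' x
    simp [this] at h6
  exact (ae_neBot.2 (NeZero.ne (volume : Measure ℝ))).ne (by simpa using h5)

end IsHardyScalar

theorem isHardy_iff {F : ℝ → C2} : IsHardy F ↔ ∀ i, IsHardyScalar fun x => F x i := by
  constructor
  · intro h i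
    exact (h.clm_apply ((EuclideanSpace.proj i : C2 →L[ℂ] ℂ).smulRight
      (EuclideanSpace.single 0 1))).congr (Eventually.of_forall fun x => by simp)
  · intro h
    have h1 := fun i => IsHardy.clm_apply (h i) ((EuclideanSpace.proj (0 : Fin 2) :
      C2 →L[ℂ] ℂ).smulRight (EuclideanSpace.single i 1))
    refine ((h1 0).add (h1 1)).congr (Eventually.of_forall fun x => ?_)
    ext i
    fin_cases i <;> simp

end HardyFunctions

/-! ### Rational multipliers and their poles. -/

noncomputable section RationalHardy

open Complex Polynomial

/-- The monic polynomial with the given multiset of roots. -/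
def rootPoly (s : Multiset ℂ) : ℂ[X] := (s.map fun a => X - C a).prod

theorem rootPoly_cons (a : ℂ) (s : Multiset ℂ) : rootPoly (a ::ₘ s) = (X - C a) * rootPoly s := by
  simp [rootPoly]

theorem rootPoly_zero : rootPoly 0 = 1 := by simp [rootPoly]

theorem rootPoly_monic (s : Multiset ℂ) : (rootPoly s).Monic :=
  monic_multisetProd_X_sub_C s

theorem natDegree_rootPoly (s : Multiset ℂ) : (rootPoly s).natDegree = Multiset.card s :=
  natDegree_multiset_prod_X_sub_C_eq_card s

theorem rootPoly_replicate (n : ℕ) (a : ℂ) : rootPoly (Multiset.replicate n a) = (X - C a) ^ n := by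
  simp [rootPoly]

theorem eval_rootPoly_ne_zero {s : Multiset ℂ} (hs : ∀ a ∈ s, a.im ≠ 0) (x : ℝ) :
    (rootPoly s).eval (x : ℂ) ≠ 0 := by
  induction s using Multiset.induction_on with
  | empty => simp [rootPoly_zero]
  | cons a s ih =>
    rw [rootPoly_cons, eval_mul]
    refine mul_ne_zero ?_ (ih fun b hb => hs b (Multiset.mem_cons_of_mem hb))
    simpa using ofReal_sub_ne_zero (hs a (Multiset.mem_cons_self a s)) x

theorem exists_eq_X_sub_C_mul_add (P : ℂ[X]) (a : ℂ) {n : ℕ} (hP : P.natDegree ≤ n + 1) :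
    ∃ (Q : ℂ[X]) (c : ℂ), P = (X - C a) * Q + C c ∧ Q.natDegree ≤ n := by
  refine ⟨P /ₘ (X - C a), P.eval a, ?_, ?_⟩
  · have := modByMonic_add_div P (X - C a)
    rw [modByMonic_X_sub_C_eq_C_eval] at this
    rw [add_comm]
    exact this.symm
  · rw [natDegree_divByMonic P (monic_X_sub_C a), natDegree_X_sub_C]
    omega

namespace IsHardyScalar

/-- Hardy functions are stable under multiplication by bounded rational functions with poles in the
lower half plane. -/
theorem ratio_mul {s : Multiset ℂ} (hs : ∀ a ∈ s, a.im < 0) :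
    ∀ {P : ℂ[X]}, P.natDegree ≤ Multiset.card s → ∀ {φ : ℝ → ℂ}, IsHardyScalar φ →
      IsHardyScalar fun x => P.eval (x : ℂ) / (rootPoly s).eval (x : ℂ) * φ x := by
  induction s using Multiset.induction_on with
  | empty =>
    intro P hP φ hφ
    rw [natDegree_le_iff_coeff_eq_zero] at hP
    have : P = C (P.coeff 0) := by
      ext n
      rcases n with _ | n
      · simp
      · rw [hP _ (by simp), coeff_C_succ]
    refine (hφ.const_mul (P.coeff 0)).congr (Eventually.of_forall fun x => ?_)
    rw [this]
    simp [rootPoly_zero]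
  | cons a s ih =>
    intro P hP φ hφ
    rw [Multiset.card_cons] at hP
    have hs' : ∀ b ∈ s, b.im < 0 := fun b hb => hs b (Multiset.mem_cons_of_mem hb)
    have ha := hs a (Multiset.mem_cons_self a s)
    obtain ⟨Q, c, hPQ, hQ⟩ := exists_eq_X_sub_C_mul_add P a hP
    have h1 := ih hs' hQ hφ
    have h2 := ih hs' (P := C c) (by simp) (hφ.inv_sub_mul ha)
    refine (h1.add h2).congr (Eventually.of_forall fun x => ?_)
    have h3 := ofReal_sub_ne_zero ha.ne x
    have h4 := eval_rootPoly_ne_zero (fun b hb => (hs' b hb).ne) x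
    simp only [hPQ, rootPoly_cons, eval_mul, eval_add, eval_sub, eval_X, eval_C]
    field_simp

theorem poly_div_add_I_pow_mul {P : ℂ[X]} {n : ℕ} (hP : P.natDegree ≤ n) {φ : ℝ → ℂ}
    (hφ : IsHardyScalar φ) :
    IsHardyScalar fun x => P.eval (x : ℂ) / ((x : ℂ) + I) ^ n * φ x := by
  have h := ratio_mul (s := Multiset.replicate n (-I))
    (fun a ha => by rw [Multiset.eq_of_mem_replicate ha]; simp) (P := P) (by simpa using hP) hφ
  refine h.congr (Eventually.of_forall fun x => ?_)
  simp [rootPoly_replicate]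

theorem poly_div_add_I_pow {P : ℂ[X]} {n : ℕ} (hP : P.natDegree < n) :
    IsHardyScalar fun x => P.eval (x : ℂ) / ((x : ℂ) + I) ^ n := by
  obtain ⟨m, rfl⟩ : ∃ m, n = m + 1 := ⟨n - 1, by omega⟩
  have h := poly_div_add_I_pow_mul (P := P) (n := m) (by omega) (cauchy (α := -I) (by simp))
  refine h.congr (Eventually.of_forall fun x => ?_)
  simp only [sub_neg_eq_add]
  rw [pow_succ, div_mul_eq_div_div, div_eq_mul_inv _ ((x : ℂ) + I)]

/-- Descent on `n` through `(x + i) / (x - β) = 1 + (β + i) / (x - β)`. -/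
theorem not_cauchy_div_pow {β : ℂ} (hβ : 0 < β.im) (n : ℕ) :
    ¬ IsHardyScalar fun x => ((x : ℂ) - β)⁻¹ / ((x : ℂ) + I) ^ n := by
  induction n with
  | zero => simpa using not_cauchy hβ
  | succ n ih =>
    intro h
    refine ih ?_
    have h1 := poly_div_add_I_pow (P := 1) (n := n + 1) (by simp)
    refine ((h.const_mul (β + I)).add h1).congr (Eventually.of_forall fun x => ?_)
    have h2 := ofReal_sub_ne_zero hβ.ne' x
    have h3 := ofReal_sub_ne_zero (α := -I) (by simp) x
    rw [sub_neg_eq_add] at h3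
    simp only [eval_one]
    field_simp
    ring

/-- A rational function in the Hardy space has no poles in the upper half plane. -/
theorem rootPoly_dvd {s : Multiset ℂ} (hs : ∀ a ∈ s, 0 < a.im) :
    ∀ {r : ℂ[X]} {n : ℕ},
      (IsHardyScalar fun x => r.eval (x : ℂ) / ((rootPoly s).eval (x : ℂ) * ((x : ℂ) + I) ^ n)) →
      rootPoly s ∣ r := by
  induction s using Multiset.induction_on with
  | empty => simp [rootPoly_zero]
  | cons a s ih =>
    intro r n h
    have hs' : ∀ b ∈ s, 0 < b.im := fun b hb => hs b (Multiset.mem_cons_of_mem hb)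
    have ha := hs a (Multiset.mem_cons_self a s)
    obtain ⟨Q, c, hr, hQ⟩ := exists_eq_X_sub_C_mul_add r a (n := r.natDegree) (by omega)
    have hc : c = 0 := by
      by_contra hc
      -- Multiplying by `rootPoly s` over a high power of `x + i` clears the other poles. Removing
      -- the part with `Q` leaves `c / (x - a)` over a power of `x + i`, which is not Hardy.
      have h1 := poly_div_add_I_pow_mul (P := rootPoly s) (n := Multiset.card s + r.natDegree + 1)
        (by rw [natDegree_rootPoly]; omega) h
      have h2 := poly_div_add_I_pow (P := Q) (n := Multiset.card s + r.natDegree + 1 + n) (by omega)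
      refine not_cauchy_div_pow ha (Multiset.card s + r.natDegree + 1 + n)
        (((h1.sub h2).const_mul c⁻¹).congr (Eventually.of_forall fun x => ?_))
      have h3 := ofReal_sub_ne_zero ha.ne' x
      have h4 := ofReal_sub_ne_zero (α := -I) (by simp) x
      have h5 := eval_rootPoly_ne_zero (fun b hb => (hs' b hb).ne') x
      rw [sub_neg_eq_add] at h4
      have hre : r.eval (x : ℂ) = ((x : ℂ) - a) * Q.eval (x : ℂ) + c := by
        conv_lhs => rw [hr]
        simp
      simp only [pow_add _ (Multiset.card s + r.natDegree + 1) n, hre]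
      generalize hN : ((x : ℂ) + I) ^ (Multiset.card s + r.natDegree + 1) = N
      have hN0 : N ≠ 0 := hN ▸ pow_ne_zero _ h4
      have hn0 : ((x : ℂ) + I) ^ n ≠ 0 := pow_ne_zero _ h4
      simp only [rootPoly_cons, eval_mul, eval_sub, eval_X, eval_C]
      field_simp
      ring
    rw [hc, C_0, add_zero] at hr
    have h1 : IsHardyScalar fun x => Q.eval (x : ℂ) /
        ((rootPoly s).eval (x : ℂ) * ((x : ℂ) + I) ^ n) := by
      refine h.congr (Eventually.of_forall fun x => ?_)
      have h3 := ofReal_sub_ne_zero ha.ne' x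
      simp only [hr, rootPoly_cons, eval_mul, eval_sub, eval_X, eval_C]
      rw [mul_assoc, mul_div_mul_left _ _ h3]
    rw [hr, rootPoly_cons]
    exact mul_dvd_mul_left _ (ih hs' h1)

end IsHardyScalar

/-- Multiplying by `(x + i) / (x - β)` for `k` points `β` in the upper half plane preserves the
Hardy space on a subspace of codimension at most `k`. -/
theorem exists_span_sup_eq_top (V : Submodule ℂ L2C2) {h : V → ℝ → ℂ}
    (hadd : ∀ f g, h (f + g) =ᵐ[volume] fun x => h f x + h g x)
    (hsmul : ∀ (c : ℂ) f, h (c • f) =ᵐ[volume] fun x => c * h f x)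
    (hh : ∀ f, IsHardyScalar (h f)) {s : Multiset ℂ} (hs : ∀ a ∈ s, 0 < a.im) :
    ∃ (N : Submodule ℂ V) (t : Finset V), t.card ≤ Multiset.card s ∧
      N ⊔ Submodule.span ℂ (t : Set V) = ⊤ ∧ ∀ f ∈ N,
        IsHardyScalar fun x =>
          ((x : ℂ) + I) ^ (Multiset.card s) / (rootPoly s).eval (x : ℂ) * h f x := by
  classical
  induction s using Multiset.induction_on with
  | empty => exact ⟨⊤, ∅, by simp, by simp, fun f _ => by simpa [rootPoly_zero] using hh f⟩
  | cons a s ih =>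
    have hs' : ∀ b ∈ s, 0 < b.im := fun b hb => hs b (Multiset.mem_cons_of_mem hb)
    have ha := hs a (Multiset.mem_cons_self a s)
    obtain ⟨N, t, ht, hNt, hN⟩ := ih hs'
    let G : ℝ → ℂ := fun x => ((x : ℂ) + I) ^ (Multiset.card s) / (rootPoly s).eval (x : ℂ)
    -- The elements of `N` for which the division by `x - a` creates no pole.
    let N' : Submodule ℂ V :=
      { carrier := {f | f ∈ N ∧ IsHardyScalar fun x => ((x : ℂ) - a)⁻¹ * (G x * h f x)}
        zero_mem' := by
          refine ⟨N.zero_mem, ?_⟩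
          have h0 := hsmul 0 0
          rw [zero_smul] at h0
          refine ((IsHardyScalar.cauchy (α := -I) (by simp)).const_mul 0).congr ?_
          filter_upwards [h0] with x hx
          rw [hx]
          ring
        add_mem' := by
          rintro f g ⟨h1, h2⟩ ⟨h3, h4⟩
          refine ⟨N.add_mem h1 h3, (h2.add h4).congr ?_⟩
          filter_upwards [hadd f g] with x hx
          rw [hx]
          ring
        smul_mem' := by
          rintro c f ⟨h1, h2⟩
          refine ⟨N.smul_mem c h1, (h2.const_mul c).congr ?_⟩
          filter_upwards [hsmul c f] with x hx
          rw [hx]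
          ring }
    have hN' : ∀ f ∈ N', IsHardyScalar fun x => ((x : ℂ) + I) ^ (Multiset.card (a ::ₘ s)) /
        (rootPoly (a ::ₘ s)).eval (x : ℂ) * h f x := by
      rintro f ⟨h1, h2⟩
      -- This is `(x + i) / (x - a) = 1 + (a + i) / (x - a)`.
      refine ((h2.const_mul (a + I)).add (hN f h1)).congr (Eventually.of_forall fun x => ?_)
      have h3 := ofReal_sub_ne_zero ha.ne' x
      have h5 := eval_rootPoly_ne_zero (fun b hb => (hs' b hb).ne') x
      simp only [G, Multiset.card_cons, rootPoly_cons, eval_mul, eval_sub, eval_X, eval_C, pow_succ]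
      field_simp
      ring
    by_cases hall : N ≤ N'
    · refine ⟨N', t, ht.trans (by simp), ?_, hN'⟩
      rw [eq_top_iff, ← hNt]
      exact sup_le_sup_right hall _
    · obtain ⟨f₀, hf₀, hf₀'⟩ := SetLike.not_le_iff_exists.1 hall
      -- The number `c f` is the obstruction for `f`. If it is non-zero for one `f₀`, subtracting a
      -- multiple of `f₀` removes it for any other `f`, so each pole costs one dimension.
      choose! c hc using fun f (hf : f ∈ N) => (hN f hf).exists_inv_sub_mul ha
      have hc0 : c f₀ ≠ 0 := by
        intro h0
        refine hf₀' ⟨hf₀, (hc f₀ hf₀).congr (Eventually.of_forall fun x => ?_)⟩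
        rw [h0]
        simp [G]
      refine ⟨N', insert f₀ t, ?_, ?_, hN'⟩
      · rw [Multiset.card_cons]
        exact (Finset.card_insert_le _ _).trans (by omega)
      · rw [eq_top_iff, ← hNt, Finset.coe_insert, Submodule.span_insert, ← sup_assoc]
        refine sup_le_sup_right (fun f hf => ?_) _
        rw [Submodule.mem_sup]
        refine ⟨f - (c f * (c f₀)⁻¹) • f₀, ⟨N.sub_mem hf (N.smul_mem _ hf₀), ?_⟩,
          (c f * (c f₀)⁻¹) • f₀,
          Submodule.smul_mem _ _ (Submodule.mem_span_singleton_self f₀), by abel⟩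
        have h1 := hadd f (-(c f * (c f₀)⁻¹) • f₀)
        have h2 := hsmul (-(c f * (c f₀)⁻¹)) f₀
        refine ((hc f hf).sub ((hc f₀ hf₀).const_mul (c f * (c f₀)⁻¹))).congr ?_
        filter_upwards [h1, h2] with x hx1 hx2
        have hsub : f - (c f * (c f₀)⁻¹) • f₀ = f + (-(c f * (c f₀)⁻¹)) • f₀ := by
          rw [neg_smul, sub_eq_add_neg]
        have h3 := ofReal_sub_ne_zero ha.ne' x
        have h5 := eval_rootPoly_ne_zero (fun b hb => (hs' b hb).ne') x
        rw [hsub, hx1, hx2]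
        simp only [G]
        field_simp
        ring

end RationalHardy

/-! ### Toeplitz operators with symbol `u · σ`. -/

noncomputable section ToeplitzBasics

open Complex

theorem pauliSymbol_apply (u : ℝ → R3) (x : ℝ) (v : C2) :
    pauliSymbol u x v = WithLp.toLp 2 ((pauliMatrix (u x)).mulVec v) := rfl

theorem pauliSymbol_apply_zero (u : ℝ → R3) (x : ℝ) (v : C2) :
    pauliSymbol u x v 0 = (u x 2 : ℂ) * v 0 + ((u x 0 : ℂ) - I * (u x 1 : ℂ)) * v 1 := by
  simp [pauliSymbol_apply, pauliMatrix, dotProduct, Fin.sum_univ_two]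

theorem pauliSymbol_apply_one (u : ℝ → R3) (x : ℝ) (v : C2) :
    pauliSymbol u x v 1 = ((u x 0 : ℂ) + I * (u x 1 : ℂ)) * v 0 - (u x 2 : ℂ) * v 1 := by
  simp [pauliSymbol_apply, pauliMatrix, dotProduct, Fin.sum_univ_two,
    sub_eq_add_neg]

theorem sum_sq_of_mem_S2 {v : R3} (hv : v ∈ S2) : v 0 ^ 2 + v 1 ^ 2 + v 2 ^ 2 = 1 := by
  rw [S2, mem_sphere_zero_iff_norm, EuclideanSpace.norm_eq, Real.sqrt_eq_one,
    Fin.sum_univ_three] at hv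
  simpa using hv

/-- The Pauli matrices anticommute and square to one, so `(u · σ)² = |u|²`. -/
theorem pauliSymbol_pauliSymbol {u : ℝ → R3} {x : ℝ} (hx : u x ∈ S2) (v : C2) :
    pauliSymbol u x (pauliSymbol u x v) = v := by
  have h : ((u x 0 : ℂ)) ^ 2 + (u x 1 : ℂ) ^ 2 + (u x 2 : ℂ) ^ 2 = 1 := by
    have h1 := congrArg (fun r : ℝ => (r : ℂ)) (sum_sq_of_mem_S2 hx)
    push_cast at h1
    exact h1
  ext i
  fin_cases i
  · change pauliSymbol u x (pauliSymbol u x v) 0 = v 0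
    rw [pauliSymbol_apply_zero, pauliSymbol_apply_zero, pauliSymbol_apply_one]
    linear_combination v 0 * h - (u x 1 : ℂ) ^ 2 * v 0 * I_sq
  · change pauliSymbol u x (pauliSymbol u x v) 1 = v 1
    rw [pauliSymbol_apply_one, pauliSymbol_apply_zero, pauliSymbol_apply_one]
    linear_combination v 1 * h - (u x 1 : ℂ) ^ 2 * v 1 * I_sq

theorem inner_pauliSymbol (u : ℝ → R3) (x : ℝ) (v w : C2) :
    inner ℂ (pauliSymbol u x v) w = inner ℂ v (pauliSymbol u x w) := by
  simp only [PiLp.inner_apply, Fin.sum_univ_two, pauliSymbol_apply_zero, pauliSymbol_apply_one,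
    RCLike.inner_apply, map_add, map_sub, map_mul, conj_ofReal, conj_I]
  ring

/-- Multiplication by the symbol of a rational map. -/
def symbolOp (u : ℝ → R3) (hu : u ∈ ratMaps) : L2C2 →L[ℂ] L2C2 := mulOp (memLp_pauliSymbol hu).toLp

variable {u : ℝ → R3} (hu : u ∈ ratMaps)

theorem coeFn_symbolOp (f : L2C2) : symbolOp u hu f =ᵐ[volume] fun x => pauliSymbol u x (f x) := by
  filter_upwards [coeFn_mulOp (memLp_pauliSymbol hu).toLp f, (memLp_pauliSymbol hu).coeFn_toLp]
    with x h1 h2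
  rw [symbolOp, h1, h2]

theorem symbolOp_symbolOp (f : L2C2) : symbolOp u hu (symbolOp u hu f) = f := by
  apply Lp.ext
  filter_upwards [coeFn_symbolOp hu (symbolOp u hu f), coeFn_symbolOp hu f] with x h1 h2
  rw [h1, h2, pauliSymbol_pauliSymbol (hu.1 x)]

theorem inner_symbolOp (f g : L2C2) : inner ℂ (symbolOp u hu f) g = inner ℂ f (symbolOp u hu g) := by
  rw [L2.inner_def, L2.inner_def]
  refine integral_congr_ae ?_
  filter_upwards [coeFn_symbolOp hu f, coeFn_symbolOp hu g] with x h1 h2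
  rw [h1, h2, inner_pauliSymbol]

theorem toeplitzOfRat_apply (f : hardySpace) :
    toeplitzOfRat u hu f = hardySpace.orthogonalProjectionOnto (symbolOp u hu f) := rfl

theorem isSelfAdjoint_toeplitzOfRat : IsSelfAdjoint (toeplitzOfRat u hu) := by
  rw [ContinuousLinearMap.isSelfAdjoint_iff_isSymmetric]
  intro f g
  change inner ℂ (toeplitzOfRat u hu f) g = inner ℂ f (toeplitzOfRat u hu g)
  rw [toeplitzOfRat_apply, toeplitzOfRat_apply, Submodule.inner_orthogonalProjectionOnto_eq_of_mem_right,
    Submodule.inner_orthogonalProjectionOnto_eq_of_mem_left, inner_symbolOp]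

theorem coe_toeplitzOfRat {f : hardySpace} (hf : symbolOp u hu f ∈ hardySpace) :
    (toeplitzOfRat u hu f : L2C2) = symbolOp u hu f := by
  rw [toeplitzOfRat_apply]
  exact Submodule.starProjection_eq_self_iff.2 hf

/-- If `T² f = f` then `‖T f‖ = ‖f‖ = ‖U f‖`, as `T` is self-adjoint and `U` unitary. So the
projection loses nothing, and `U f` is already Hardy. Conversely `T f = U f` and `T² f = U² f = f`.
-/
theorem defect_toeplitzOfRat_eq_zero_iff {f : hardySpace} :
    defect (toeplitzOfRat u hu) f = 0 ↔ symbolOp u hu f ∈ hardySpace := by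
  rw [defect_apply, sub_eq_zero]
  constructor
  · intro h
    have h1 : ‖toeplitzOfRat u hu f‖ ^ 2 = ‖f‖ ^ 2 := by
      have h2 : inner ℂ (toeplitzOfRat u hu f) (toeplitzOfRat u hu f) = inner ℂ f f := by
        rw [inner_map_of_isSelfAdjoint (isSelfAdjoint_toeplitzOfRat hu), ← h]
      have h3 := ((inner_self_eq_norm_sq_to_K (𝕜 := ℂ) (toeplitzOfRat u hu f)).symm.trans h2).trans
        (inner_self_eq_norm_sq_to_K f)
      exact_mod_cast h3
    have h3 : ‖symbolOp u hu f‖ ^ 2 = ‖f‖ ^ 2 := by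
      have h2 : inner ℂ (symbolOp u hu f) (symbolOp u hu f) = inner ℂ (f : L2C2) f := by
        rw [inner_symbolOp, symbolOp_symbolOp]
      rw [inner_self_eq_norm_sq_to_K (𝕜 := ℂ), inner_self_eq_norm_sq_to_K (𝕜 := ℂ)] at h2
      exact_mod_cast h2
    have h4 := Submodule.norm_sq_eq_add_norm_sq_projection (symbolOp u hu f) hardySpace
    rw [← toeplitzOfRat_apply, h1, h3, left_eq_add, sq_eq_zero_iff, norm_eq_zero] at h4
    have h5 := hardySpace.starProjection_add_starProjection_orthogonal (symbolOp u hu f)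
    rw [Submodule.starProjection_apply hardySpaceᗮ, h4, Submodule.coe_zero, add_zero] at h5
    rw [← h5]
    exact Submodule.starProjection_apply_mem _ _
  · intro h
    apply Subtype.ext
    have h1 := coe_toeplitzOfRat hu h
    have h2 : symbolOp u hu (toeplitzOfRat u hu f : L2C2) ∈ hardySpace := by
      rw [h1, symbolOp_symbolOp]
      exact f.2
    rw [coe_toeplitzOfRat hu h2, h1, symbolOp_symbolOp]

/-- If `U f = z f` for some non-zero Hardy function `f`, then the eigenspace of `T_U` at `z` has
infinite dimension. -/
theorem not_finiteDimensional_eigenspaceAt {z : ℂ} {f : L2C2} (hf : f ∈ hardySpace) (hf0 : f ≠ 0)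
    (hz : symbolOp u hu f = z • f) : ¬ FiniteDimensional ℂ (eigenspaceAt (toeplitzOfRat u hu) z) := by
  intro hfd
  have him : (-I).im < 0 := by simp
  -- Multiplication by `1 / (x + i)` preserves the Hardy space and commutes with `U`, so it acts on
  -- the solutions of `U g = z g`. If these were finite-dimensional it would have an eigenvector.
  let B : L2C2 →L[ℂ] L2C2 := mulOp (bddSymbol 1 (cauchyBdd him.ne))
  have hB : ∀ g : L2C2, B g =ᵐ[volume] fun x => ((x : ℂ) - -I)⁻¹ • g x := fun g =>
    coeFn_mulOp_bddSymbol 1 (cauchyBdd him.ne) g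
  have hBmem : ∀ g ∈ hardySpace, B g ∈ hardySpace := fun g hg =>
    isHardy_coe.1 (((isHardy_coe.2 hg).inv_sub_smul him).congr (hB g).symm)
  have hBsym : ∀ g : L2C2, symbolOp u hu (B g) = B (symbolOp u hu g) := by
    intro g
    apply Lp.ext
    filter_upwards [coeFn_symbolOp hu (B g), hB g, hB (symbolOp u hu g), coeFn_symbolOp hu g]
      with x h1 h2 h3 h4
    rw [h1, h2, h3, h4, map_smul]
  let W : Submodule ℂ hardySpace :=
    { carrier := {g | symbolOp u hu g = z • (g : L2C2)}
      zero_mem' := by simp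
      add_mem' := by
        intro g h hg hh
        simp only [Set.mem_ofPred_eq, Submodule.coe_add, map_add, smul_add] at *
        rw [hg, hh]
      smul_mem' := by
        intro c g hg
        simp only [Set.mem_ofPred_eq, Submodule.coe_smul, map_smul] at *
        rw [hg, smul_comm] }
  have hW : W ≤ eigenspaceAt (toeplitzOfRat u hu) z := by
    intro g hg
    have hg' : symbolOp u hu g = z • (g : L2C2) := hg
    refine mem_eigenspace_clm.2 (Subtype.ext ?_)
    rw [coe_toeplitzOfRat hu (by rw [hg']; exact Submodule.smul_mem _ _ g.2), hg']
    rfl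
  have : FiniteDimensional ℂ W := Submodule.finiteDimensional_of_le hW
  let B' : W →ₗ[ℂ] W :=
    { toFun := fun g => ⟨⟨B g, hBmem _ g.1.2⟩, by
        have hg' : symbolOp u hu g = z • (g : L2C2) := g.2
        change symbolOp u hu (B g) = z • B g
        rw [hBsym, hg', map_smul]⟩
      map_add' := by
        intro g h
        ext1
        ext1
        simp
      map_smul' := by
        intro c g
        ext1
        ext1
        simp }
  have : Nontrivial W := ⟨⟨⟨⟨f, hf⟩, hz⟩, 0, fun h => hf0 (by
    simpa using congrArg (fun g : W => (g : L2C2)) h)⟩⟩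
  obtain ⟨μ, hμ⟩ := Module.End.exists_eigenvalue B'
  obtain ⟨g, hg⟩ := hμ.exists_hasEigenvector
  have hBg : B g = μ • (g : L2C2) := congrArg (fun g : W => (g : L2C2)) hg.apply_eq_smul
  refine hg.2 ?_
  apply Subtype.ext
  apply Subtype.ext
  change (g : L2C2) = 0
  rw [Lp.eq_zero_iff_ae_eq_zero]
  -- The equation `1 / (x + i) = μ` holds for at most one real `x`, so an eigenfunction vanishes off
  -- one point.
  filter_upwards [hB g, Lp.coeFn_smul μ (g : L2C2), Measure.ae_ne volume (μ⁻¹ - I).re]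
    with x h1 h2 h3
  rw [hBg, h2, Pi.smul_apply] at h1
  by_contra h4
  have h5 : (((x : ℂ) - -I)⁻¹ - μ) • (g : L2C2) x = 0 := by rw [sub_smul, ← h1, sub_self]
  rcases smul_eq_zero.1 h5 with h6 | h6
  · refine h3 ?_
    rw [sub_eq_zero] at h6
    rw [← h6, inv_inv]
    simp
  · exact h4 h6

/-- The link between simplicity of the discrete spectrum and simplicity away from `±1`. -/
theorem hasSimpleDiscreteSpectrum_of_simpleAwayFromOne
    [FiniteDimensional ℂ (defectSpace (toeplitzOfRat u hu))]
    (hs : SimpleAwayFromOne (toeplitzOfRat u hu)) {f g : L2C2} (hf : f ∈ hardySpace) (hf0 : f ≠ 0)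
    (hfu : symbolOp u hu f = f) (hg : g ∈ hardySpace) (hg0 : g ≠ 0) (hgu : symbolOp u hu g = -g) :
    HasSimpleDiscreteSpectrum (toeplitzOfRat u hu) := by
  rintro z ⟨hz, -, hfd⟩
  have h1 : z ≠ 1 := by
    rintro rfl
    exact not_finiteDimensional_eigenspaceAt hu hf hf0 (by rw [hfu, one_smul]) hfd
  have h2 : z ≠ -1 := by
    rintro rfl
    exact not_finiteDimensional_eigenspaceAt hu hg hg0 (by rw [hgu, neg_smul, one_smul]) hfd
  have h3 := hs z h1 h2
  have : Module.Finite ℂ (Module.End.eigenspace (toeplitzOfRat u hu : hardySpace →ₗ[ℂ] hardySpace) z) :=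
    hfd
  have h4 := eigenspace_ne_bot_of_mem_spectrum h1 h2 hz
  have h5 : 0 < Module.finrank ℂ (eigenspaceAt (toeplitzOfRat u hu) z) := by
    rw [Nat.pos_iff_ne_zero]
    exact fun h => h4 (Submodule.finrank_eq_zero.1 h)
  exact le_antisymm h3 h5

end ToeplitzBasics

/-! ### Rational maps in stereographic coordinates and spectral factorization. -/

noncomputable section RationalSymbols

open Complex Polynomial

/-- Inverse stereographic projection. -/
def stereo (w : ℂ) : R3 :=
  !₂[2 * w.re / (1 + normSq w), -2 * w.im / (1 + normSq w), (normSq w - 1) / (1 + normSq w)]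

theorem one_add_normSq_pos (w : ℂ) : 0 < 1 + normSq w := by
  have := normSq_nonneg w
  linarith

theorem stereo_mem_S2 (w : ℂ) : stereo w ∈ S2 := by
  rw [S2, mem_sphere_zero_iff_norm, EuclideanSpace.norm_eq, Real.sqrt_eq_one,
    Fin.sum_univ_three]
  simp only [stereo, Real.norm_eq_abs, sq_abs, PiLp.toLp_apply, Matrix.cons_val]
  have h := (one_add_normSq_pos w).ne'
  have h2 : normSq w = w.re ^ 2 + w.im ^ 2 := by rw [normSq_apply]; ring
  rw [h2] at h ⊢
  field_simp
  ring

/-- The rational map with stereographic coordinate `p / q`. -/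
def ratU (p q : ℂ[X]) (x : ℝ) : R3 := stereo (p.eval (x : ℂ) / q.eval (x : ℂ))

theorem exists_real_imag_parts (p : ℂ[X]) :
    ∃ a b : ℝ[X], ∀ x : ℝ, p.eval (x : ℂ) = ((a.eval x : ℝ) : ℂ) + ((b.eval x : ℝ) : ℂ) * I := by
  induction p using Polynomial.induction_on' with
  | add p q hp hq =>
    obtain ⟨a, b, h⟩ := hp
    obtain ⟨a', b', h'⟩ := hq
    refine ⟨a + a', b + b', fun x => ?_⟩
    rw [eval_add, h, h', eval_add, eval_add]
    push_cast
    ring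
  | monomial n c =>
    refine ⟨monomial n c.re, monomial n c.im, fun x => ?_⟩
    simp only [eval_monomial]
    push_cast
    nth_rewrite 1 [← re_add_im c]
    ring

/-- With `p = a + ib` and `q = c + id` on the real line, every coordinate becomes a quadratic
expression in `a, b, c, d` over `|p|² + |q|²`, which has no real zero. -/
theorem ratU_mem_ratMaps {p q : ℂ[X]} (hq : ∀ x : ℝ, q.eval (x : ℂ) ≠ 0) : ratU p q ∈ ratMaps := by
  refine ⟨fun x => stereo_mem_S2 _, ?_⟩
  obtain ⟨a, b, hp⟩ := exists_real_imag_parts p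
  obtain ⟨c, d, hq'⟩ := exists_real_imag_parts q
  have hcd : ∀ x, c.eval x ^ 2 + d.eval x ^ 2 ≠ 0 := by
    intro x h
    refine hq x ?_
    have h1 : c.eval x = 0 := by nlinarith [sq_nonneg (c.eval x), sq_nonneg (d.eval x)]
    have h2 : d.eval x = 0 := by nlinarith [sq_nonneg (c.eval x), sq_nonneg (d.eval x)]
    rw [hq', h1, h2]
    simp
  have hden : ∀ x, a.eval x ^ 2 + b.eval x ^ 2 + (c.eval x ^ 2 + d.eval x ^ 2) ≠ 0 := by
    intro x h
    refine hcd x ?_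
    nlinarith [sq_nonneg (c.eval x), sq_nonneg (d.eval x), sq_nonneg (a.eval x),
      sq_nonneg (b.eval x)]
  have hw : ∀ x : ℝ, p.eval (x : ℂ) / q.eval (x : ℂ) =
      (((a.eval x * c.eval x + b.eval x * d.eval x) / (c.eval x ^ 2 + d.eval x ^ 2) : ℝ) : ℂ) +
      (((b.eval x * c.eval x - a.eval x * d.eval x) / (c.eval x ^ 2 + d.eval x ^ 2) : ℝ) : ℂ) * I := by
    intro x
    have h1 : ((c.eval x : ℝ) : ℂ) ^ 2 + ((d.eval x : ℝ) : ℂ) ^ 2 ≠ 0 := by exact_mod_cast hcd x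
    rw [div_eq_iff (hq x), hp, hq']
    push_cast
    field_simp
    linear_combination (((a.eval x : ℝ) : ℂ) * ((d.eval x : ℝ) : ℂ) ^ 2
      - ((b.eval x : ℝ) : ℂ) * ((c.eval x : ℝ) : ℂ) * ((d.eval x : ℝ) : ℂ)) * I_sq
  have hre : ∀ x : ℝ, (p.eval (x : ℂ) / q.eval (x : ℂ)).re =
      (a.eval x * c.eval x + b.eval x * d.eval x) / (c.eval x ^ 2 + d.eval x ^ 2) := by
    intro x
    rw [hw]
    simp only [add_re, ofReal_re, mul_re, ofReal_im, I_re, I_im]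
    ring
  have him : ∀ x : ℝ, (p.eval (x : ℂ) / q.eval (x : ℂ)).im =
      (b.eval x * c.eval x - a.eval x * d.eval x) / (c.eval x ^ 2 + d.eval x ^ 2) := by
    intro x
    rw [hw]
    simp only [add_im, ofReal_re, mul_im, ofReal_im, I_re, I_im]
    ring
  have hns : ∀ x : ℝ, normSq (p.eval (x : ℂ) / q.eval (x : ℂ)) =
      (a.eval x ^ 2 + b.eval x ^ 2) / (c.eval x ^ 2 + d.eval x ^ 2) := by
    intro x
    rw [normSq_apply, hre, him]
    have := hcd x
    field_simp
    ring
  intro k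
  fin_cases k
  · refine ⟨2 * (a * c + b * d), a ^ 2 + b ^ 2 + (c ^ 2 + d ^ 2), fun x => ?_⟩
    simp only [eval_add, eval_mul, eval_pow, eval_ofNat]
    refine ⟨hden x, ?_⟩
    change 2 * (p.eval (x : ℂ) / q.eval (x : ℂ)).re / _ = _
    rw [hre, hns]
    have h1 := hcd x
    have h2 := hden x
    rw [one_add_div h1, add_comm (c.eval x ^ 2 + d.eval x ^ 2)]
    field_simp
  · refine ⟨-2 * (b * c - a * d), a ^ 2 + b ^ 2 + (c ^ 2 + d ^ 2), fun x => ?_⟩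
    simp only [eval_add, eval_mul, eval_pow, eval_ofNat, eval_neg, eval_sub]
    refine ⟨hden x, ?_⟩
    change -2 * (p.eval (x : ℂ) / q.eval (x : ℂ)).im / _ = _
    rw [him, hns]
    have h1 := hcd x
    have h2 := hden x
    rw [one_add_div h1, add_comm (c.eval x ^ 2 + d.eval x ^ 2)]
    field_simp
  · refine ⟨a ^ 2 + b ^ 2 - (c ^ 2 + d ^ 2), a ^ 2 + b ^ 2 + (c ^ 2 + d ^ 2), fun x => ?_⟩
    simp only [eval_add, eval_pow, eval_sub]
    refine ⟨hden x, ?_⟩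
    change (normSq (p.eval (x : ℂ) / q.eval (x : ℂ)) - 1) / _ = _
    rw [hns]
    have h1 := hcd x
    have h2 := hden x
    rw [one_add_div h1, add_comm (c.eval x ^ 2 + d.eval x ^ 2), div_sub_one h1]
    field_simp

/-- The polynomial with conjugated coefficients. -/
def conjPoly (p : ℂ[X]) : ℂ[X] := p.map (starRingEnd ℂ)

theorem eval_conjPoly (p : ℂ[X]) (z : ℂ) :
    (conjPoly p).eval (starRingEnd ℂ z) = starRingEnd ℂ (p.eval z) := by
  rw [conjPoly, eval_map_apply]

theorem eval_conjPoly_ofReal (p : ℂ[X]) (x : ℝ) :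
    (conjPoly p).eval (x : ℂ) = starRingEnd ℂ (p.eval (x : ℂ)) := by
  rw [← eval_conjPoly, conj_ofReal]

theorem natDegree_conjPoly (p : ℂ[X]) : (conjPoly p).natDegree = p.natDegree :=
  natDegree_map _

theorem conjPoly_conjPoly (p : ℂ[X]) : conjPoly (conjPoly p) = p := by
  ext n
  simp [conjPoly]

/-- The polynomial `p p^* + q q^*`, which is `|p|² + |q|²` on the real line. -/
def normPoly (p q : ℂ[X]) : ℂ[X] := p * conjPoly p + q * conjPoly q

theorem eval_normPoly (p q : ℂ[X]) (x : ℝ) :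
    (normPoly p q).eval (x : ℂ) = p.eval (x : ℂ) * starRingEnd ℂ (p.eval (x : ℂ)) +
      q.eval (x : ℂ) * starRingEnd ℂ (q.eval (x : ℂ)) := by
  rw [normPoly, eval_add, eval_mul, eval_mul, eval_conjPoly_ofReal, eval_conjPoly_ofReal]

theorem mul_conj_add_mul_conj_ne_zero {a b : ℂ} (hb : b ≠ 0) :
    a * starRingEnd ℂ a + b * starRingEnd ℂ b ≠ 0 := by
  rw [mul_conj, mul_conj, ← ofReal_add, ofReal_ne_zero]
  have h1 := normSq_nonneg a
  have h2 := normSq_pos.2 hb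
  linarith

theorem eval_normPoly_ne_zero {p q : ℂ[X]} (hq : ∀ x : ℝ, q.eval (x : ℂ) ≠ 0) (x : ℝ) :
    (normPoly p q).eval (x : ℂ) ≠ 0 := by
  rw [eval_normPoly]
  exact mul_conj_add_mul_conj_ne_zero (hq x)

theorem conjPoly_normPoly (p q : ℂ[X]) : conjPoly (normPoly p q) = normPoly p q := by
  have h : conjPoly (normPoly p q) =
      conjPoly p * conjPoly (conjPoly p) + conjPoly q * conjPoly (conjPoly q) := by
    simp only [conjPoly, normPoly, Polynomial.map_add, Polynomial.map_mul]
  rw [h, conjPoly_conjPoly, conjPoly_conjPoly, normPoly]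
  ring

/-- The coefficient of degree `2 deg q` is a sum of squared moduli with a positive term, so nothing
cancels. -/
theorem natDegree_normPoly {p q : ℂ[X]} (hq : q ≠ 0) (hp : p.natDegree ≤ q.natDegree) :
    (normPoly p q).natDegree = q.natDegree + q.natDegree := by
  refine natDegree_eq_of_le_of_coeff_ne_zero ?_ ?_
  · refine (natDegree_add_le _ _).trans (max_le ?_ ?_)
    · refine natDegree_mul_le.trans ?_
      rw [natDegree_conjPoly]
      omega
    · refine natDegree_mul_le.trans ?_
      rw [natDegree_conjPoly]
  · rw [normPoly, coeff_add, coeff_mul_add_eq_of_natDegree_le hp (by rwa [natDegree_conjPoly]),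
      coeff_mul_add_eq_of_natDegree_le le_rfl (by rw [natDegree_conjPoly])]
    simp only [conjPoly, coeff_map]
    exact mul_conj_add_mul_conj_ne_zero (by simpa using hq)

/-- Spectral factorization of `|p|² + |q|²`. -/
theorem exists_normPoly_eq {p q : ℂ[X]} (hq : ∀ x : ℝ, q.eval (x : ℂ) ≠ 0)
    (hp : p.natDegree ≤ q.natDegree) :
    ∃ (c : ℂ) (s t : Multiset ℂ), c ≠ 0 ∧ (∀ a ∈ s, 0 < a.im) ∧ (∀ a ∈ t, a.im < 0) ∧
      Multiset.card s = q.natDegree ∧ Multiset.card t = q.natDegree ∧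
      normPoly p q = C c * rootPoly s * rootPoly t := by
  have hq0 : q ≠ 0 := by
    rintro rfl
    exact hq 0 (by simp)
  set F := normPoly p q with hF
  have hF0 : F ≠ 0 := by
    intro h
    have := eval_normPoly_ne_zero (p := p) hq 0
    rw [← hF, h] at this
    simp at this
  have hsplit : F.Splits := IsAlgClosed.splits F
  -- `F` has real coefficients and no real zero, so conjugation exchanges its zeros in the two half
  -- planes, and each half plane carries half of the degree.
  have hroots : F.roots.map (starRingEnd ℂ) = F.roots := by
    have h1 := hsplit.roots_map_of_injective (RingHom.injective (starRingEnd ℂ))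
    rw [← h1]
    change (conjPoly F).roots = _
    rw [hF, conjPoly_normPoly]
  have hne : ∀ a ∈ F.roots, a.im ≠ 0 := by
    intro a ha him
    have h1 : a = (a.re : ℂ) := Complex.ext (by simp) (by simpa using him)
    have h2 := (mem_roots hF0).1 ha
    rw [IsRoot, h1] at h2
    exact eval_normPoly_ne_zero hq _ h2
  let s := F.roots.filter fun a => 0 < a.im
  let t := F.roots.filter fun a => ¬ 0 < a.im
  have hst : s + t = F.roots := Multiset.filter_add_not _ _
  have ht : ∀ a ∈ t, a.im < 0 := by
    intro a ha
    have h1 := Multiset.mem_filter.1 ha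
    exact lt_of_le_of_ne (not_lt.1 h1.2) (hne a h1.1)
  have hmap : s.map (starRingEnd ℂ) = t := by
    have h1 : t = (F.roots.map (starRingEnd ℂ)).filter fun a => ¬ 0 < a.im := by rw [hroots]
    rw [h1, Multiset.filter_map]
    congr 1
    refine Multiset.filter_congr fun a ha => ?_
    simp only [Function.comp, conj_im, not_lt, Left.neg_nonpos_iff]
    exact ⟨le_of_lt, fun h => lt_of_le_of_ne h (hne a ha).symm⟩
  have hcard : Multiset.card s = Multiset.card t := by rw [← hmap, Multiset.card_map]
  have hcard2 : Multiset.card s + Multiset.card t = q.natDegree + q.natDegree := by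
    rw [← Multiset.card_add, hst, ← natDegree_normPoly hq0 hp, ← hF]
    exact hsplit.natDegree_eq_card_roots.symm
  refine ⟨F.leadingCoeff, s, t, leadingCoeff_ne_zero.2 hF0,
    fun a ha => (Multiset.mem_filter.1 ha).2, ht, by omega, by omega, ?_⟩
  rw [mul_assoc]
  have h1 : rootPoly s * rootPoly t = rootPoly F.roots := by
    rw [rootPoly, rootPoly, rootPoly, ← hst, Multiset.map_add, Multiset.prod_add]
  rw [h1]
  exact hsplit.eq_prod_roots

/-- First component of the reflection `2Π - 1`, with `Π` the orthogonal projection onto the line of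
`(a, b)`. The minus sign in the second coordinate of `stereo` makes `(a, b)`, rather than its
conjugate, the fixed direction. -/
theorem pauli_stereo_zero {a b : ℂ} (hb : b ≠ 0) (v w : ℂ) :
    ((stereo (a / b) 2 : ℝ) : ℂ) * v +
      (((stereo (a / b) 0 : ℝ) : ℂ) - I * ((stereo (a / b) 1 : ℝ) : ℂ)) * w =
    2 * a * (starRingEnd ℂ a * v + starRingEnd ℂ b * w) /
      (a * starRingEnd ℂ a + b * starRingEnd ℂ b) - v := by
  have h0 := mul_conj_add_mul_conj_ne_zero (a := a) hb
  have hb' : starRingEnd ℂ b ≠ 0 := by simpa using hb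
  have hn : ((normSq (a / b) : ℝ) : ℂ) = a * starRingEnd ℂ a / (b * starRingEnd ℂ b) := by
    rw [← mul_conj, map_div₀]
    field_simp
  have h1 : (1 : ℂ) + ((normSq (a / b) : ℝ) : ℂ) =
      (a * starRingEnd ℂ a + b * starRingEnd ℂ b) / (b * starRingEnd ℂ b) := by
    rw [hn]
    field_simp
    ring
  have hw : ((a / b).re : ℂ) + ((a / b).im : ℂ) * I = a / b := re_add_im _
  have e0 : ((stereo (a / b) 0 : ℝ) : ℂ) - I * ((stereo (a / b) 1 : ℝ) : ℂ) =
      2 * (a / b) / (1 + ((normSq (a / b) : ℝ) : ℂ)) := by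
    simp only [stereo, PiLp.toLp_apply, Matrix.cons_val]
    push_cast
    generalize normSq (a / b) = N
    conv_rhs => rw [← hw]
    ring
  have e2 : ((stereo (a / b) 2 : ℝ) : ℂ) =
      1 - 2 / (1 + ((normSq (a / b) : ℝ) : ℂ)) := by
    simp only [stereo, PiLp.toLp_apply, Matrix.cons_val]
    push_cast
    have : (1 : ℂ) + ((normSq (a / b) : ℝ) : ℂ) ≠ 0 := by
      rw [h1]
      exact div_ne_zero h0 (mul_ne_zero hb hb')
    field_simp
    ring
  rw [e0, e2, h1]
  field_simp
  ring

theorem pauli_stereo_one {a b : ℂ} (hb : b ≠ 0) (v w : ℂ) :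
    (((stereo (a / b) 0 : ℝ) : ℂ) + I * ((stereo (a / b) 1 : ℝ) : ℂ)) * v -
      ((stereo (a / b) 2 : ℝ) : ℂ) * w =
    2 * b * (starRingEnd ℂ a * v + starRingEnd ℂ b * w) /
      (a * starRingEnd ℂ a + b * starRingEnd ℂ b) - w := by
  have h0 := mul_conj_add_mul_conj_ne_zero (a := a) hb
  have hb' : starRingEnd ℂ b ≠ 0 := by simpa using hb
  have hn : ((normSq (a / b) : ℝ) : ℂ) = a * starRingEnd ℂ a / (b * starRingEnd ℂ b) := by
    rw [← mul_conj, map_div₀]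
    field_simp
  have h1 : (1 : ℂ) + ((normSq (a / b) : ℝ) : ℂ) =
      (a * starRingEnd ℂ a + b * starRingEnd ℂ b) / (b * starRingEnd ℂ b) := by
    rw [hn]
    field_simp
    ring
  have hw : ((a / b).re : ℂ) - ((a / b).im : ℂ) * I = starRingEnd ℂ a / starRingEnd ℂ b := by
    rw [← map_div₀]
    generalize a / b = z
    apply Complex.ext <;> simp
  have e0 : ((stereo (a / b) 0 : ℝ) : ℂ) + I * ((stereo (a / b) 1 : ℝ) : ℂ) =
      2 * (starRingEnd ℂ a / starRingEnd ℂ b) / (1 + ((normSq (a / b) : ℝ) : ℂ)) := by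
    simp only [stereo, PiLp.toLp_apply, Matrix.cons_val]
    push_cast
    rw [← hw]
    ring
  have e2 : ((stereo (a / b) 2 : ℝ) : ℂ) =
      1 - 2 / (1 + ((normSq (a / b) : ℝ) : ℂ)) := by
    simp only [stereo, PiLp.toLp_apply, Matrix.cons_val]
    push_cast
    have : (1 : ℂ) + ((normSq (a / b) : ℝ) : ℂ) ≠ 0 := by
      rw [h1]
      exact div_ne_zero h0 (mul_ne_zero hb hb')
    field_simp
    ring
  rw [e0, e2, h1]
  field_simp
  ring

end RationalSymbols

/-! ### The rank of `1 - T²` for a rational symbol. -/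

noncomputable section Rank

open Complex Polynomial

variable {p q : ℂ[X]}

theorem pauliSymbol_ratU_zero (hq : ∀ x : ℝ, q.eval (x : ℂ) ≠ 0) (x : ℝ) (v : C2) :
    pauliSymbol (ratU p q) x v 0 = 2 * p.eval (x : ℂ) * ((conjPoly p).eval (x : ℂ) * v 0 +
      (conjPoly q).eval (x : ℂ) * v 1) / (normPoly p q).eval (x : ℂ) - v 0 := by
  rw [pauliSymbol_apply_zero, eval_normPoly, eval_conjPoly_ofReal, eval_conjPoly_ofReal]
  exact pauli_stereo_zero (hq x) _ _

theorem pauliSymbol_ratU_one (hq : ∀ x : ℝ, q.eval (x : ℂ) ≠ 0) (x : ℝ) (v : C2) :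
    pauliSymbol (ratU p q) x v 1 = 2 * q.eval (x : ℂ) * ((conjPoly p).eval (x : ℂ) * v 0 +
      (conjPoly q).eval (x : ℂ) * v 1) / (normPoly p q).eval (x : ℂ) - v 1 := by
  rw [pauliSymbol_apply_one, eval_normPoly, eval_conjPoly_ofReal, eval_conjPoly_ofReal]
  exact pauli_stereo_one (hq x) _ _

theorem ofReal_add_I_ne_zero (x : ℝ) : (x : ℂ) + I ≠ 0 := by
  have h := ofReal_sub_ne_zero (α := -I) (by simp) x
  rwa [sub_neg_eq_add] at h

/-- The Toeplitz operator whose symbol has stereographic coordinate `p / q`. -/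
abbrev ratToeplitz (p : ℂ[X]) {q : ℂ[X]} (hq : ∀ x : ℝ, q.eval (x : ℂ) ≠ 0) :
    hardySpace →L[ℂ] hardySpace :=
  toeplitzOfRat (ratU p q) (ratU_mem_ratMaps hq)

/-- With `n = deg q`, `|p|² + |q|² = c A B` and `h = (p* f₀ + q* f₁) / (x + i)^n`, one has `U f + f
= 2 (p, q) (x + i)^n h / (c A B)`. Dividing by `B`, whose zeros lie in the lower half plane, is
harmless. Dividing by `A` preserves the Hardy space on a subspace of codimension at most `n`, and
there `1 - T²` vanishes. -/
theorem exists_defectSpace_le_span (hq : ∀ x : ℝ, q.eval (x : ℂ) ≠ 0)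
    (hp : p.natDegree ≤ q.natDegree) :
    ∃ t : Finset hardySpace, t.card ≤ q.natDegree ∧
      defectSpace (ratToeplitz p hq) ≤ Submodule.span ℂ (t : Set hardySpace) := by
  classical
  obtain ⟨c, s, t, hc, hs, ht, hsc, htc, hF⟩ := exists_normPoly_eq hq hp
  let h : hardySpace → ℝ → ℂ := fun f x =>
    (conjPoly p).eval (x : ℂ) / ((x : ℂ) + I) ^ q.natDegree * (f : L2C2) x 0 +
    (conjPoly q).eval (x : ℂ) / ((x : ℂ) + I) ^ q.natDegree * (f : L2C2) x 1
  obtain ⟨N, τ, hτ, hNτ, hN⟩ := exists_span_sup_eq_top hardySpace (h := h)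
    (by
      intro f g
      filter_upwards [Lp.coeFn_add (f : L2C2) g] with x hx
      simp only [h, Submodule.coe_add, hx, Pi.add_apply, PiLp.add_apply]
      ring)
    (by
      intro a f
      filter_upwards [Lp.coeFn_smul a (f : L2C2)] with x hx
      simp only [h, Submodule.coe_smul, hx, Pi.smul_apply, PiLp.smul_apply, smul_eq_mul]
      ring)
    (fun f => by
      have hf := isHardy_iff.1 (isHardy_coe.2 f.2)
      exact ((hf 0).poly_div_add_I_pow_mul (by rw [natDegree_conjPoly]; exact hp)).add
        ((hf 1).poly_div_add_I_pow_mul (by rw [natDegree_conjPoly])))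
    hs
  have hker : ∀ f ∈ N, defect (ratToeplitz p hq) f = 0 := by
    intro f hf
    rw [defect_toeplitzOfRat_eq_zero_iff]
    refine isHardy_coe.1 (isHardy_iff.2 fun i => ?_)
    have hf' := isHardy_iff.1 (isHardy_coe.2 f.2)
    have h1 := hN f hf
    have key : ∀ r : ℂ[X], r.natDegree ≤ q.natDegree → IsHardyScalar fun x =>
        2 * r.eval (x : ℂ) * ((conjPoly p).eval (x : ℂ) * (f : L2C2) x 0 +
          (conjPoly q).eval (x : ℂ) * (f : L2C2) x 1) / (normPoly p q).eval (x : ℂ) := by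
      intro r hr
      refine ((h1.ratio_mul ht (P := r) (by rw [htc]; exact hr)).const_mul (2 * c⁻¹)).congr
        (Eventually.of_forall fun x => ?_)
      have h2 := eval_rootPoly_ne_zero (fun b hb => (hs b hb).ne') x
      have h3 := eval_rootPoly_ne_zero (fun b hb => (ht b hb).ne) x
      have h4 := pow_ne_zero q.natDegree (ofReal_add_I_ne_zero x)
      simp only [h, hF, hsc, eval_mul, eval_C]
      field_simp
    fin_cases i
    · refine ((key p hp).sub (hf' 0)).congr ?_
      filter_upwards [coeFn_symbolOp (ratU_mem_ratMaps (p := p) hq) f] with x hx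
      exact ((congrArg (fun v : C2 => v 0) hx).trans (pauliSymbol_ratU_zero hq x _)).symm
    · refine ((key q le_rfl).sub (hf' 1)).congr ?_
      filter_upwards [coeFn_symbolOp (ratU_mem_ratMaps (p := p) hq) f] with x hx
      exact ((congrArg (fun v : C2 => v 1) hx).trans (pauliSymbol_ratU_one hq x _)).symm
  refine ⟨τ.image (defect (ratToeplitz p hq)), Finset.card_image_le.trans (hτ.trans hsc.le), ?_⟩
  rintro _ ⟨f, rfl⟩
  have hf : f ∈ N ⊔ Submodule.span ℂ (τ : Set hardySpace) := by rw [hNτ]; trivial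
  obtain ⟨g, hg, k, hk, rfl⟩ := Submodule.mem_sup.1 hf
  change defect (ratToeplitz p hq) (g + k) ∈ _
  rw [map_add, hker g hg, zero_add, Finset.coe_image]
  have := Submodule.mem_map_of_mem (f := (defect (ratToeplitz p hq) : hardySpace →ₗ[ℂ] hardySpace)) hk
  rwa [Submodule.map_span] at this

theorem finiteDimensional_defectSpace (hq : ∀ x : ℝ, q.eval (x : ℂ) ≠ 0)
    (hp : p.natDegree ≤ q.natDegree) :
    FiniteDimensional ℂ (defectSpace (ratToeplitz p hq)) := by
  obtain ⟨t, -, ht⟩ := exists_defectSpace_le_span hq hp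
  exact Submodule.finiteDimensional_of_le ht

theorem finrank_defectSpace_le (hq : ∀ x : ℝ, q.eval (x : ℂ) ≠ 0)
    (hp : p.natDegree ≤ q.natDegree) :
    Module.finrank ℂ (defectSpace (ratToeplitz p hq)) ≤ q.natDegree := by
  obtain ⟨t, htc, ht⟩ := exists_defectSpace_le_span hq hp
  exact (Submodule.finrank_mono ht).trans ((finrank_span_finset_le_card t).trans htc)

/-- The vector-valued rational function `(P, Q) / (x + i)^m`. -/
def ratVec (P Q : ℂ[X]) (m : ℕ) (x : ℝ) : C2 :=
  !₂[P.eval (x : ℂ) / ((x : ℂ) + I) ^ m, Q.eval (x : ℂ) / ((x : ℂ) + I) ^ m]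

theorem ratVec_zero (P Q : ℂ[X]) (m : ℕ) (x : ℝ) :
    ratVec P Q m x 0 = P.eval (x : ℂ) / ((x : ℂ) + I) ^ m := rfl

theorem ratVec_one (P Q : ℂ[X]) (m : ℕ) (x : ℝ) :
    ratVec P Q m x 1 = Q.eval (x : ℂ) / ((x : ℂ) + I) ^ m := rfl

theorem isHardy_ratVec {P Q : ℂ[X]} {m : ℕ} (hP : P.natDegree < m) (hQ : Q.natDegree < m) :
    IsHardy (ratVec P Q m) := by
  refine isHardy_iff.2 fun i => ?_
  fin_cases i
  · exact IsHardyScalar.poly_div_add_I_pow hP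
  · exact IsHardyScalar.poly_div_add_I_pow hQ

theorem toLp_ratVec_ne_zero {P Q : ℂ[X]} {m : ℕ} (h : MemLp (ratVec P Q m) 2 volume)
    (h0 : ∀ x : ℝ, P.eval (x : ℂ) ≠ 0 ∨ Q.eval (x : ℂ) ≠ 0) : h.toLp (ratVec P Q m) ≠ 0 := by
  intro he
  rw [Lp.eq_zero_iff_ae_eq_zero] at he
  obtain ⟨x, hx⟩ := (h.coeFn_toLp.symm.trans he).exists
  have h1 := pow_ne_zero m (ofReal_add_I_ne_zero x)
  rcases h0 x with h2 | h2
  · exact div_ne_zero h2 h1 (congrArg (fun v : C2 => v 0) hx)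
  · exact div_ne_zero h2 h1 (congrArg (fun v : C2 => v 1) hx)

/-- The vector `(p, q)` spans the line fixed by the reflection. -/
theorem pauliSymbol_ratVec (hq : ∀ x : ℝ, q.eval (x : ℂ) ≠ 0) (m : ℕ) (x : ℝ) :
    pauliSymbol (ratU p q) x (ratVec p q m x) = ratVec p q m x := by
  have h2 := eval_normPoly_ne_zero (p := p) hq x
  have h3 : (normPoly p q).eval (x : ℂ) = p.eval (x : ℂ) * (conjPoly p).eval (x : ℂ) +
      q.eval (x : ℂ) * (conjPoly q).eval (x : ℂ) := by simp [normPoly]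
  rw [h3] at h2
  ext i
  fin_cases i
  · refine (pauliSymbol_ratU_zero hq x _).trans ?_
    simp only [ratVec_zero, ratVec_one, h3, Fin.zero_eta]
    rw [sub_eq_iff_eq_add, div_eq_iff h2]
    ring
  · refine (pauliSymbol_ratU_one hq x _).trans ?_
    simp only [ratVec_zero, ratVec_one, h3, Fin.mk_one]
    rw [sub_eq_iff_eq_add, div_eq_iff h2]
    ring

/-- On the real line `(-q*, p*)` is orthogonal to `(p, q)`, hence reversed by the reflection. -/
theorem pauliSymbol_ratVec_conj (hq : ∀ x : ℝ, q.eval (x : ℂ) ≠ 0) (m : ℕ) (x : ℝ) :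
    pauliSymbol (ratU p q) x (ratVec (-conjPoly q) (conjPoly p) m x) =
      -ratVec (-conjPoly q) (conjPoly p) m x := by
  ext i
  fin_cases i
  · refine (pauliSymbol_ratU_zero hq x _).trans ?_
    simp only [ratVec_zero, ratVec_one, Fin.zero_eta, eval_neg, PiLp.neg_apply]
    ring
  · refine (pauliSymbol_ratU_one hq x _).trans ?_
    simp only [ratVec_zero, ratVec_one, Fin.mk_one, eval_neg, PiLp.neg_apply]
    ring

/-- Divided by `(x + i)^(deg q + 1)`, the vectors `(p, q)` and `(-q*, p*)` become Hardy functions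
with `U f = f` and `U f = -f`. This excludes `±1` from the discrete spectrum. -/
theorem ratU_mem_ratMapsSimple (hq : ∀ x : ℝ, q.eval (x : ℂ) ≠ 0)
    (hp : p.natDegree ≤ q.natDegree) (hs : SimpleAwayFromOne (ratToeplitz p hq)) :
    ratU p q ∈ ratMapsSimple := by
  have hu := ratU_mem_ratMaps (p := p) hq
  have := finiteDimensional_defectSpace hq hp
  obtain ⟨hf, hf'⟩ := isHardy_ratVec (P := p) (Q := q) (m := q.natDegree + 1) (by omega) (by omega)
  obtain ⟨hg, hg'⟩ := isHardy_ratVec (P := -conjPoly q) (Q := conjPoly p) (m := q.natDegree + 1)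
    (by rw [natDegree_neg, natDegree_conjPoly]; omega) (by rw [natDegree_conjPoly]; omega)
  refine ⟨hu, hasSimpleDiscreteSpectrum_of_simpleAwayFromOne hu hs hf'
    (toLp_ratVec_ne_zero hf fun x => Or.inr (hq x)) ?_ hg'
    (toLp_ratVec_ne_zero hg fun x => Or.inl ?_) ?_⟩
  · apply Lp.ext
    filter_upwards [coeFn_symbolOp hu (hf.toLp _), hf.coeFn_toLp] with x h1 h2
    rw [h1, h2, pauliSymbol_ratVec hq]
  · rw [eval_neg, eval_conjPoly_ofReal, neg_ne_zero]
    exact (_root_.map_ne_zero _).2 (hq x)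
  · apply Lp.ext
    filter_upwards [coeFn_symbolOp hu (hg.toLp _), hg.coeFn_toLp, Lp.coeFn_neg (hg.toLp _)]
      with x h1 h2 h3
    rw [h1, h3, Pi.neg_apply, h2, pauliSymbol_ratVec_conj hq]

/-- Let `a p + b q = 1`. The test functions `f = (a*, b*) r / (x + i)^m` with `deg r < deg q`
satisfy `U f + f = 2 (p, q) r / ((|p|² + |q|²)(x + i)^m)`. If `1 - T²` kills `f`, this is Hardy,
which forces the zeros of `|p|² + |q|²` in the upper half plane to be zeros of `r`. There are `deg
q` of them, so `r = 0`. -/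
theorem le_finrank_defectSpace (hq : ∀ x : ℝ, q.eval (x : ℂ) ≠ 0)
    (hp : p.natDegree ≤ q.natDegree) (hpq : IsCoprime p q) :
    q.natDegree ≤ Module.finrank ℂ (defectSpace (ratToeplitz p hq)) := by
  have hu := ratU_mem_ratMaps (p := p) hq
  have := finiteDimensional_defectSpace hq hp
  obtain ⟨a, b, hab⟩ := hpq
  obtain ⟨c, s, t, hc, hs, ht, hsc, htc, hF⟩ := exists_normPoly_eq hq hp
  obtain ⟨m, hm⟩ : ∃ m, m = a.natDegree + b.natDegree + q.natDegree + 1 := ⟨_, rfl⟩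
  have hdeg : ∀ r ∈ degreeLT ℂ q.natDegree, r.natDegree ≤ q.natDegree := fun r hr =>
    natDegree_le_of_degree_le (mem_degreeLT.1 hr).le
  have hH : ∀ r ∈ degreeLT ℂ q.natDegree, IsHardy (ratVec (conjPoly a * r) (conjPoly b * r) m) := by
    intro r hr
    have h1 := natDegree_mul_le (p := conjPoly a) (q := r)
    have h2 := natDegree_mul_le (p := conjPoly b) (q := r)
    have h3 := hdeg r hr
    rw [natDegree_conjPoly] at h1 h2
    exact isHardy_ratVec (by omega) (by omega)
  let Φ : degreeLT ℂ q.natDegree →ₗ[ℂ] hardySpace :=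
    { toFun := fun r => ⟨(hH r r.2).1.toLp _, (hH r r.2).2⟩
      map_add' := by
        intro r r'
        refine Subtype.ext (Lp.ext ?_)
        filter_upwards [(hH _ (r + r').2).1.coeFn_toLp, (hH r r.2).1.coeFn_toLp,
          (hH r' r'.2).1.coeFn_toLp, Lp.coeFn_add ((hH r r.2).1.toLp _) ((hH r' r'.2).1.toLp _)]
          with x h1 h2 h3 h4
        refine h1.trans (Eq.trans ?_ h4.symm)
        rw [Pi.add_apply, h2, h3]
        ext i
        fin_cases i
        · simp [ratVec]; ring
        · simp [ratVec]; ring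
      map_smul' := by
        intro k r
        refine Subtype.ext (Lp.ext ?_)
        filter_upwards [(hH _ (k • r).2).1.coeFn_toLp, (hH r r.2).1.coeFn_toLp,
          Lp.coeFn_smul k ((hH r r.2).1.toLp _)] with x h1 h2 h4
        refine h1.trans (Eq.trans ?_ h4.symm)
        rw [Pi.smul_apply, h2]
        ext i
        fin_cases i
        · simp [ratVec]; ring
        · simp [ratVec]; ring }
  have hΦ : ∀ r, Φ r =ᵐ[volume] ratVec (conjPoly a * r) (conjPoly b * r) m := fun r =>
    (hH r r.2).1.coeFn_toLp
  have hab' : ∀ x : ℝ, (conjPoly p).eval (x : ℂ) * (conjPoly a).eval (x : ℂ) +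
      (conjPoly q).eval (x : ℂ) * (conjPoly b).eval (x : ℂ) = 1 := by
    intro x
    have := congrArg (fun P : ℂ[X] => starRingEnd ℂ (P.eval (x : ℂ))) hab
    simp only [eval_add, eval_mul, map_add, map_mul, eval_one, map_one] at this
    simp only [eval_conjPoly_ofReal]
    linear_combination this
  have hinj : ∀ r, defect (ratToeplitz p hq) (Φ r) = 0 → r = 0 := by
    intro r hr
    rw [defect_toeplitzOfRat_eq_zero_iff] at hr
    have h1 := isHardy_iff.1 (isHardy_coe.2 hr)
    have h2 := isHardy_iff.1 (hH r r.2)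
    have hne : ∀ x : ℝ, (normPoly p q).eval (x : ℂ) ≠ 0 := eval_normPoly_ne_zero hq
    have k0 : IsHardyScalar fun x => p.eval (x : ℂ) * (r : ℂ[X]).eval (x : ℂ) /
        ((normPoly p q).eval (x : ℂ) * ((x : ℂ) + I) ^ m) := by
      refine (((h1 0).add (h2 0)).const_mul 2⁻¹).congr ?_
      filter_upwards [coeFn_symbolOp hu (Φ r), hΦ r] with x e1 e2
      rw [e1, e2, pauliSymbol_ratU_zero hq]
      have e3 := hne x
      have e4 := pow_ne_zero m (ofReal_add_I_ne_zero x)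
      simp only [ratVec_zero, ratVec_one, eval_mul]
      field_simp
      linear_combination 2 * p.eval (x : ℂ) * (r : ℂ[X]).eval (x : ℂ) * hab' x
    have k1 : IsHardyScalar fun x => q.eval (x : ℂ) * (r : ℂ[X]).eval (x : ℂ) /
        ((normPoly p q).eval (x : ℂ) * ((x : ℂ) + I) ^ m) := by
      refine (((h1 1).add (h2 1)).const_mul 2⁻¹).congr ?_
      filter_upwards [coeFn_symbolOp hu (Φ r), hΦ r] with x e1 e2
      rw [e1, e2, pauliSymbol_ratU_one hq]
      have e3 := hne x
      have e4 := pow_ne_zero m (ofReal_add_I_ne_zero x)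
      simp only [ratVec_zero, ratVec_one, eval_mul]
      field_simp
      linear_combination 2 * q.eval (x : ℂ) * (r : ℂ[X]).eval (x : ℂ) * hab' x
    -- Second use of the Bézout identity: combining the components with `a` and `b` removes `(p,
    -- q)`, and multiplying by `rootPoly t` removes the poles in the lower half plane.
    have k2 : IsHardyScalar fun x => (r : ℂ[X]).eval (x : ℂ) /
        ((rootPoly s).eval (x : ℂ) * ((x : ℂ) + I) ^ (m + m + q.natDegree)) := by
      have k3 := ((k0.poly_div_add_I_pow_mul (P := a) (n := m) (by omega)).add
        (k1.poly_div_add_I_pow_mul (P := b) (n := m) (by omega)))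
      refine ((k3.poly_div_add_I_pow_mul (P := rootPoly t) (n := q.natDegree)
        (by rw [natDegree_rootPoly, htc])).const_mul c).congr (Eventually.of_forall fun x => ?_)
      have e1 := eval_rootPoly_ne_zero (fun b hb => (hs b hb).ne') x
      have e2 := eval_rootPoly_ne_zero (fun b hb => (ht b hb).ne) x
      have e3 := pow_ne_zero q.natDegree (ofReal_add_I_ne_zero x)
      have e4 := pow_ne_zero m (ofReal_add_I_ne_zero x)
      have e5 := congrArg (fun P : ℂ[X] => P.eval (x : ℂ)) hab
      simp only [eval_add, eval_mul, eval_one] at e5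
      simp only [hF, eval_mul, eval_C, pow_add]
      field_simp
      linear_combination (r : ℂ[X]).eval (x : ℂ) * e5
    have k4 := IsHardyScalar.rootPoly_dvd hs k2
    apply Subtype.ext
    refine eq_zero_of_dvd_of_degree_lt k4 ?_
    rw [degree_eq_natDegree (rootPoly_monic s).ne_zero, natDegree_rootPoly, hsc]
    exact mem_degreeLT.1 r.2
  let Ψ : degreeLT ℂ q.natDegree →ₗ[ℂ] defectSpace (ratToeplitz p hq) :=
    ((defect (ratToeplitz p hq) : hardySpace →ₗ[ℂ] hardySpace) ∘ₗ Φ).codRestrict _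
      (fun r => ⟨Φ r, rfl⟩)
  have hΨ : Function.Injective Ψ := by
    rw [← LinearMap.ker_eq_bot, LinearMap.ker_eq_bot']
    intro r hr
    exact hinj r (congrArg Subtype.val hr)
  have hle := LinearMap.finrank_le_finrank_of_injective hΨ
  rw [(degreeLTEquiv ℂ q.natDegree).finrank_eq, Module.finrank_fin_fun] at hle
  exact hle

theorem finrank_defectSpace_eq (hq : ∀ x : ℝ, q.eval (x : ℂ) ≠ 0)
    (hp : p.natDegree ≤ q.natDegree) (hpq : IsCoprime p q) :
    Module.finrank ℂ (defectSpace (ratToeplitz p hq)) = q.natDegree :=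
  le_antisymm (finrank_defectSpace_le hq hp) (le_finrank_defectSpace hq hp hpq)

end Rank

/-! ### Analytic families of symbols and the induction on poles. -/

noncomputable section Perturbation

open Complex Polynomial

/-- Half the chordal distance of the points of the circle that correspond to `x` and `y`. -/
def chord (x y : ℝ) : ℝ := |x - y| / (√(1 + x ^ 2) * √(1 + y ^ 2))

theorem chord_nonneg (x y : ℝ) : 0 ≤ chord x y := by
  unfold chord
  positivity

/-- The function `φ` is bounded by `K`, and `K`-Lipschitz for the chordal distance. -/
def ChordBound (K : ℝ) (φ : ℝ → ℂ) : Prop :=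
  (∀ x, ‖φ x‖ ≤ K) ∧ ∀ x y, ‖φ x - φ y‖ ≤ K * chord x y

namespace ChordBound

variable {K L : ℝ} {φ χ : ℝ → ℂ}

theorem nonneg (h : ChordBound K φ) : 0 ≤ K := (norm_nonneg _).trans (h.1 0)

theorem congr (h : ChordBound K φ) (he : ∀ x, φ x = χ x) : ChordBound K χ := by
  rwa [← funext he]

theorem mono (h : ChordBound K φ) (hKL : K ≤ L) : ChordBound L φ :=
  ⟨fun x => (h.1 x).trans hKL, fun x y =>
    (h.2 x y).trans (mul_le_mul_of_nonneg_right hKL (chord_nonneg x y))⟩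

theorem add (h : ChordBound K φ) (h' : ChordBound L χ) :
    ChordBound (K + L) fun x => φ x + χ x := by
  refine ⟨fun x => (norm_add_le _ _).trans (add_le_add (h.1 x) (h'.1 x)), fun x y => ?_⟩
  rw [add_sub_add_comm, add_mul]
  exact (norm_add_le _ _).trans (add_le_add (h.2 x y) (h'.2 x y))

theorem mul (h : ChordBound K φ) (h' : ChordBound L χ) :
    ChordBound (2 * (K * L)) fun x => φ x * χ x := by
  have hK := h.nonneg
  have hL := h'.nonneg
  have hKL := mul_nonneg hK hL
  refine ⟨fun x => ?_, fun x y => ?_⟩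
  · rw [norm_mul]
    have := mul_le_mul (h.1 x) (h'.1 x) (norm_nonneg _) hK
    linarith
  · have h1 : φ x * χ x - φ y * χ y = φ x * (χ x - χ y) + (φ x - φ y) * χ y := by ring
    rw [h1]
    refine (norm_add_le _ _).trans ?_
    rw [norm_mul, norm_mul]
    have h2 := mul_le_mul (h.1 x) (h'.2 x y) (norm_nonneg _) hK
    have h3 := mul_le_mul (h.2 x y) (h'.1 y) (norm_nonneg _) (mul_nonneg hK (chord_nonneg x y))
    linarith

theorem const (c : ℂ) : ChordBound ‖c‖ fun _ => c :=
  ⟨fun _ => le_rfl, fun x y => by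
    rw [sub_self, norm_zero]
    exact mul_nonneg (norm_nonneg c) (chord_nonneg x y)⟩

theorem const_mul (h : ChordBound K φ) (c : ℂ) : ChordBound (‖c‖ * K) fun x => c * φ x := by
  refine ⟨fun x => ?_, fun x y => ?_⟩
  · rw [norm_mul]
    exact mul_le_mul_of_nonneg_left (h.1 x) (norm_nonneg c)
  · rw [← mul_sub, norm_mul, mul_assoc]
    exact mul_le_mul_of_nonneg_left (h.2 x y) (norm_nonneg c)

/-- `√(1 + x²) ≤ c |x - α|` for some `c`. In the constant `c + c²` the first term bounds the
function and the second its difference quotient `1 / ((x - α)(y - α))`. -/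
theorem exists_inv_sub {α : ℂ} (hα : α.im ≠ 0) :
    ∃ K, ChordBound K fun x => ((x : ℂ) - α)⁻¹ := by
  have hlow : ∃ c : ℝ, 0 < c ∧ ∀ x : ℝ, √(1 + x ^ 2) ≤ c * ‖(x : ℂ) - α‖ := by
    refine ⟨1 + (1 + ‖α‖) / |α.im|, by positivity, fun x => ?_⟩
    have h1 := abs_im_le_norm_ofReal_sub α x
    have h2 : |x| ≤ ‖(x : ℂ) - α‖ + ‖α‖ := by
      have h3 := norm_add_le ((x : ℂ) - α) α
      rwa [sub_add_cancel, norm_real, Real.norm_eq_abs] at h3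
    have h3 : √(1 + x ^ 2) ≤ 1 + |x| := by
      rw [Real.sqrt_le_left (by positivity)]
      nlinarith [sq_abs x, abs_nonneg x]
    have h4 : 1 + ‖α‖ ≤ (1 + ‖α‖) / |α.im| * ‖(x : ℂ) - α‖ := by
      rw [div_mul_eq_mul_div, le_div_iff₀ (abs_pos.2 hα)]
      exact mul_le_mul_of_nonneg_left h1 (by positivity)
    linarith
  obtain ⟨c, hc, hlow⟩ := hlow
  refine ⟨c + c ^ 2, fun x => ?_, fun x y => ?_⟩
  · have h1 : 1 ≤ √(1 + x ^ 2) := by rw [Real.one_le_sqrt]; nlinarith [sq_nonneg x]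
    rw [norm_inv]
    refine inv_le_of_inv_le₀ (by positivity) ?_
    have h2 := h1.trans (hlow x)
    rw [inv_le_iff_one_le_mul₀ (by positivity)]
    nlinarith [norm_nonneg ((x : ℂ) - α), mul_nonneg (sq_nonneg c) (norm_nonneg ((x : ℂ) - α))]
  · have hx := ofReal_sub_ne_zero hα x
    have hy := ofReal_sub_ne_zero hα y
    have hx' := norm_pos_iff.2 hx
    have hy' := norm_pos_iff.2 hy
    have h1 : ((x : ℂ) - α)⁻¹ - ((y : ℂ) - α)⁻¹ =
        ((y - x : ℝ) : ℂ) / (((x : ℂ) - α) * ((y : ℂ) - α)) := by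
      field_simp
      push_cast
      ring
    rw [h1, norm_div, norm_mul, norm_real, Real.norm_eq_abs, abs_sub_comm, chord]
    have h2 : |x - y| / (‖(x : ℂ) - α‖ * ‖(y : ℂ) - α‖) ≤
        c ^ 2 * (|x - y| / (√(1 + x ^ 2) * √(1 + y ^ 2))) := by
      rw [← mul_div_assoc, div_le_div_iff₀ (by positivity) (by positivity)]
      have := mul_le_mul (hlow x) (hlow y) (by positivity) (by positivity)
      nlinarith [mul_le_mul_of_nonneg_left this (abs_nonneg (x - y))]
    have h3 : 0 ≤ c * (|x - y| / (√(1 + x ^ 2) * √(1 + y ^ 2))) := by positivity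
    linarith

theorem exists_ratio {s : Multiset ℂ} (hs : ∀ a ∈ s, a.im ≠ 0) :
    ∀ {P : ℂ[X]}, P.natDegree ≤ Multiset.card s →
      ∃ K, ChordBound K fun x => P.eval (x : ℂ) / (rootPoly s).eval (x : ℂ) := by
  induction s using Multiset.induction_on with
  | empty =>
    intro P hP
    rw [Multiset.card_zero, Nat.le_zero, natDegree_eq_zero] at hP
    obtain ⟨c, rfl⟩ := hP
    exact ⟨‖c‖, by simpa [rootPoly_zero] using const c⟩
  | cons a s ih =>
    intro P hP
    rw [Multiset.card_cons] at hP
    have hs' : ∀ b ∈ s, b.im ≠ 0 := fun b hb => hs b (Multiset.mem_cons_of_mem hb)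
    have ha := hs a (Multiset.mem_cons_self a s)
    obtain ⟨Q, c, hPQ, hQ⟩ := exists_eq_X_sub_C_mul_add P a hP
    obtain ⟨K, hK⟩ := ih hs' hQ
    obtain ⟨L, hL⟩ := ih hs' (P := C c) (by simp)
    obtain ⟨M, hM⟩ := exists_inv_sub ha
    refine ⟨_, (hK.add (hM.mul hL)).congr fun x => ?_⟩
    have h3 := ofReal_sub_ne_zero ha x
    have h4 := eval_rootPoly_ne_zero hs' x
    simp only [hPQ, rootPoly_cons, eval_mul, eval_add, eval_sub, eval_X, eval_C]
    field_simp

end ChordBound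

/-- A rational function without poles on the real line or at infinity is bounded and continuous. -/
def ratBdd {s : Multiset ℂ} (hs : ∀ a ∈ s, a.im ≠ 0) {P : ℂ[X]}
    (hP : P.natDegree ≤ Multiset.card s) : BoundedContinuousFunction ℝ ℂ :=
  BoundedContinuousFunction.ofNormedAddCommGroup
    (fun x : ℝ => P.eval (x : ℂ) / (rootPoly s).eval (x : ℂ))
    ((P.continuous.comp continuous_ofReal).div ((rootPoly s).continuous.comp continuous_ofReal)
      (eval_rootPoly_ne_zero hs))
    (ChordBound.exists_ratio hs hP).choose (ChordBound.exists_ratio hs hP).choose_spec.1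

theorem ratBdd_apply {s : Multiset ℂ} (hs : ∀ a ∈ s, a.im ≠ 0) {P : ℂ[X]}
    (hP : P.natDegree ≤ Multiset.card s) (x : ℝ) :
    ratBdd hs hP x = P.eval (x : ℂ) / (rootPoly s).eval (x : ℂ) := rfl

/-- The Toeplitz operator depends linearly and continuously on the symbol. -/
def toeplitzL : Lp (C2 →L[ℂ] C2) ∞ (volume : Measure ℝ) →L[ℂ] (hardySpace →L[ℂ] hardySpace) :=
  let P : (hardySpace →L[ℂ] L2C2) →L[ℂ] (hardySpace →L[ℂ] hardySpace) :=
    hardySpace.orthogonalProjectionOnto.postcomp hardySpace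
  let J : (L2C2 →L[ℂ] L2C2) →L[ℂ] (hardySpace →L[ℂ] L2C2) :=
    hardySpace.subtypeL.precomp L2C2
  P ∘L J ∘L (ContinuousLinearMap.id ℂ (C2 →L[ℂ] C2)).holderL volume ∞ 2 2

/-- The elementary matrices as operators on `ℂ²`. -/
def matUnit (i j : Fin 2) : C2 →L[ℂ] C2 :=
  Matrix.toEuclideanCLM (𝕜 := ℂ) (n := Fin 2) (Matrix.single i j 1)

/-- Only `w`, its conjugate and `(1 + w w̄)⁻¹` occur, so the symbol is built by operations of the
Banach algebra of bounded continuous functions. -/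
theorem pauliMatrix_stereo (w : ℂ) :
    pauliMatrix (stereo w) =
      (1 - 2 * (1 + w * starRingEnd ℂ w)⁻¹) • Matrix.single 0 0 1 +
      (2 * w * (1 + w * starRingEnd ℂ w)⁻¹) • Matrix.single 0 1 1 +
      (2 * starRingEnd ℂ w * (1 + w * starRingEnd ℂ w)⁻¹) • Matrix.single 1 0 1 -
      (1 - 2 * (1 + w * starRingEnd ℂ w)⁻¹) • Matrix.single 1 1 1 := by
  have h0 : ((1 + normSq w : ℝ) : ℂ) ≠ 0 := ofReal_ne_zero.2 (one_add_normSq_pos w).ne'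
  have h1 : 1 + w * starRingEnd ℂ w = ((1 + normSq w : ℝ) : ℂ) := by rw [mul_conj]; simp
  rw [h1]
  have hc : starRingEnd ℂ w = (w.re : ℂ) - (w.im : ℂ) * I := by apply Complex.ext <;> simp
  have hw : w = (w.re : ℂ) + (w.im : ℂ) * I := (re_add_im w).symm
  have e2 : ((stereo w 2 : ℝ) : ℂ) = 1 - 2 * ((1 + normSq w : ℝ) : ℂ)⁻¹ := by
    simp only [stereo, PiLp.toLp_apply, Matrix.cons_val]
    push_cast at h0 ⊢
    field_simp
    ring
  have e0 : ((stereo w 0 : ℝ) : ℂ) - I * ((stereo w 1 : ℝ) : ℂ) =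
      2 * w * ((1 + normSq w : ℝ) : ℂ)⁻¹ := by
    simp only [stereo, PiLp.toLp_apply, Matrix.cons_val]
    generalize hN : normSq w = N
    conv_rhs => rw [hw]
    push_cast
    ring
  have e1 : ((stereo w 0 : ℝ) : ℂ) + I * ((stereo w 1 : ℝ) : ℂ) =
      2 * starRingEnd ℂ w * ((1 + normSq w : ℝ) : ℂ)⁻¹ := by
    simp only [stereo, PiLp.toLp_apply, Matrix.cons_val]
    rw [hc]
    push_cast
    ring
  ext i j
  fin_cases i <;> fin_cases j
  · simpa [pauliMatrix, Matrix.single] using e2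
  · simpa [pauliMatrix, Matrix.single] using e0
  · simpa [pauliMatrix, Matrix.single] using e1
  · simpa [pauliMatrix, Matrix.single] using congrArg Neg.neg e2

variable {W : BoundedContinuousFunction ℝ ℂ}

theorem isUnit_one_add_mul_star (W : BoundedContinuousFunction ℝ ℂ) : IsUnit (1 + W * star W) := by
  have h0 : ∀ x, 1 + W x * star (W x) = ((1 + normSq (W x) : ℝ) : ℂ) := by
    intro x
    rw [star_def, mul_conj]
    simp
  have h1 : ∀ x, 1 + W x * star (W x) ≠ 0 := fun x => by
    rw [h0]
    exact ofReal_ne_zero.2 (one_add_normSq_pos _).ne'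
  let V : BoundedContinuousFunction ℝ ℂ := BoundedContinuousFunction.ofNormedAddCommGroup
    (fun x => (1 + W x * star (W x))⁻¹)
    ((continuous_const.add (W.continuous.mul W.continuous.star)).inv₀ h1) 1 (by
      intro x
      rw [h0, norm_inv, norm_real, Real.norm_eq_abs, abs_of_pos (one_add_normSq_pos _)]
      refine inv_le_one_of_one_le₀ ?_
      linarith [normSq_nonneg (W x)])
  refine IsUnit.of_mul_eq_one V ?_
  ext x
  exact mul_inv_cancel₀ (h1 x)

theorem inverse_one_add_mul_star_apply (W : BoundedContinuousFunction ℝ ℂ) (x : ℝ) :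
    Ring.inverse (1 + W * star W) x = (1 + W x * starRingEnd ℂ (W x))⁻¹ := by
  have h := congrArg (fun V : BoundedContinuousFunction ℝ ℂ => V x)
    (Ring.mul_inverse_cancel _ (isUnit_one_add_mul_star W))
  exact eq_inv_of_mul_eq_one_right h

theorem toLp_pauliSymbol_eq {u : ℝ → R3} (hu : u ∈ ratMaps) (hW : ∀ x, u x = stereo (W x)) :
    (memLp_pauliSymbol hu).toLp =
      bddSymbol (matUnit 0 0) (1 - (2 : ℝ) • Ring.inverse (1 + W * star W)) +
      bddSymbol (matUnit 0 1) ((2 : ℝ) • W * Ring.inverse (1 + W * star W)) +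
      bddSymbol (matUnit 1 0) ((2 : ℝ) • star W * Ring.inverse (1 + W * star W)) -
      bddSymbol (matUnit 1 1) (1 - (2 : ℝ) • Ring.inverse (1 + W * star W)) := by
  apply Lp.ext
  generalize hg1 : bddSymbol (matUnit 0 0) (1 - (2 : ℝ) • Ring.inverse (1 + W * star W)) = g1
  generalize hg2 : bddSymbol (matUnit 0 1) ((2 : ℝ) • W * Ring.inverse (1 + W * star W)) = g2
  generalize hg3 : bddSymbol (matUnit 1 0) ((2 : ℝ) • star W * Ring.inverse (1 + W * star W)) = g3
  generalize hg4 : bddSymbol (matUnit 1 1) (1 - (2 : ℝ) • Ring.inverse (1 + W * star W)) = g4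
  filter_upwards [(memLp_pauliSymbol hu).coeFn_toLp, Lp.coeFn_sub (g1 + g2 + g3) g4,
    Lp.coeFn_add (g1 + g2) g3, Lp.coeFn_add g1 g2, hg1 ▸ coeFn_bddSymbol _ _,
    hg2 ▸ coeFn_bddSymbol _ _, hg3 ▸ coeFn_bddSymbol _ _, hg4 ▸ coeFn_bddSymbol _ _]
    with x h0 h1 h2 h3 h4 h5 h6 h7
  rw [h0, h1, Pi.sub_apply, h2, Pi.add_apply, h3, Pi.add_apply, h4, h5, h6, h7, pauliSymbol, hW,
    pauliMatrix_stereo, map_sub, map_add, map_add, map_smul, map_smul, map_smul, map_smul]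
  simp only [BoundedContinuousFunction.coe_sub, BoundedContinuousFunction.coe_one, Pi.sub_apply,
    Pi.one_apply, BoundedContinuousFunction.coe_smul, BoundedContinuousFunction.coe_mul,
    Pi.mul_apply, inverse_one_add_mul_star_apply, BoundedContinuousFunction.star_apply, real_smul,
    star_def, ofReal_ofNat, matUnit]

/-- Inversion is analytic on the units of a Banach algebra, and the Toeplitz operator is linear and
continuous in its symbol. Conjugation is only real linear, hence the real parameter. -/
theorem analyticAt_toeplitzOfRat {u : ℝ → ℝ → R3} (hu : ∀ t, u t ∈ ratMaps)
    (W G : BoundedContinuousFunction ℝ ℂ) (hW : ∀ t x, u t x = stereo ((W + t • G) x)) (t : ℝ) :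
    AnalyticAt ℝ (fun t => toeplitzOfRat (u t) (hu t)) t := by
  have h1 : AnalyticAt ℝ (fun t : ℝ => W + t • G) t :=
    analyticAt_const.add (analyticAt_id.smul analyticAt_const)
  have h2 : AnalyticAt ℝ (fun t : ℝ => star (W + t • G)) t := by
    have : (fun t : ℝ => star (W + t • G)) = fun t : ℝ => star W + t • star G := by
      ext1 t
      rw [star_add, star_smul, star_trivial t]
    rw [this]
    exact analyticAt_const.add (analyticAt_id.smul analyticAt_const)
  have h3 : AnalyticAt ℝ (fun t : ℝ => Ring.inverse (1 + (W + t • G) * star (W + t • G))) t := by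
    have h4 : AnalyticAt ℝ (fun t : ℝ => 1 + (W + t • G) * star (W + t • G)) t :=
      analyticAt_const.add (h1.mul h2)
    exact AnalyticAt.comp (g := Ring.inverse)
      (analyticAt_inverse (𝕜 := ℝ) (isUnit_one_add_mul_star (W + t • G)).unit) h4
  have hL : ∀ (m : C2 →L[ℂ] C2) {V : ℝ → BoundedContinuousFunction ℝ ℂ}, AnalyticAt ℝ V t →
      AnalyticAt ℝ (fun t => bddSymbol m (V t)) t := fun m V hV =>
    ((bddSymbol m).restrictScalars ℝ).analyticAt _ |>.comp hV
  have h4 : AnalyticAt ℝ (fun t => (memLp_pauliSymbol (hu t)).toLp) t := by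
    simp only [fun t => toLp_pauliSymbol_eq (hu t) (hW t)]
    have h5 : AnalyticAt ℝ (fun t : ℝ => (1 : BoundedContinuousFunction ℝ ℂ) -
        (2 : ℝ) • Ring.inverse (1 + (W + t • G) * star (W + t • G))) t :=
      analyticAt_const.sub (analyticAt_const.fun_smul h3)
    exact (((hL _ h5).add (hL _ ((analyticAt_const.fun_smul h1).mul h3))).add
      (hL _ ((analyticAt_const.fun_smul h2).mul h3))).sub (hL _ h5)
  exact (ContinuousLinearMap.analyticAt (F := hardySpace →L[ℂ] hardySpace)
    (toeplitzL.restrictScalars ℝ) _).comp h4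

/-- The exceptional set has at most one point. -/
theorem eventually_codiscrete_add_mul_ne_zero (a : ℂ) {b : ℂ} (hb : b ≠ 0) :
    ∀ᶠ t : ℝ in codiscrete ℝ, a + (t : ℂ) * b ≠ 0 := by
  refine codiscreteWithin_iff_locallyFiniteComplementWithin.2 fun z _ => ⟨Set.univ, univ_mem, ?_⟩
  refine Set.Subsingleton.finite ?_
  rintro t ⟨-, -, ht⟩ t' ⟨-, -, ht'⟩
  have h1 : a + (t : ℂ) * b = 0 := by simpa using ht
  have h2 : a + (t' : ℂ) * b = 0 := by simpa using ht'
  have h3 : (t : ℂ) * b = t' * b := by linear_combination h1 - h2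
  exact_mod_cast mul_right_cancel₀ hb h3

theorem isCoprime_rootPoly {P : ℂ[X]} {s : Multiset ℂ} (h : ∀ a ∈ s, P.eval a ≠ 0) :
    IsCoprime P (rootPoly s) := by
  induction s using Multiset.induction_on with
  | empty => rw [rootPoly_zero]; exact isCoprime_one_right
  | cons a s ih =>
    rw [rootPoly_cons]
    refine IsCoprime.mul_right ?_ (ih fun b hb => h b (Multiset.mem_cons_of_mem hb))
    have ha := h a (Multiset.mem_cons_self a s)
    obtain ⟨Q, c, hPQ, -⟩ := exists_eq_X_sub_C_mul_add P a (n := P.natDegree) (by omega)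
    rw [hPQ] at ha ⊢
    have hc : c ≠ 0 := by simpa using ha
    rw [add_comm, IsCoprime.add_mul_left_left_iff]
    exact ⟨C c⁻¹, 0, by rw [← C_mul, inv_mul_cancel₀ hc, C_1, zero_mul, add_zero]⟩

/-- Induction on the poles. Splitting `p = (x - z) p₁ + c`, the hypothesis replaces `p₁` by a nearby
simple `p₂`, and `(x - z) p₂ + t e` with generic `t` restores the pole at `z`. Coprimality is
carried along because it fixes the rank of `1 - T²` at the next stage. -/
theorem exists_perturbation_simple {s : Multiset ℂ} (hs : ∀ a ∈ s, a.im ≠ 0) :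
    ∀ {p : ℂ[X]}, p.natDegree ≤ Multiset.card s → ∀ {ε : ℝ}, 0 < ε →
      ∃ p' : ℂ[X], p'.natDegree ≤ Multiset.card s ∧ IsCoprime p' (rootPoly s) ∧
        SimpleAwayFromOne (ratToeplitz p' (eval_rootPoly_ne_zero hs)) ∧
        ChordBound ε fun x => (p' - p).eval (x : ℂ) / (rootPoly s).eval (x : ℂ) := by
  induction s using Multiset.induction_on with
  | empty =>
    intro p hp ε hε
    refine ⟨p, hp, by rw [rootPoly_zero]; exact isCoprime_one_right, ?_, ?_⟩
    -- Without poles the rank bound is zero, so there is no eigenvalue other than `±1`.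
    · intro z h1 h2
      have hd : p.natDegree ≤ (rootPoly 0).natDegree := by rwa [natDegree_rootPoly]
      have := finiteDimensional_defectSpace (eval_rootPoly_ne_zero hs) hd
      have h3 := Submodule.finrank_mono (eigenspace_le_defectSpace
        (T := ratToeplitz p (eval_rootPoly_ne_zero hs)) h1 h2)
      have h4 := finrank_defectSpace_le (eval_rootPoly_ne_zero hs) hd
      rw [natDegree_rootPoly, Multiset.card_zero] at h4
      omega
    · simp only [sub_self, eval_zero, zero_div]
      exact ((ChordBound.const 0).mono (by simpa using hε.le))
  | cons z s ih =>
    intro p hp ε hε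
    rw [Multiset.card_cons] at hp
    have hs' : ∀ b ∈ s, b.im ≠ 0 := fun b hb => hs b (Multiset.mem_cons_of_mem hb)
    have hz := hs z (Multiset.mem_cons_self z s)
    obtain ⟨p₁, c, hpp, hp₁⟩ := exists_eq_X_sub_C_mul_add p z hp
    obtain ⟨p₂, hp₂, hcop, hsim, hcl⟩ := ih hs' hp₁ (half_pos hε)
    obtain ⟨D, hD⟩ := ChordBound.exists_ratio hs (P := 1) (by simp)
    -- The direction `e` must be non-zero even if `c = 0`; then the target parameter is `0` itself.
    obtain ⟨e, t₀, he, hte⟩ : ∃ (e : ℂ) (t₀ : ℝ), e ≠ 0 ∧ (t₀ : ℂ) * e = c := by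
      by_cases hc : c = 0
      · exact ⟨1, 0, one_ne_zero, by simp [hc]⟩
      · exact ⟨c, 1, hc, by simp⟩
    have hqz := eval_rootPoly_ne_zero hs
    let P : ℝ → ℂ[X] := fun t => (X - C z) * p₂ + C ((t : ℂ) * e)
    have hPdeg : ∀ t, (P t).natDegree ≤ Multiset.card (z ::ₘ s) := by
      intro t
      rw [Multiset.card_cons]
      refine (natDegree_add_C.le).trans (natDegree_mul_le.trans ?_)
      rw [natDegree_X_sub_C]
      omega
    have hPdeg' : ∀ t, (P t).natDegree ≤ (rootPoly (z ::ₘ s)).natDegree := fun t => by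
      rw [natDegree_rootPoly]
      exact hPdeg t
    have hgen : ∀ᶠ t : ℝ in codiscrete ℝ, IsCoprime (P t) (rootPoly (z ::ₘ s)) := by
      have h1 : ∀ᶠ t : ℝ in codiscrete ℝ, ∀ a ∈ (z ::ₘ s).toFinset,
          ((X - C z) * p₂).eval a + (t : ℂ) * e ≠ 0 := by
        rw [Filter.eventually_all_finset]
        exact fun a _ => eventually_codiscrete_add_mul_ne_zero _ he
      filter_upwards [h1] with t ht
      refine isCoprime_rootPoly fun a ha => ?_
      have := ht a (Multiset.mem_toFinset.2 ha)
      simpa [P] using this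
    let T : ℝ → hardySpace →L[ℂ] hardySpace := fun t => ratToeplitz (P t) hqz
    have hfd : ∀ t, FiniteDimensional ℂ (defectSpace (T t)) := fun t =>
      finiteDimensional_defectSpace hqz (hPdeg' t)
    have hTan : ∀ t, AnalyticAt ℝ T t := by
      refine analyticAt_toeplitzOfRat (fun t => ratU_mem_ratMaps hqz)
        (ratBdd hs (P := (X - C z) * p₂) (by simpa [P] using hPdeg 0))
        (ratBdd hs (P := C e) (by simp)) fun t x => ?_
      rw [ratU]
      congr 1
      simp only [P, BoundedContinuousFunction.coe_add, Pi.add_apply,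
        BoundedContinuousFunction.coe_smul, ratBdd_apply, real_smul, eval_add, eval_C, add_div,
        mul_div_assoc]
    -- At `t = 0` the factor `x - z` cancels, so the family starts at the simple operator of the
    -- previous stage, with one pole fewer.
    have hT0 : T 0 = ratToeplitz p₂ (eval_rootPoly_ne_zero hs') := by
      have h1 : ratU (P 0) (rootPoly (z ::ₘ s)) = ratU p₂ (rootPoly s) := by
        ext1 x
        rw [ratU, ratU]
        congr 1
        simp only [P, rootPoly_cons, ofReal_zero, zero_mul, C_0, add_zero, eval_mul]
        refine mul_div_mul_left _ _ ?_
        simpa using ofReal_sub_ne_zero hz x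
      simp only [T, ratToeplitz, h1]
    have hsimple : ∀ᶠ t in codiscrete ℝ, SimpleAwayFromOne (T t) := by
      refine eventually_codiscrete_simple (R := Multiset.card s) hTan
        (fun t => isSelfAdjoint_toeplitzOfRat _) (fun t => ?_) ?_ ?_ ?_
      · have := finrank_defectSpace_le hqz (hPdeg' t)
        rwa [natDegree_rootPoly, Multiset.card_cons] at this
      · rw [hT0, finrank_defectSpace_eq (eval_rootPoly_ne_zero hs')
          (by rwa [natDegree_rootPoly]) hcop, natDegree_rootPoly]
      · filter_upwards [hgen] with t ht
        have := finrank_defectSpace_eq hqz (hPdeg' t) ht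
        rwa [natDegree_rootPoly, Multiset.card_cons] at this
      · rw [hT0]
        exact hsim
    have hnear : ∀ᶠ t : ℝ in 𝓝 t₀, ‖(t : ℂ) * e - c‖ * D < ε / 2 := by
      have h1 : Continuous fun t : ℝ => ‖(t : ℂ) * e - c‖ * D := by fun_prop
      refine h1.continuousAt.eventually_lt continuousAt_const ?_
      rw [hte, sub_self, norm_zero, zero_mul]
      exact half_pos hε
    have hboth := hgen.and hsimple
    have hpt : ∀ᶠ t in 𝓝[≠] t₀, IsCoprime (P t) (rootPoly (z ::ₘ s)) ∧ SimpleAwayFromOne (T t) := by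
      rw [Filter.Eventually, mem_codiscrete] at hboth
      exact Filter.disjoint_principal_right.1 (hboth t₀) |> fun h => by rwa [compl_compl] at h
    obtain ⟨t, ⟨ht1, ht2⟩, ht3⟩ := (hpt.and (hnear.filter_mono nhdsWithin_le_nhds)).exists
    refine ⟨P t, hPdeg t, ht1, ht2, ?_⟩
    have h1 := (hcl.add (hD.const_mul ((t : ℂ) * e - c))).mono
      (L := ε) (by linarith)
    refine h1.congr fun x => ?_
    have h3 := ofReal_sub_ne_zero hz x
    have h4 := eval_rootPoly_ne_zero hs' x
    simp only [P, hpp, rootPoly_cons, eval_mul, eval_add, eval_sub, eval_X, eval_C, eval_one]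
    field_simp
    ring

end Perturbation

/-! ### Convergence of integrals from pointwise convergence and an energy bound. -/

section Convergence

/-- A form of dominated convergence in which the dominating functions converge as well. -/
theorem tendsto_lintegral_zero_of_le_mul_add {Z : Type*} [MeasurableSpace Z] {ν : Measure Z}
    {h : Z → ℝ≥0∞} {hn d : ℕ → Z → ℝ≥0∞} {C : ℝ≥0∞} (hC : C ≠ ∞) (hh : Measurable h)
    (hhn : ∀ n, Measurable (hn n)) (hd : ∀ n, Measurable (d n)) (hfin : ∫⁻ z, h z ∂ν ≠ ∞)
    (hle : ∀ n, ∫⁻ z, hn n z ∂ν ≤ ∫⁻ z, h z ∂ν)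
    (hlim : ∀ᵐ z ∂ν, Tendsto (fun n => hn n z) atTop (𝓝 (h z)))
    (hdom : ∀ n, ∀ᵐ z ∂ν, d n z ≤ C * (hn n z + h z))
    (hd0 : ∀ᵐ z ∂ν, Tendsto (fun n => d n z) atTop (𝓝 0)) :
    Tendsto (fun n => ∫⁻ z, d n z ∂ν) atTop (𝓝 0) := by
  set M := C * (∫⁻ z, h z ∂ν + ∫⁻ z, h z ∂ν) with hM
  have hMfin : M ≠ ∞ := ENNReal.mul_ne_top hC (ENNReal.add_ne_top.2 ⟨hfin, hfin⟩)
  have hgm : ∀ n, Measurable fun z => C * (hn n z + h z) := fun n =>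
    ((hhn n).add hh).const_mul C
  have hg : ∀ n, ∫⁻ z, C * (hn n z + h z) ∂ν ≤ M := by
    intro n
    rw [lintegral_const_mul C (by fun_prop), lintegral_add_left (hhn n), hM]
    exact mul_le_mul' le_rfl (add_le_add (hle n) le_rfl)
  have hD : ∀ n, ∫⁻ z, d n z ∂ν ≤ M := fun n => (lintegral_mono_ae (hdom n)).trans (hg n)
  -- Fatou's lemma for the non-negative functions `C (hn + h) - d n`, which converge to `2 C h`.
  have hfatou : M ≤ liminf (fun n => M - ∫⁻ z, d n z ∂ν) atTop := by
    calc M = ∫⁻ z, C * (h z + h z) ∂ν := by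
          rw [lintegral_const_mul C (by fun_prop), lintegral_add_left hh]
      _ = ∫⁻ z, liminf (fun n => C * (hn n z + h z) - d n z) atTop ∂ν := by
          refine lintegral_congr_ae ?_
          filter_upwards [hlim, hd0, ae_lt_top hh hfin] with z h1 h2 h3
          have h4 : Tendsto (fun n => C * (hn n z + h z)) atTop (𝓝 (C * (h z + h z))) :=
            ENNReal.Tendsto.const_mul (h1.add tendsto_const_nhds) (Or.inr hC)
          have h5 := ENNReal.Tendsto.sub h4 h2 (Or.inr ENNReal.zero_ne_top)
          rw [tsub_zero] at h5
          exact h5.liminf_eq.symm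
      _ ≤ liminf (fun n => ∫⁻ z, C * (hn n z + h z) - d n z ∂ν) atTop :=
          lintegral_liminf_le fun n => (hgm n).sub (hd n)
      _ ≤ liminf (fun n => M - ∫⁻ z, d n z ∂ν) atTop := by
          refine liminf_le_liminf (Eventually.of_forall fun n => ?_)
          rw [lintegral_sub (hd n) (ne_top_of_le_ne_top hMfin (hD n)) (hdom n)]
          exact tsub_le_tsub_right (hg n) _
  rw [ENNReal.tendsto_nhds_zero]
  intro δ hδ
  by_cases hM0 : M = 0
  · exact Eventually.of_forall fun n => ((hD n).trans hM0.le).trans zero_le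
  · have hlt : M - δ < liminf (fun n => M - ∫⁻ z, d n z ∂ν) atTop :=
      (ENNReal.sub_lt_self hMfin hM0 hδ.ne').trans_le hfatou
    filter_upwards [eventually_lt_of_lt_liminf hlt] with n hn
    by_contra hcon
    exact absurd hn (not_lt.2 (tsub_le_tsub_left (not_le.1 hcon).le M))

theorem enorm_sub_sq_le {V : Type*} [NormedAddCommGroup V] (a b : V) :
    ‖a - b‖ₑ ^ 2 ≤ 2 * (‖a‖ₑ ^ 2 + ‖b‖ₑ ^ 2) := by
  have h1 : ‖a - b‖ ^ 2 ≤ 2 * (‖a‖ ^ 2 + ‖b‖ ^ 2) := by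
    have := norm_sub_le a b
    nlinarith [sq_nonneg (‖a‖ - ‖b‖), norm_nonneg (a - b)]
  simp only [← ofReal_norm, ← ENNReal.ofReal_pow (norm_nonneg _)]
  rw [← ENNReal.ofReal_add (by positivity) (by positivity), ← ENNReal.ofReal_ofNat,
    ← ENNReal.ofReal_mul (by norm_num)]
  exact ENNReal.ofReal_le_ofReal h1

/-- The `L²` norms of `Hn` do not exceed that of their pointwise limit, so no mass is lost. The `Gn`
are dominated by the `Hn` and inherit the convergence. -/
theorem tendsto_lintegral_enorm_sub_sq {Z : Type*} [MeasurableSpace Z] {ν : Measure Z}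
    {V V' : Type*} [NormedAddCommGroup V] [MeasurableSpace V] [BorelSpace V]
    [SecondCountableTopology V]
    [NormedAddCommGroup V'] [MeasurableSpace V'] [BorelSpace V'] [SecondCountableTopology V']
    {H : Z → V} {Hn : ℕ → Z → V} {G : Z → V'} {Gn : ℕ → Z → V'} {L : ℝ≥0∞} (hL : L ≠ ∞)
    (hH : Measurable H) (hHn : ∀ n, Measurable (Hn n)) (hG : Measurable G)
    (hGn : ∀ n, Measurable (Gn n)) (hfin : ∫⁻ z, ‖H z‖ₑ ^ 2 ∂ν ≠ ∞)
    (hle : ∀ n, ∫⁻ z, ‖Hn n z‖ₑ ^ 2 ∂ν ≤ ∫⁻ z, ‖H z‖ₑ ^ 2 ∂ν)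
    (hlim : ∀ᵐ z ∂ν, Tendsto (fun n => Hn n z) atTop (𝓝 (H z)))
    (hGlim : ∀ᵐ z ∂ν, Tendsto (fun n => Gn n z) atTop (𝓝 (G z)))
    (hLn : ∀ n z, ‖Gn n z‖ₑ ≤ L * ‖Hn n z‖ₑ) (hL' : ∀ z, ‖G z‖ₑ ≤ L * ‖H z‖ₑ) :
    Tendsto (fun n => ∫⁻ z, ‖Gn n z - G z‖ₑ ^ 2 ∂ν) atTop (𝓝 0) := by
  refine tendsto_lintegral_zero_of_le_mul_add (C := 2 * L ^ 2)
    (ENNReal.mul_ne_top (by simp) (ENNReal.pow_ne_top hL)) (hH.enorm.pow_const 2)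
    (fun n => (hHn n).enorm.pow_const 2) (fun n => ((hGn n).sub hG).enorm.pow_const 2) hfin hle
    ?_ (fun n => Eventually.of_forall fun z => ?_) ?_
  · filter_upwards [hlim] with z hz
    exact (((ENNReal.continuous_pow 2).comp continuous_enorm).tendsto _).comp hz
  · refine (enorm_sub_sq_le _ _).trans ?_
    rw [mul_assoc, mul_add (L ^ 2), ← mul_pow, ← mul_pow]
    gcongr
    · exact hLn n z
    · exact hL' z
  · filter_upwards [hGlim] with z hz
    have h1 : Tendsto (fun n => Gn n z - G z) atTop (𝓝 0) := by
      simpa using hz.sub_const (G z)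
    have h2 := (((ENNReal.continuous_pow 2).comp continuous_enorm).tendsto (0 : V')).comp h1
    simpa [Function.comp_def] using h2

theorem sq_lintegral_le {S : Type*} [MeasurableSpace S] {μ : Measure S} [IsProbabilityMeasure μ]
    {g : S → ℝ≥0∞} (hg : AEMeasurable g μ) : (∫⁻ s, g s ∂μ) ^ 2 ≤ ∫⁻ s, g s ^ 2 ∂μ := by
  have h := ENNReal.lintegral_mul_le_Lp_mul_Lq μ Real.HolderConjugate.two_two hg
    (aemeasurable_const (b := (1 : ℝ≥0∞)))
  simp only [Pi.mul_apply, mul_one, ENNReal.one_rpow, lintegral_const, measure_univ] at h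
  calc (∫⁻ s, g s ∂μ) ^ 2 ≤ ((∫⁻ s, g s ^ (2 : ℝ) ∂μ) ^ (1 / 2 : ℝ)) ^ 2 := by gcongr
    _ = ∫⁻ s, g s ^ 2 ∂μ := by
      rw [← ENNReal.rpow_natCast, ← ENNReal.rpow_mul]
      simp

theorem enorm_integral_sq_le {S V : Type*} [MeasurableSpace S] {μ : Measure S}
    [IsProbabilityMeasure μ] [NormedAddCommGroup V] [NormedSpace ℝ V] {g : S → V}
    (hg : AEStronglyMeasurable g μ) : ‖∫ s, g s ∂μ‖ₑ ^ 2 ≤ ∫⁻ s, ‖g s‖ₑ ^ 2 ∂μ :=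
  (pow_le_pow_left' (enorm_integral_le_lintegral_enorm g) 2).trans (sq_lintegral_le hg.enorm)

end Convergence

/-! ### Energy on the circle and averages of translates. -/

noncomputable section CircleEnergy

open Real

/-- The circle `ℝ / 2πℤ`. -/
abbrev Torus : Type := AddCircle (2 * π)

instance : Fact (0 < 2 * π) := ⟨two_pi_pos⟩

/-- The point of the unit circle in `ℂ` with the given angle. -/
def circ (a : Torus) : ℂ := (AddCircle.toCircle a : ℂ)

theorem continuous_circ : Continuous circ :=
  continuous_subtype_val.comp AddCircle.continuous_toCircle

theorem circ_add (a b : Torus) : circ (a + b) = circ a * circ b := by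
  simp [circ, AddCircle.toCircle_add]

theorem norm_circ (a : Torus) : ‖circ a‖ = 1 := Circle.norm_coe _

theorem circ_injective : Function.Injective circ :=
  Subtype.val_injective.comp (AddCircle.injective_toCircle two_pi_pos.ne')

theorem circ_coe (x : ℝ) : circ (x : Torus) = Complex.exp (x * Complex.I) := by
  rw [circ, AddCircle.toCircle_apply_mk, Circle.coe_exp, div_self two_pi_pos.ne', one_mul]

theorem norm_circ_sub_one_le (a : Torus) : ‖circ a - 1‖ ≤ ‖a‖ := by
  obtain ⟨x, hx, rfl⟩ : ∃ x : ℝ, |x| = ‖a‖ ∧ (x : Torus) = a := by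
    induction a using QuotientAddGroup.induction_on with
    | H x =>
      refine ⟨x - round ((2 * π)⁻¹ * x) * (2 * π), (AddCircle.norm_eq (2 * π)).symm, ?_⟩
      rw [AddCircle.coe_sub, ← zsmul_eq_mul, AddCircle.coe_zsmul, AddCircle.coe_period, smul_zero,
        sub_zero]
  rw [← hx, circ_coe, mul_comm]
  exact Real.norm_exp_I_mul_ofReal_sub_one_le

theorem norm_circ_sub_le (a b : Torus) : ‖circ a - circ b‖ ≤ ‖a - b‖ := by
  have h : circ a - circ b = (circ (a - b) - 1) * circ b := by
    rw [sub_mul, one_mul, ← circ_add, sub_add_cancel]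
  rw [h, norm_mul, norm_circ, mul_one]
  exact norm_circ_sub_one_le _

/-- The measure `dα dβ / |e^{iα} - e^{iβ}|²`. -/
def circleMeasure : Measure (Torus × Torus) :=
  (volume.prod volume).withDensity fun z => (‖circ z.1 - circ z.2‖ₑ ^ 2)⁻¹

theorem measurable_circleKernel :
    Measurable fun z : Torus × Torus => (‖circ z.1 - circ z.2‖ₑ ^ 2)⁻¹ := by
  have h1 : Measurable fun z : Torus × Torus => circ z.1 - circ z.2 :=
    ((continuous_circ.comp continuous_fst).sub (continuous_circ.comp continuous_snd)).measurable
  exact (h1.enorm.pow_const 2).inv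

theorem lintegral_circleMeasure {F : Torus × Torus → ℝ≥0∞} (hF : Measurable F) :
    ∫⁻ z, F z ∂circleMeasure =
      ∫⁻ z, (‖circ z.1 - circ z.2‖ₑ ^ 2)⁻¹ * F z ∂((volume : Measure Torus).prod volume) :=
  lintegral_withDensity_eq_lintegral_mul _ measurable_circleKernel hF

instance : SFinite circleMeasure := by
  unfold circleMeasure
  infer_instance

theorem ae_circleMeasure {P : Torus → Prop} (h : ∀ᵐ a, P a) :
    ∀ᵐ z ∂circleMeasure, P z.1 ∧ P z.2 := by
  refine (withDensity_absolutelyContinuous _ _).ae_le ?_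
  exact (Measure.quasiMeasurePreserving_fst.ae h).and (Measure.quasiMeasurePreserving_snd.ae h)

/-- The energy of a function on the circle. -/
def circleEnergy {V : Type*} [NormedAddCommGroup V] (f : Torus → V) : ℝ≥0∞ :=
  ∫⁻ z, ‖f z.1 - f z.2‖ₑ ^ 2 ∂circleMeasure

/-- Simultaneous rotation preserves both the Haar measure and the distance in the kernel. -/
theorem lintegral_circleMeasure_add {F : Torus × Torus → ℝ≥0∞} (hF : Measurable F) (s : Torus) :
    ∫⁻ z, F (z + (s, s)) ∂circleMeasure = ∫⁻ z, F z ∂circleMeasure := by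
  rw [lintegral_circleMeasure hF, lintegral_circleMeasure (F := fun z => F (z + (s, s))) (hF.comp (measurable_add_const (s, s)))]
  conv_rhs => rw [← lintegral_add_right_eq_self _ ((s, s) : Torus × Torus)]
  refine lintegral_congr fun z => ?_
  congr 3
  simp only [Prod.fst_add, Prod.snd_add, circ_add]
  rw [← sub_mul, enorm_mul, ← ofReal_norm (circ s), norm_circ, ENNReal.ofReal_one, mul_one]

variable {V : Type*} [NormedAddCommGroup V] [MeasurableSpace V] [BorelSpace V]
  [SecondCountableTopology V]

theorem integrable_translate {μ : Measure Torus} [IsProbabilityMeasure μ] {f : Torus → V}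
    (hf : Measurable f) {B : ℝ} (hB : ∀ a, ‖f a‖ ≤ B) (a : Torus) :
    Integrable (fun s => f (a + s)) μ :=
  Integrable.of_bound (hf.comp (measurable_const_add a)).aestronglyMeasurable B
    (Eventually.of_forall fun _ => hB _)

variable [NormedSpace ℝ V]

/-- The average of the translates of `f` with respect to `μ`. -/
def mollify (μ : Measure Torus) (f : Torus → V) (a : Torus) : V := ∫ s, f (a + s) ∂μ

theorem measurable_mollify (μ : Measure Torus) [IsProbabilityMeasure μ] {f : Torus → V}
    (hf : Measurable f) : Measurable (mollify μ f) := by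
  have h : StronglyMeasurable fun z : Torus × Torus => f (z.1 + z.2) :=
    (hf.comp measurable_add).stronglyMeasurable
  exact (h.integral_prod_right).measurable

/-- Averaging does not increase the energy. -/
theorem circleEnergy_mollify_le (μ : Measure Torus) [IsProbabilityMeasure μ] {f : Torus → V}
    (hf : Measurable f) {B : ℝ} (hB : ∀ a, ‖f a‖ ≤ B) :
    circleEnergy (mollify μ f) ≤ circleEnergy f := by
  have hF : Measurable fun z : Torus × Torus => ‖f z.1 - f z.2‖ₑ ^ 2 :=
    ((hf.comp measurable_fst).sub (hf.comp measurable_snd)).enorm.pow_const 2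
  have h1 : Measurable fun w : (Torus × Torus) × Torus => f (w.1.1 + w.2) :=
    hf.comp (measurable_fst.fst.add measurable_snd)
  have h2 : Measurable fun w : (Torus × Torus) × Torus => f (w.1.2 + w.2) :=
    hf.comp (measurable_fst.snd.add measurable_snd)
  have hF2 : Measurable fun w : (Torus × Torus) × Torus =>
      ‖f (w.1.1 + w.2) - f (w.1.2 + w.2)‖ₑ ^ 2 := (h1.sub h2).enorm.pow_const 2
  calc circleEnergy (mollify μ f)
      ≤ ∫⁻ z, ∫⁻ s, ‖f (z.1 + s) - f (z.2 + s)‖ₑ ^ 2 ∂μ ∂circleMeasure := by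
        -- Jensen's inequality for the probability measure. After exchanging the integrals, each
        -- translate has the same energy.
        refine lintegral_mono fun z => ?_
        rw [mollify, mollify, ← integral_sub (integrable_translate hf hB _)
          (integrable_translate hf hB _)]
        exact enorm_integral_sq_le ((integrable_translate hf hB _).sub
          (integrable_translate hf hB _)).aestronglyMeasurable
    _ = ∫⁻ s, ∫⁻ z, ‖f (z.1 + s) - f (z.2 + s)‖ₑ ^ 2 ∂circleMeasure ∂μ := by
        exact lintegral_lintegral_swap hF2.aemeasurable
    _ = ∫⁻ _, circleEnergy f ∂μ := by
        exact lintegral_congr fun s => lintegral_circleMeasure_add hF s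
    _ = circleEnergy f := by simp

end CircleEnergy

/-! ### Transfer of the energy between the line and the circle. -/

noncomputable section CayleyTransform

open Real

/-- The parametrization `x ↦ 2 arctan x` of the circle without the point `π`. -/
def cay (x : ℝ) : Torus := ((2 * arctan x : ℝ) : Torus)

theorem measurable_cay : Measurable cay := by
  have h : Continuous cay := continuous_quotient_mk'.comp (continuous_const.mul continuous_arctan)
  exact h.measurable

theorem lintegral_torus (g : Torus → ℝ≥0∞) :
    ∫⁻ a, g a = ∫⁻ x : ℝ, ENNReal.ofReal (2 / (1 + x ^ 2)) * g (cay x) := by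
  have h1 : (fun x => 2 * arctan x) '' Set.univ = Set.Ioo (-π) π := by
    rw [Set.image_univ]
    ext y
    constructor
    · rintro ⟨x, rfl⟩
      have h2 := arctan_lt_pi_div_two x
      have h3 := neg_pi_div_two_lt_arctan x
      simp only [Set.mem_Ioo]
      constructor <;> linarith
    · rintro ⟨h2, h3⟩
      have h4 : y / 2 ∈ Set.range arctan := by
        rw [range_arctan]
        constructor <;> linarith
      obtain ⟨x, hx⟩ := h4
      refine ⟨x, ?_⟩
      simp only [hx]
      ring
  have h2 := lintegral_image_eq_lintegral_abs_deriv_mul (f := fun x => 2 * arctan x)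
    (f' := fun x => 2 / (1 + x ^ 2)) MeasurableSet.univ
    (fun x _ => by
      have := ((hasDerivAt_arctan x).const_mul 2).hasDerivWithinAt (s := Set.univ)
      rwa [mul_one_div] at this)
    (fun x _ y _ hxy => arctan_injective (by simpa using hxy)) (fun θ => g (θ : Torus))
  rw [h1, Measure.restrict_univ] at h2
  -- The parametrization covers the open interval, which differs from a full period by a null set.
  rw [← AddCircle.lintegral_preimage (2 * π) (-π), show -π + 2 * π = π by ring,
    ← Measure.restrict_congr_set Ioo_ae_eq_Ioc, h2]
  refine lintegral_congr fun x => ?_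
  rw [abs_of_pos (by positivity)]
  rfl

theorem one_sub_mul_I_ne_zero (x : ℝ) : 1 - (x : ℂ) * Complex.I ≠ 0 := by
  intro h
  have := congrArg Complex.re h
  simp at this

theorem circ_cay (x : ℝ) :
    circ (cay x) = (1 + (x : ℂ) * Complex.I) / (1 - (x : ℂ) * Complex.I) := by
  have h0 := one_sub_mul_I_ne_zero x
  have hr : √(1 + x ^ 2) ^ 2 = 1 + x ^ 2 := sq_sqrt (by positivity)
  have hr0 : (√(1 + x ^ 2) : ℂ) ≠ 0 := by
    rw [Complex.ofReal_ne_zero]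
    positivity
  have h1 : Complex.exp ((arctan x : ℂ) * Complex.I) =
      (1 + (x : ℂ) * Complex.I) / (√(1 + x ^ 2) : ℂ) := by
    rw [Complex.exp_mul_I, ← Complex.ofReal_cos, ← Complex.ofReal_sin, cos_arctan, sin_arctan]
    push_cast
    field_simp
  have h2 : ((√(1 + x ^ 2) : ℝ) : ℂ) ^ 2 = (1 + (x : ℂ) * Complex.I) * (1 - (x : ℂ) * Complex.I) := by
    rw [← Complex.ofReal_pow, hr]
    push_cast
    linear_combination (x : ℂ) ^ 2 * Complex.I_sq
  rw [cay, circ_coe]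
  have h3 : ((2 * arctan x : ℝ) : ℂ) * Complex.I =
      (arctan x : ℂ) * Complex.I + (arctan x : ℂ) * Complex.I := by
    push_cast
    ring
  rw [h3, Complex.exp_add, h1, div_mul_div_comm, ← sq (√(1 + x ^ 2) : ℂ), h2]
  have h4 : (1 + (x : ℂ) * Complex.I) ≠ 0 := by
    intro h
    have := congrArg Complex.re h
    simp at this
  rw [mul_div_mul_left _ _ h4]

theorem norm_one_sub_mul_I (x : ℝ) : ‖1 - (x : ℂ) * Complex.I‖ = √(1 + x ^ 2) := by
  rw [Complex.norm_def, Complex.normSq_apply]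
  congr 1
  simp
  ring

theorem norm_circ_cay_sub (x y : ℝ) : ‖circ (cay x) - circ (cay y)‖ = 2 * chord x y := by
  have hx := one_sub_mul_I_ne_zero x
  have hy := one_sub_mul_I_ne_zero y
  have h : circ (cay x) - circ (cay y) = 2 * Complex.I * ((x - y : ℝ) : ℂ) /
      ((1 - (x : ℂ) * Complex.I) * (1 - (y : ℂ) * Complex.I)) := by
    rw [circ_cay, circ_cay, div_sub_div _ _ hx hy]
    congr 1
    push_cast
    ring
  rw [h, norm_div, norm_mul, norm_mul, norm_mul, norm_one_sub_mul_I, norm_one_sub_mul_I,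
    Complex.norm_I, Complex.norm_real, Real.norm_eq_abs, chord]
  simp
  ring

/-- Conformal invariance: the squared distance on the circle is `4 (x - y)² / ((1 + x²)(1 + y²))`,
and the Jacobians cancel the factors exactly. On the diagonal both sides are infinite. -/
theorem circleKernel_cay (x y : ℝ) :
    ENNReal.ofReal (2 / (1 + x ^ 2)) * (ENNReal.ofReal (2 / (1 + y ^ 2)) *
      (‖circ (cay x) - circ (cay y)‖ₑ ^ 2)⁻¹) = (‖x - y‖ₑ ^ 2)⁻¹ := by
  by_cases hxy : x = y
  · subst hxy
    have : ENNReal.ofReal (2 / (1 + x ^ 2)) ≠ 0 := by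
      rw [ne_eq, ENNReal.ofReal_eq_zero, not_le]
      positivity
    simp [ENNReal.mul_top this]
  · have h1 : 0 < |x - y| := abs_pos.2 (sub_ne_zero.2 hxy)
    have hcx : √(1 + x ^ 2) ^ 2 = 1 + x ^ 2 := sq_sqrt (by positivity)
    have hcy : √(1 + y ^ 2) ^ 2 = 1 + y ^ 2 := sq_sqrt (by positivity)
    have h2 : 0 < chord x y := by
      unfold chord
      positivity
    rw [← ofReal_norm, ← ofReal_norm, norm_circ_cay_sub, Real.norm_eq_abs,
      ← ENNReal.ofReal_pow (by positivity), ← ENNReal.ofReal_pow (by positivity),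
      ← ENNReal.ofReal_inv_of_pos (by positivity), ← ENNReal.ofReal_inv_of_pos (by positivity),
      ← ENNReal.ofReal_mul (by positivity), ← ENNReal.ofReal_mul (by positivity)]
    congr 1
    rw [chord, mul_pow, div_pow, mul_pow, hcx, hcy]
    field_simp

theorem lintegral_circleMeasure_eq {F : Torus × Torus → ℝ≥0∞} (hF : Measurable F) :
    ∫⁻ z, F z ∂circleMeasure = ∫⁻ x : ℝ, ∫⁻ y : ℝ, F (cay x, cay y) / ‖x - y‖ₑ ^ 2 := by
  have hm : Measurable fun z : Torus × Torus => (‖circ z.1 - circ z.2‖ₑ ^ 2)⁻¹ * F z :=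
    measurable_circleKernel.mul hF
  rw [lintegral_circleMeasure hF, lintegral_prod _ hm.aemeasurable, lintegral_torus]
  refine lintegral_congr fun x => ?_
  rw [lintegral_torus, ← lintegral_const_mul']
  · refine lintegral_congr fun y => ?_
    rw [ENNReal.div_eq_inv_mul, ← circleKernel_cay x y]
    ring
  · exact ENNReal.ofReal_ne_top

/-- The energy of a function on the line. -/
def lineEnergy {V : Type*} [NormedAddCommGroup V] (u : ℝ → V) : ℝ≥0∞ :=
  ∫⁻ x : ℝ, ∫⁻ y : ℝ, ‖u x - u y‖ₑ ^ 2 / ‖x - y‖ₑ ^ 2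

theorem gagliardoHalf_eq (u : ℝ → R3) :
    gagliardoHalf u = (ENNReal.ofReal (1 / (2 * π)) * lineEnergy u) ^ (1 / 2 : ℝ) := rfl

theorem lineEnergy_comp_cay {V : Type*} [NormedAddCommGroup V] [MeasurableSpace V] [BorelSpace V]
    [SecondCountableTopology V] {f : Torus → V} (hf : Measurable f) :
    lineEnergy (fun x => f (cay x)) = circleEnergy f :=
  (lintegral_circleMeasure_eq (F := fun z => ‖f z.1 - f z.2‖ₑ ^ 2)
    (((hf.comp measurable_fst).sub (hf.comp measurable_snd)).enorm.pow_const 2)).symm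

/-- Here `f` is `u (tan (θ / 2))`. The last clause extends pointwise constraints, such as lying on
the sphere, to the point of the circle missed by `cay`. -/
theorem exists_comp_cay_eq {V : Type*} [MeasurableSpace V] {u : ℝ → V} (hu : Measurable u) :
    ∃ f : Torus → V, Measurable f ∧ (∀ x, f (cay x) = u x) ∧ ∀ a, ∃ x, f a = u x := by
  have htan : Measurable tan := by
    have : tan = fun x => sin x / cos x := funext tan_eq_sin_div_cos
    rw [this]
    exact measurable_sin.div measurable_cos
  refine ⟨fun a => u (tan ((AddCircle.measurableEquivIoc (2 * π) (-π) a : ℝ) / 2)), ?_, fun x => ?_,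
    fun a => ⟨_, rfl⟩⟩
  · exact hu.comp (htan.comp ((measurable_subtype_coe.comp
      (AddCircle.measurableEquivIoc (2 * π) (-π)).measurable).div_const 2))
  · have h2 := arctan_lt_pi_div_two x
    have h3 := neg_pi_div_two_lt_arctan x
    have h4 : 2 * arctan x ∈ Set.Ioc (-π) (-π + 2 * π) := ⟨by linarith, by linarith⟩
    have h5 : (AddCircle.measurableEquivIoc (2 * π) (-π) (cay x) : ℝ) = 2 * arctan x := by
      change (AddCircle.equivIoc (2 * π) (-π) (cay x) : ℝ) = 2 * arctan x
      have h6 : AddCircle.equivIoc (2 * π) (-π) (cay x) = ⟨2 * arctan x, h4⟩ := by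
        rw [← (AddCircle.equivIoc (2 * π) (-π)).apply_symm_apply ⟨2 * arctan x, h4⟩]
        rfl
      rw [h6]
    simp only [h5]
    rw [mul_div_cancel_left₀ _ two_ne_zero, tan_arctan]

theorem lineEnergy_add_le {u v : ℝ → R3} (hu : Measurable u) :
    lineEnergy (fun x => u x + v x) ≤ 2 * (lineEnergy u + lineEnergy v) := by
  have hk : Measurable fun z : ℝ × ℝ => ‖u z.1 - u z.2‖ₑ ^ 2 / ‖z.1 - z.2‖ₑ ^ 2 :=
    (((hu.comp measurable_fst).sub (hu.comp measurable_snd)).enorm.pow_const 2).div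
      ((measurable_fst.sub measurable_snd).enorm.pow_const 2)
  have hk1 : Measurable fun x : ℝ => ∫⁻ y : ℝ, ‖u x - u y‖ₑ ^ 2 / ‖x - y‖ₑ ^ 2 :=
    hk.lintegral_prod_right'
  have hk2 : ∀ x : ℝ, Measurable fun y : ℝ => ‖u x - u y‖ₑ ^ 2 / ‖x - y‖ₑ ^ 2 := fun x =>
    ((measurable_const.sub hu).enorm.pow_const 2).div
      ((measurable_const.sub measurable_id).enorm.pow_const 2)
  have hpt : ∀ x y : ℝ, ‖(u x + v x) - (u y + v y)‖ₑ ^ 2 / ‖x - y‖ₑ ^ 2 ≤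
      2 * (‖u x - u y‖ₑ ^ 2 / ‖x - y‖ₑ ^ 2 + ‖v x - v y‖ₑ ^ 2 / ‖x - y‖ₑ ^ 2) := by
    intro x y
    rw [← ENNReal.add_div, ← mul_div_assoc]
    refine ENNReal.div_le_div_right ?_ _
    have h := enorm_sub_sq_le (u x - u y) (-(v x - v y))
    rw [enorm_neg, sub_neg_eq_add] at h
    rwa [add_sub_add_comm]
  calc lineEnergy (fun x => u x + v x)
      ≤ ∫⁻ x : ℝ, ∫⁻ y : ℝ,
          2 * (‖u x - u y‖ₑ ^ 2 / ‖x - y‖ₑ ^ 2 + ‖v x - v y‖ₑ ^ 2 / ‖x - y‖ₑ ^ 2) :=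
        lintegral_mono fun x => lintegral_mono fun y => hpt x y
    _ = ∫⁻ x : ℝ, 2 * ((∫⁻ y : ℝ, ‖u x - u y‖ₑ ^ 2 / ‖x - y‖ₑ ^ 2) +
          ∫⁻ y : ℝ, ‖v x - v y‖ₑ ^ 2 / ‖x - y‖ₑ ^ 2) := by
        refine lintegral_congr fun x => ?_
        rw [lintegral_const_mul' _ _ (by simp), lintegral_add_left (hk2 x)]
    _ = 2 * (lineEnergy u + lineEnergy v) := by
        rw [lintegral_const_mul' _ _ (by simp), lintegral_add_left hk1, lineEnergy, lineEnergy]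

end CayleyTransform

/-! ### Energy of rational maps and of small perturbations. -/

noncomputable section RationalEnergy

open Complex Polynomial

/-- The chordal distance formula `|stereo w - stereo w'|² = 4 |w - w'|² / ((1 + |w|²)(1 + |w'|²))`.
-/
theorem norm_stereo_sub_le (w w' : ℂ) : ‖stereo w - stereo w'‖ ≤ 2 * ‖w - w'‖ := by
  have h1 := one_add_normSq_pos w
  have h2 := one_add_normSq_pos w'
  have e1 : normSq w = w.re ^ 2 + w.im ^ 2 := by rw [normSq_apply]; ring
  have e2 : normSq w' = w'.re ^ 2 + w'.im ^ 2 := by rw [normSq_apply]; ring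
  have h3 : ‖stereo w - stereo w'‖ ^ 2 =
      4 * ‖w - w'‖ ^ 2 / ((1 + normSq w) * (1 + normSq w')) := by
    rw [EuclideanSpace.norm_sq_eq, Fin.sum_univ_three, Complex.sq_norm, normSq_apply]
    simp only [stereo, PiLp.sub_apply, Matrix.cons_val, Real.norm_eq_abs, sq_abs,
      sub_re, sub_im]
    rw [e1] at h1 ⊢
    rw [e2] at h2 ⊢
    field_simp
    ring
  have h4 : ‖stereo w - stereo w'‖ ^ 2 ≤ (2 * ‖w - w'‖) ^ 2 := by
    rw [h3, mul_pow, show (2 : ℝ) ^ 2 = 4 by norm_num]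
    refine div_le_self (by positivity) ?_
    nlinarith [normSq_nonneg w, normSq_nonneg w', mul_nonneg (normSq_nonneg w) (normSq_nonneg w')]
  exact le_of_sq_le_sq h4 (by positivity)

theorem circleEnergy_circ_lt_top : circleEnergy circ < ∞ := by
  have hm : Measurable fun z : Torus × Torus => ‖circ z.1 - circ z.2‖ₑ ^ 2 :=
    ((continuous_circ.measurable.comp measurable_fst).sub
      (continuous_circ.measurable.comp measurable_snd)).enorm.pow_const 2
  rw [circleEnergy, lintegral_circleMeasure hm]
  calc ∫⁻ z, (‖circ z.1 - circ z.2‖ₑ ^ 2)⁻¹ * ‖circ z.1 - circ z.2‖ₑ ^ 2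
        ∂((volume : Measure Torus).prod volume)
      ≤ ∫⁻ _, 1 ∂((volume : Measure Torus).prod volume) :=
        lintegral_mono fun z => ENNReal.inv_mul_le_one (‖circ z.1 - circ z.2‖ₑ ^ 2)
    _ < ∞ := by
        rw [lintegral_one]
        exact measure_lt_top _ _

/-- `chord x y` is half the distance of `circ (cay x)` and `circ (cay y)`, and `circ` has finite
energy because its integrand is at most one. -/
theorem lineEnergy_lt_top_of_le_chord {V : Type*} [NormedAddCommGroup V] {u : ℝ → V} {K : ℝ}
    (hu : ∀ x y, ‖u x - u y‖ ≤ K * chord x y) : lineEnergy u < ∞ := by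
  have h1 : lineEnergy u ≤ ENNReal.ofReal (K / 2) ^ 2 * lineEnergy fun x => circ (cay x) := by
    unfold lineEnergy
    rw [← lintegral_const_mul' _ _ (by finiteness)]
    refine lintegral_mono fun x => ?_
    rw [← lintegral_const_mul' _ _ (by finiteness)]
    refine lintegral_mono fun y => ?_
    rw [← mul_div_assoc, ← mul_pow]
    gcongr
    rw [← ofReal_norm, ← ofReal_norm, ← ENNReal.ofReal_mul' (norm_nonneg _), norm_circ_cay_sub]
    refine ENNReal.ofReal_le_ofReal ((hu x y).trans (le_of_eq ?_))
    ring
  refine h1.trans_lt (ENNReal.mul_lt_top (by finiteness) ?_)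
  rw [lineEnergy_comp_cay continuous_circ.measurable]
  exact circleEnergy_circ_lt_top

theorem continuous_of_mem_ratMaps {u : ℝ → R3} (hu : u ∈ ratMaps) : Continuous u := by
  refine (PiLp.continuous_toLp 2 (fun _ : Fin 3 => ℝ)).comp
    (continuous_pi (f := fun x k => u x k) fun k => ?_)
  obtain ⟨p, q, h⟩ := hu.2 k
  have : (fun x => u x k) = fun x => p.eval x / q.eval x := funext fun x => (h x).2
  rw [this]
  exact p.continuous.div q.continuous fun x => (h x).1

/-- Boundedness forces `deg p ≤ deg q`, so the quotient has no pole at infinity; over `ℂ` the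
denominator splits into non-real factors. -/
theorem exists_chord_bound_of_bounded {p q : ℝ[X]} (hq : ∀ x, q.eval x ≠ 0) {B : ℝ}
    (hB : ∀ x, |p.eval x / q.eval x| ≤ B) :
    ∃ K, ∀ x y, |p.eval x / q.eval x - p.eval y / q.eval y| ≤ K * chord x y := by
  have hq0 : q ≠ 0 := by
    rintro rfl
    exact hq 0 (by simp)
  have hdeg : p.natDegree ≤ q.natDegree := by
    by_contra hlt
    have h1 := abs_div_tendsto_atTop_atTop_of_degree_gt p q
      (degree_lt_degree (not_le.1 hlt)) hq0
    obtain ⟨x, hx⟩ := (h1.eventually_gt_atTop B).exists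
    exact absurd hx (not_lt.2 (hB x))
  set P := p.map ofRealHom with hP
  set Q := q.map ofRealHom with hQ
  have hQ0 : Q ≠ 0 := (Polynomial.map_ne_zero_iff ofRealHom.injective).2 hq0
  have hev : ∀ (r : ℝ[X]) (x : ℝ), (r.map ofRealHom).eval (x : ℂ) = ((r.eval x : ℝ) : ℂ) := by
    intro r x
    exact eval_map_apply ofRealHom x
  have hsplit : Q.Splits := IsAlgClosed.splits Q
  have hne : ∀ a ∈ Q.roots, a.im ≠ 0 := by
    intro a ha him
    have h1 : a = (a.re : ℂ) := Complex.ext (by simp) (by simpa using him)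
    have h2 := (mem_roots hQ0).1 ha
    rw [IsRoot, h1, hQ, hev, ofReal_eq_zero] at h2
    exact hq _ h2
  have hcard : P.natDegree ≤ Multiset.card Q.roots := by
    rw [← hsplit.natDegree_eq_card_roots, hP, hQ, natDegree_map, natDegree_map]
    exact hdeg
  obtain ⟨K, hK⟩ := ChordBound.exists_ratio hne hcard
  have hK' := hK.const_mul Q.leadingCoeff⁻¹
  refine ⟨‖Q.leadingCoeff⁻¹‖ * K, fun x y => ?_⟩
  have hx : ∀ x : ℝ, Q.leadingCoeff⁻¹ * (P.eval (x : ℂ) / (rootPoly Q.roots).eval (x : ℂ)) =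
      ((p.eval x / q.eval x : ℝ) : ℂ) := by
    intro x
    have h1 : Q.eval (x : ℂ) = Q.leadingCoeff * (rootPoly Q.roots).eval (x : ℂ) := by
      conv_lhs => rw [hsplit.eq_prod_roots]
      rw [eval_mul, eval_C]
      rfl
    rw [ofReal_div, ← hev p, ← hev q, ← hP, ← hQ, h1, inv_mul_eq_div, div_div, mul_comm]
  have := (hK'.congr hx).2 x y
  rwa [← ofReal_sub, norm_real, Real.norm_eq_abs] at this

theorem ratMaps_subset_energySpace : ratMaps ⊆ energySpace := by
  intro u hu
  refine ⟨(continuous_of_mem_ratMaps hu).locallyIntegrable, Eventually.of_forall hu.1, ?_⟩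
  have h1 : ∀ k, ∃ K, ∀ x y, |u x k - u y k| ≤ K * chord x y := by
    intro k
    obtain ⟨p, q, h⟩ := hu.2 k
    have hB : ∀ x, |p.eval x / q.eval x| ≤ 1 := by
      intro x
      rw [← (h x).2, ← Real.norm_eq_abs]
      refine (PiLp.norm_apply_le (u x) k).trans ?_
      exact (mem_sphere_zero_iff_norm.1 (hu.1 x)).le
    obtain ⟨K, hK⟩ := exists_chord_bound_of_bounded (fun x => (h x).1) hB
    refine ⟨K, fun x y => ?_⟩
    rw [(h x).2, (h y).2]
    exact hK x y
  choose K hK using h1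
  have h2 : lineEnergy u < ∞ := by
    refine lineEnergy_lt_top_of_le_chord (K := ∑ k, K k) fun x y => ?_
    have h3 : ‖u x - u y‖ ≤ ∑ k, |u x k - u y k| := by
      have h4 : ∀ v : R3, ‖v‖ ≤ ∑ k, |v k| := by
        intro v
        rw [EuclideanSpace.norm_eq]
        refine Real.sqrt_le_iff.2 ⟨Finset.sum_nonneg fun _ _ => abs_nonneg _, ?_⟩
        exact Finset.sum_sq_le_sq_sum_of_nonneg fun _ _ => abs_nonneg _
      exact h4 (u x - u y)
    refine h3.trans ?_
    rw [Finset.sum_mul]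
    exact Finset.sum_le_sum fun k _ => hK k x y
  rw [gagliardoHalf_eq]
  exact ENNReal.rpow_lt_top_of_nonneg (by norm_num)
    (ENNReal.mul_ne_top ENNReal.ofReal_ne_top h2.ne)

theorem lineEnergy_eq_lintegral_prod {V : Type*} [NormedAddCommGroup V] [MeasurableSpace V]
    [BorelSpace V] [SecondCountableTopology V] {u : ℝ → V} (hu : Measurable u) :
    lineEnergy u = ∫⁻ z : ℝ × ℝ, ‖u z.1 - u z.2‖ₑ ^ 2 / ‖z.1 - z.2‖ₑ ^ 2 := by
  have hk : Measurable fun z : ℝ × ℝ => ‖u z.1 - u z.2‖ₑ ^ 2 / ‖z.1 - z.2‖ₑ ^ 2 :=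
    (((hu.comp measurable_fst).sub (hu.comp measurable_snd)).enorm.pow_const 2).div
      ((measurable_fst.sub measurable_snd).enorm.pow_const 2)
  rw [Measure.volume_eq_prod, lintegral_prod _ hk.aemeasurable]
  rfl

/-- Dominated convergence, with the integrand of a multiple of `circ ∘ cay` as majorant. -/
theorem tendsto_lineEnergy_of_le_chord {V : Type*} [NormedAddCommGroup V] [MeasurableSpace V]
    [BorelSpace V] [SecondCountableTopology V] {u : ℕ → ℝ → V} (hu : ∀ n, Measurable (u n)) {K : ℝ}
    (hK : ∀ n x y, ‖u n x - u n y‖ ≤ K * chord x y)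
    (hlim : ∀ x, Tendsto (fun n => u n x) atTop (𝓝 0)) :
    Tendsto (fun n => lineEnergy (u n)) atTop (𝓝 0) := by
  have hcc : Measurable fun x => circ (cay x) := continuous_circ.measurable.comp measurable_cay
  have hw : Measurable fun x => ((K / 2 : ℝ) : ℂ) * circ (cay x) := hcc.const_mul _
  have hwK : ∀ x y, ‖((K / 2 : ℝ) : ℂ) * circ (cay x) - ((K / 2 : ℝ) : ℂ) * circ (cay y)‖ =
      |K| * chord x y := by
    intro x y
    rw [← mul_sub, norm_mul, norm_circ_cay_sub, norm_real, Real.norm_eq_abs, abs_div, abs_two]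
    ring
  have hfin : lineEnergy (fun x => ((K / 2 : ℝ) : ℂ) * circ (cay x)) < ∞ :=
    lineEnergy_lt_top_of_le_chord fun x y => (hwK x y).le
  rw [lineEnergy_eq_lintegral_prod hw] at hfin
  simp only [fun n => lineEnergy_eq_lintegral_prod (hu n)]
  have hmeas : ∀ n, Measurable fun z : ℝ × ℝ => ‖u n z.1 - u n z.2‖ₑ ^ 2 / ‖z.1 - z.2‖ₑ ^ 2 :=
    fun n => ((((hu n).comp measurable_fst).sub ((hu n).comp measurable_snd)).enorm.pow_const 2).div
      ((measurable_fst.sub measurable_snd).enorm.pow_const 2)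
  have h := tendsto_lintegral_of_dominated_convergence (μ := (volume : Measure (ℝ × ℝ)))
    (f := fun _ => 0) _ hmeas (fun n => Eventually.of_forall fun z => ?_) hfin.ne
    (Eventually.of_forall fun z => ?_)
  · simpa using h
  · refine ENNReal.div_le_div_right (pow_le_pow_left' ?_ 2) _
    rw [← ofReal_norm, ← ofReal_norm, hwK]
    exact ENNReal.ofReal_le_ofReal ((hK n _ _).trans
      (mul_le_mul_of_nonneg_right (le_abs_self K) (chord_nonneg _ _)))
  · by_cases hz : z.1 = z.2
    · simp [hz]
    · have h1 : Tendsto (fun n => u n z.1 - u n z.2) atTop (𝓝 0) := by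
        simpa using (hlim z.1).sub (hlim z.2)
      have h2 := (((ENNReal.continuous_pow 2).comp continuous_enorm).tendsto (0 : V)).comp h1
      have h3 : ‖z.1 - z.2‖ₑ ^ 2 ≠ 0 := by
        simpa [sub_eq_zero] using hz
      have h4 := ENNReal.Tendsto.div_const h2 (Or.inr h3)
      simpa [Function.comp_def] using h4

/-- Perturbations of size `1 / (n + 1)` converge pointwise and obey one chordal Lipschitz bound, so
domination suffices; no estimate for differences of `stereo` in the energy is needed. -/
theorem exists_mem_ratMapsSimple_near {s : Multiset ℂ} (hs : ∀ a ∈ s, a.im ≠ 0) {p : ℂ[X]}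
    (hp : p.natDegree ≤ Multiset.card s) {δ : ℝ≥0∞} (hδ : 0 < δ) :
    ∃ u ∈ ratMapsSimple, Measurable u ∧
      lineEnergy (fun x => u x - ratU p (rootPoly s) x) < δ := by
  have hq := eval_rootPoly_ne_zero hs
  have hmeas : ∀ p : ℂ[X], Measurable (ratU p (rootPoly s)) := fun p =>
    (continuous_of_mem_ratMaps (ratU_mem_ratMaps hq)).measurable
  choose P hPdeg hPcop hPs hPb using fun n : ℕ =>
    exists_perturbation_simple hs hp (ε := 1 / ((n : ℝ) + 1)) (by positivity)
  obtain ⟨K, hK⟩ := ChordBound.exists_ratio hs hp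
  have hdiff : ∀ n (x : ℝ), (P n).eval (x : ℂ) / (rootPoly s).eval (x : ℂ) =
      p.eval (x : ℂ) / (rootPoly s).eval (x : ℂ) +
        (P n - p).eval (x : ℂ) / (rootPoly s).eval (x : ℂ) := by
    intro n x
    rw [← add_div, eval_sub]
    ring
  have hlim := tendsto_lineEnergy_of_le_chord
    -- The perturbed coordinates have constant at most `K + 1`, the limit has `K`, and `stereo`
    -- doubles each.
    (u := fun n x => ratU (P n) (rootPoly s) x - ratU p (rootPoly s) x) (K := 2 * (K + 1) + 2 * K)
    (fun n => (hmeas _).sub (hmeas _)) (fun n x y => ?_) (fun x => ?_)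
  · obtain ⟨n, hn⟩ := (hlim.eventually_lt_const hδ).exists
    exact ⟨_, ratU_mem_ratMapsSimple hq (by rw [natDegree_rootPoly]; exact hPdeg n) (hPs n),
      hmeas _, hn⟩
  · have h1 : ChordBound (K + 1) fun x => (P n).eval (x : ℂ) / (rootPoly s).eval (x : ℂ) := by
      refine ((hK.add (hPb n)).mono ?_).congr fun x => (hdiff n x).symm
      have : 1 / ((n : ℝ) + 1) ≤ 1 := by
        rw [div_le_one (by positivity)]
        linarith [n.cast_nonneg (α := ℝ)]
      linarith
    have h2 := (norm_stereo_sub_le _ _).trans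
      (mul_le_mul_of_nonneg_left (h1.2 x y) zero_le_two)
    have h3 := (norm_stereo_sub_le _ _).trans
      (mul_le_mul_of_nonneg_left (hK.2 x y) zero_le_two)
    rw [sub_sub_sub_comm]
    refine (norm_sub_le _ _).trans ((add_le_add h2 h3).trans (le_of_eq ?_))
    ring
  · refine squeeze_zero_norm (a := fun n : ℕ => 2 * (1 / ((n : ℝ) + 1))) (fun n => ?_) ?_
    · refine (norm_stereo_sub_le _ _).trans (mul_le_mul_of_nonneg_left ?_ zero_le_two)
      rw [hdiff, add_sub_cancel_left]
      exact (hPb n).1 x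
    · simpa using (tendsto_one_div_add_atTop_nhds_zero_nat (𝕜 := ℝ)).const_mul 2

end RationalEnergy

/-! ### Averages with continuous densities. -/

noncomputable section Mollifiers

/-- The probability measure with density proportional to `ρ`. -/
def densityMeasure (ρ : Torus → ℝ) : Measure Torus :=
  volume.withDensity fun s => ENNReal.ofReal (ρ s / ∫ t, ρ t)

variable {ρ : Torus → ℝ}

theorem integrable_of_continuous_torus {E : Type*} [NormedAddCommGroup E] {g : Torus → E}
    (hg : Continuous g) : Integrable g volume :=
  hg.integrable_of_hasCompactSupport (HasCompactSupport.of_compactSpace g)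

theorem isProbabilityMeasure_densityMeasure (hρ : Continuous ρ) (h0 : ∀ s, 0 ≤ ρ s)
    (hpos : 0 < ∫ t, ρ t) : IsProbabilityMeasure (densityMeasure ρ) := by
  refine ⟨?_⟩
  rw [densityMeasure, withDensity_apply _ MeasurableSet.univ, Measure.restrict_univ,
    ← ofReal_integral_eq_lintegral_ofReal ((integrable_of_continuous_torus hρ).div_const _)
    (Eventually.of_forall fun s => div_nonneg (h0 s) hpos.le), integral_div,
    div_self hpos.ne', ENNReal.ofReal_one]

theorem lintegral_densityMeasure (hρ : Continuous ρ) {g : Torus → ℝ≥0∞} (hg : Measurable g) :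
    ∫⁻ s, g s ∂densityMeasure ρ = ∫⁻ s, ENNReal.ofReal (ρ s / ∫ t, ρ t) * g s :=
  lintegral_withDensity_eq_lintegral_mul _ (hρ.div_const _).measurable.ennreal_ofReal hg

theorem mollify_densityMeasure (hρ : Continuous ρ) (h0 : ∀ s, 0 ≤ ρ s) (hpos : 0 < ∫ t, ρ t)
    {V : Type*} [NormedAddCommGroup V] [NormedSpace ℝ V] (f : Torus → V) (a : Torus) :
    mollify (densityMeasure ρ) f a = (∫ t, ρ t)⁻¹ • ∫ s, ρ s • f (a + s) := by
  rw [mollify, densityMeasure, integral_withDensity_eq_integral_toReal_smul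
    (hρ.div_const _).measurable.ennreal_ofReal (Eventually.of_forall fun _ => ENNReal.ofReal_lt_top),
    ← integral_smul]
  refine integral_congr_ae (Eventually.of_forall fun s => ?_)
  simp only
  rw [ENNReal.toReal_ofReal (div_nonneg (h0 s) hpos.le), smul_smul, div_eq_inv_mul]

theorem measurable_sub_fst_snd {V : Type*} [NormedAddCommGroup V] [MeasurableSpace V]
    [BorelSpace V] [SecondCountableTopology V] {f : Torus → V} (hf : Measurable f) :
    Measurable fun z : Torus × Torus => f z.1 - f z.2 :=
  (hf.comp measurable_fst).sub (hf.comp measurable_snd)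

theorem enorm_le_ofReal_mul_enorm {V V' : Type*} [NormedAddCommGroup V] [NormedAddCommGroup V']
    {x : V} {y : V'} {L : ℝ} (h : ‖x‖ ≤ L * ‖y‖) : ‖x‖ₑ ≤ ENNReal.ofReal L * ‖y‖ₑ := by
  rw [← ofReal_norm, ← ofReal_norm, ← ENNReal.ofReal_mul' (norm_nonneg _)]
  exact ENNReal.ofReal_le_ofReal h

/-- Averages never exceed the energy of `f`, so pointwise convergence becomes convergence in energy.
Allowing `gn` and `g` covers images of the averages under Lipschitz maps such as normalization or
`stereo`. -/
theorem tendsto_circleEnergy_sub {V V' : Type*} [NormedAddCommGroup V] [MeasurableSpace V]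
    [BorelSpace V] [SecondCountableTopology V] [NormedSpace ℝ V]
    [NormedAddCommGroup V'] [MeasurableSpace V'] [BorelSpace V'] [SecondCountableTopology V']
    {μ : ℕ → Measure Torus} (hμ : ∀ n, IsProbabilityMeasure (μ n)) {f : Torus → V}
    (hf : Measurable f) {B : ℝ} (hB : ∀ a, ‖f a‖ ≤ B) (hE : circleEnergy f ≠ ∞)
    (hlim : ∀ᵐ a, Tendsto (fun n => mollify (μ n) f a) atTop (𝓝 (f a)))
    {g : Torus → V'} {gn : ℕ → Torus → V'} (hg : Measurable g) (hgn : ∀ n, Measurable (gn n))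
    (hglim : ∀ᵐ a, Tendsto (fun n => gn n a) atTop (𝓝 (g a))) {L : ℝ}
    (hLn : ∀ n a b, ‖gn n a - gn n b‖ ≤ L * ‖mollify (μ n) f a - mollify (μ n) f b‖)
    (hL : ∀ a b, ‖g a - g b‖ ≤ L * ‖f a - f b‖) :
    Tendsto (fun n => circleEnergy fun a => gn n a - g a) atTop (𝓝 0) := by
  have h := tendsto_lintegral_enorm_sub_sq (ν := circleMeasure) (L := ENNReal.ofReal L)
    (H := fun z => f z.1 - f z.2) (Hn := fun n z => mollify (μ n) f z.1 - mollify (μ n) f z.2)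
    (G := fun z => g z.1 - g z.2) (Gn := fun n z => gn n z.1 - gn n z.2)
    ENNReal.ofReal_ne_top (measurable_sub_fst_snd hf) (fun n => measurable_sub_fst_snd (measurable_mollify (μ n) hf)) (measurable_sub_fst_snd hg)
    (fun n => measurable_sub_fst_snd (hgn n)) hE (fun n => circleEnergy_mollify_le (μ n) hf hB)
    (by
      filter_upwards [ae_circleMeasure hlim] with z hz
      exact hz.1.sub hz.2)
    (by
      filter_upwards [ae_circleMeasure hglim] with z hz
      exact hz.1.sub hz.2)
    (fun n z => enorm_le_ofReal_mul_enorm (hLn n _ _)) (fun z => enorm_le_ofReal_mul_enorm (hL _ _))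
  refine h.congr fun n => lintegral_congr fun z => ?_
  rw [sub_sub_sub_comm]

end Mollifiers

/-! ### Approximation by trigonometric polynomials. -/

noncomputable section TrigonometricKernel

open Complex Polynomial

/-- The trigonometric polynomial `|1 + e^{is}|²`, which peaks at `s = 0`. -/
def peak (s : Torus) : ℝ := ‖1 + circ s‖ ^ 2

theorem continuous_peak : Continuous peak := (continuous_const.add continuous_circ).norm.pow 2

theorem continuous_peak_pow (n : ℕ) : Continuous fun s => peak s ^ n := continuous_peak.pow n

theorem peak_pow_nonneg (n : ℕ) (s : Torus) : 0 ≤ peak s ^ n := by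
  unfold peak
  positivity

/-- The probability measure with density proportional to `peak ^ n`. -/
def peakMeasure (n : ℕ) : Measure Torus := densityMeasure fun s => peak s ^ n

theorem circ_zero : circ 0 = 1 := by simp [circ]

theorem peak_lt {s : Torus} (hs : s ≠ 0) : peak s < peak 0 := by
  have h1 : circ s ≠ 1 := fun h => hs (circ_injective (h.trans circ_zero.symm))
  have h2 : ‖(1 : ℂ) + circ s‖ < ‖(1 : ℂ)‖ + ‖circ s‖ := by
    refine norm_add_lt_of_not_sameRay fun h => h1 ?_
    have := (sameRay_iff_of_norm_eq (by rw [norm_circ, norm_one])).1 h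
    exact this.symm
  rw [norm_one, norm_circ] at h2
  have h3 : peak 0 = 4 := by
    rw [peak, circ_zero]
    norm_num
  rw [h3, peak]
  nlinarith [norm_nonneg (1 + circ s)]

theorem peak_zero_pos : 0 < peak 0 := by
  rw [peak, circ_zero]
  norm_num

theorem integral_peak_pow_pos (n : ℕ) : 0 < ∫ t, peak t ^ n := by
  refine (continuous_peak_pow n).integral_pos_of_hasCompactSupport_nonneg_nonzero
    (HasCompactSupport.of_compactSpace _) (peak_pow_nonneg n) (x := 0) ?_
  exact pow_ne_zero n peak_zero_pos.ne'

/-- Powers of a function with a unique maximum concentrate at that maximum after normalization. -/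
theorem tendsto_mollify_peak {w : Torus → ℂ} (hw : Continuous w) (a : Torus) :
    Tendsto (fun n : ℕ => mollify (peakMeasure n) w a) atTop (𝓝 (w a)) := by
  have h := tendsto_setIntegral_pow_smul_of_unique_maximum_of_isCompact_of_continuousOn
    (μ := (volume : Measure Torus)) (s := Set.univ) (x₀ := (0 : Torus)) (c := peak)
    (g := fun s => w (a + s)) isCompact_univ continuous_peak.continuousOn
    (fun y _ hy => peak_lt hy) (fun x _ => by unfold peak; positivity) peak_zero_pos (by simp)
    (hw.comp (continuous_const_add a)).continuousOn
  simp only [Measure.restrict_univ, add_zero] at h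
  refine h.congr fun n => ?_
  rw [peakMeasure, mollify_densityMeasure (continuous_peak_pow n) (peak_pow_nonneg n)
    (integral_peak_pow_pos n)]

/-- The poles `±i`, each with multiplicity `n`. -/
def poles (n : ℕ) : Multiset ℂ := Multiset.replicate n I + Multiset.replicate n (-I)

theorem im_ne_zero_of_mem_poles {n : ℕ} {a : ℂ} (ha : a ∈ poles n) : a.im ≠ 0 := by
  rcases Multiset.mem_add.1 ha with h | h
  · rw [Multiset.eq_of_mem_replicate h]
    simp
  · rw [Multiset.eq_of_mem_replicate h]
    simp

theorem card_poles (n : ℕ) : Multiset.card (poles n) = 2 * n := by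
  simp [poles]
  ring

theorem eval_rootPoly_poles (n : ℕ) (x : ℝ) :
    (rootPoly (poles n)).eval (x : ℂ) = ((1 + x ^ 2 : ℝ) : ℂ) ^ n := by
  have h : rootPoly (poles n) = (X - C I) ^ n * (X - C (-I)) ^ n := by
    rw [← rootPoly_replicate, ← rootPoly_replicate, poles, rootPoly, rootPoly, rootPoly,
      Multiset.map_add, Multiset.prod_add]
  rw [h, ← mul_pow, eval_pow]
  congr 1
  simp only [eval_mul, eval_sub, eval_X, eval_C]
  push_cast
  linear_combination -I_sq

/-- The numerator of `|1 + e^{i(b - a)}|²` as a polynomial in `x`, where `a = 2 arctan x`. -/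
def peakPoly (b : Torus) : ℂ[X] :=
  C ((2 * (1 + (circ b).re) : ℝ) : ℂ) + C ((4 * (circ b).im : ℝ) : ℂ) * X +
    C ((2 * (1 - (circ b).re) : ℝ) : ℂ) * X ^ 2

theorem eval_peakPoly (b : Torus) (x : ℝ) :
    (peakPoly b).eval (x : ℂ) = ((peak (b - cay x) * (1 + x ^ 2) : ℝ) : ℂ) := by
  have h1 : (circ b).re ^ 2 + (circ b).im ^ 2 = 1 := by
    have := norm_circ b
    rw [Complex.norm_eq_sqrt_sq_add_sq, Real.sqrt_eq_one] at this
    exact this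
  have h2 : peak (b - cay x) * (1 + x ^ 2) =
      2 * (1 + (circ b).re) + 4 * (circ b).im * x + 2 * (1 - (circ b).re) * x ^ 2 := by
    have h3 : ‖1 + circ (b - cay x)‖ = ‖circ (cay x) + circ b‖ := by
      have h4 : circ (cay x) + circ b = (1 + circ (b - cay x)) * circ (cay x) := by
        rw [add_mul, one_mul, ← circ_add, sub_add_cancel]
      rw [h4, norm_mul, norm_circ, mul_one]
    have h5 : circ (cay x) + circ b =
        ((1 + (x : ℂ) * I) + (1 - (x : ℂ) * I) * circ b) / (1 - (x : ℂ) * I) := by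
      rw [circ_cay, add_div _ ((1 - (x : ℂ) * I) * circ b),
        mul_div_cancel_left₀ _ (one_sub_mul_I_ne_zero x)]
    have h6 : (0 : ℝ) < 1 + x ^ 2 := by positivity
    rw [peak, h3, h5, norm_div, norm_one_sub_mul_I, div_pow, Real.sq_sqrt h6.le,
      div_mul_cancel₀ _ h6.ne', Complex.sq_norm, normSq_apply]
    simp only [add_re, add_im, mul_re, mul_im, sub_re, sub_im, one_re, one_im, I_re, I_im,
      ofReal_re, ofReal_im]
    linear_combination (1 + x ^ 2) * h1
  rw [h2]
  simp only [peakPoly, eval_add, eval_mul, eval_C, eval_X, eval_pow]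
  push_cast
  ring

theorem natDegree_peakPoly_le (b : Torus) : (peakPoly b).natDegree ≤ 2 := by
  unfold peakPoly
  compute_degree

theorem continuous_coeff_peakPoly_pow (n j : ℕ) : Continuous fun b => (peakPoly b ^ n).coeff j := by
  have h1 : ∀ j, Continuous fun b => (peakPoly b).coeff j := by
    intro j
    have hre : Continuous fun b => (circ b).re := continuous_re.comp continuous_circ
    have him : Continuous fun b => (circ b).im := continuous_im.comp continuous_circ
    simp only [peakPoly, coeff_add, coeff_C_mul, coeff_C, coeff_X_pow, coeff_X]
    split_ifs <;> fun_prop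
  induction n generalizing j with
  | zero => simpa using continuous_const
  | succ n ih =>
    simp only [pow_succ, coeff_mul]
    exact continuous_finsetSum _ fun k _ => (ih _).mul (h1 _)

/-- Translation moves the dependence on `x` into the kernel `peak (b - cay x) ^ n`. Times `(1 +
x²)^n` this is a polynomial in `x` of degree at most `2n`, whose coefficients are integrated against
`w`. -/
theorem exists_mollify_peak_eq {w : Torus → ℂ} (hw : Continuous w) (n : ℕ) :
    ∃ p : ℂ[X], p.natDegree ≤ Multiset.card (poles n) ∧ ∀ x : ℝ,
      mollify (peakMeasure n) w (cay x) =
        p.eval (x : ℂ) / (rootPoly (poles n)).eval (x : ℂ) := by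
  set Z := ∫ t, peak t ^ n with hZ
  let m : ℕ → ℂ := fun j => ((Z⁻¹ : ℝ) : ℂ) * ∫ b, (peakPoly b ^ n).coeff j * w b
  refine ⟨∑ j ∈ Finset.range (2 * n + 1), C (m j) * X ^ j, ?_, fun x => ?_⟩
  · rw [card_poles]
    refine natDegree_sum_le_of_forall_le _ _ fun j hj => ?_
    exact (natDegree_C_mul_X_pow_le _ _).trans (by
      have := Finset.mem_range.1 hj
      omega)
  · have hx : ((1 + x ^ 2 : ℝ) : ℂ) ^ n ≠ 0 := by
      refine pow_ne_zero n (ofReal_ne_zero.2 ?_)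
      positivity
    have hev : ∀ b, ((peak (b - cay x) * (1 + x ^ 2) : ℝ) : ℂ) ^ n =
        ∑ j ∈ Finset.range (2 * n + 1), (peakPoly b ^ n).coeff j * (x : ℂ) ^ j := by
      intro b
      rw [← eval_peakPoly, ← eval_pow]
      refine eval_eq_sum_range' (Nat.lt_succ_of_le ?_) _
      refine natDegree_pow_le.trans ?_
      rw [mul_comm]
      exact Nat.mul_le_mul_right n (natDegree_peakPoly_le b)
    rw [peakMeasure, mollify_densityMeasure (continuous_peak_pow n) (peak_pow_nonneg n)
      (integral_peak_pow_pos n), eval_rootPoly_poles, eq_div_iff hx, eval_finsetSum, ← hZ]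
    have htr : ∫ s, peak s ^ n • w (cay x + s) = ∫ b, peak (b - cay x) ^ n • w b := by
      rw [← integral_add_left_eq_self (fun b => peak (b - cay x) ^ n • w b) (cay x)]
      simp only [add_sub_cancel_left]
    rw [htr, real_smul, mul_assoc, ← integral_mul_const]
    have h1 : ∀ b, peak (b - cay x) ^ n • w b * ((1 + x ^ 2 : ℝ) : ℂ) ^ n =
        ∑ j ∈ Finset.range (2 * n + 1), (peakPoly b ^ n).coeff j * w b * (x : ℂ) ^ j := by
      intro b
      have h2 : peak (b - cay x) ^ n • w b * ((1 + x ^ 2 : ℝ) : ℂ) ^ n =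
          ((peak (b - cay x) * (1 + x ^ 2) : ℝ) : ℂ) ^ n * w b := by
        rw [real_smul, ofReal_mul (peak _), mul_pow, ofReal_pow]
        ring
      rw [h2, hev, Finset.sum_mul]
      exact Finset.sum_congr rfl fun j _ => by ring
    simp only [h1]
    have hint : ∀ j ∈ Finset.range (2 * n + 1),
        Integrable (fun b => (peakPoly b ^ n).coeff j * w b * (x : ℂ) ^ j) volume := fun j _ =>
      integrable_of_continuous_torus
        (((continuous_coeff_peakPoly_pow n j).mul hw).mul continuous_const)
    rw [integral_finsetSum _ hint, Finset.mul_sum]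
    refine Finset.sum_congr rfl fun j _ => ?_
    rw [integral_mul_const, eval_mul, eval_C, eval_pow, eval_X]
    simp only [m]
    ring

theorem continuous_stereo : Continuous stereo :=
  (LipschitzWith.of_dist_le_mul (K := 2) fun a b => by
    rw [dist_eq_norm, dist_eq_norm]
    exact norm_stereo_sub_le a b).continuous

theorem exists_ratU_near {w : Torus → ℂ} (hw : Continuous w) (hE : circleEnergy w ≠ ∞)
    {δ : ℝ≥0∞} (hδ : 0 < δ) :
    ∃ (s : Multiset ℂ) (p : ℂ[X]), (∀ a ∈ s, a.im ≠ 0) ∧ p.natDegree ≤ Multiset.card s ∧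
      lineEnergy (fun x => ratU p (rootPoly s) x - stereo (w (cay x))) < δ := by
  obtain ⟨B, hB⟩ := isCompact_univ.exists_bound_of_continuousOn hw.continuousOn
  have hμ : ∀ n, IsProbabilityMeasure (peakMeasure n) := fun n =>
    isProbabilityMeasure_densityMeasure (continuous_peak_pow n) (peak_pow_nonneg n)
      (integral_peak_pow_pos n)
  have hm : ∀ n, Measurable (mollify (peakMeasure n) w) := fun n =>
    have := hμ n
    measurable_mollify _ hw.measurable
  have h := tendsto_circleEnergy_sub hμ hw.measurable (B := B) (fun a => hB a trivial) hE
    (Eventually.of_forall fun a => tendsto_mollify_peak hw a)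
    (g := fun a => stereo (w a))
    (gn := fun n a => stereo (mollify (peakMeasure n) w a)) (L := 2)
    (continuous_stereo.measurable.comp hw.measurable) (fun n => continuous_stereo.measurable.comp (hm n))
    (Eventually.of_forall fun a => (continuous_stereo.tendsto _).comp (tendsto_mollify_peak hw a))
    (fun n a b => norm_stereo_sub_le _ _) (fun a b => norm_stereo_sub_le _ _)
  obtain ⟨n, hn⟩ := (h.eventually_lt_const hδ).exists
  obtain ⟨p, hp, hpe⟩ := exists_mollify_peak_eq hw n
  refine ⟨poles n, p, fun a ha => im_ne_zero_of_mem_poles ha, hp, ?_⟩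
  rw [← lineEnergy_comp_cay (f := fun a => stereo (mollify (peakMeasure n) w a) - stereo (w a))
    ((continuous_stereo.measurable.comp (hm n)).sub (continuous_stereo.measurable.comp hw.measurable))] at hn
  simpa [ratU, hpe] using hn

end TrigonometricKernel

/-! ### Averages at small scale and mean oscillation. -/

noncomputable section TentKernel

open Real

/-- The tent function of width `ε`. -/
def tent (ε : ℝ) (s : Torus) : ℝ := max 0 (ε - ‖s‖)

theorem continuous_tent (ε : ℝ) : Continuous (tent ε) :=
  continuous_const.max (continuous_const.sub continuous_norm)

theorem tent_nonneg (ε : ℝ) (s : Torus) : 0 ≤ tent ε s := le_max_left _ _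

theorem tent_le {ε : ℝ} (hε : 0 ≤ ε) (s : Torus) : tent ε s ≤ ε :=
  max_le hε (by linarith [norm_nonneg s])

theorem tent_eq_zero {ε : ℝ} {s : Torus} (h : ε ≤ ‖s‖) : tent ε s = 0 :=
  max_eq_left (by linarith)

theorem abs_tent_sub_le (ε : ℝ) (s t : Torus) : |tent ε s - tent ε t| ≤ ‖s - t‖ := by
  refine (abs_max_sub_max_le_max _ _ _ _).trans ?_
  rw [sub_self, abs_zero, sub_sub_sub_cancel_left]
  refine max_le (norm_nonneg _) ?_
  rw [norm_sub_rev]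
  exact abs_norm_sub_norm_le t s

/-- On the ball of radius `ε / 2`, an arc of length `ε`, the tent is at least `ε / 2`. -/
theorem le_integral_tent {ε : ℝ} (h0 : 0 < ε) (h1 : ε ≤ 1) : ε ^ 2 / 2 ≤ ∫ s, tent ε s := by
  have hvol : (volume : Measure Torus).real (Metric.closedBall 0 (ε / 2)) = ε := by
    rw [Measure.real, AddCircle.volume_closedBall, ENNReal.toReal_ofReal
      (le_min two_pi_pos.le (by linarith))]
    rw [min_eq_right (by linarith [pi_gt_three])]
    ring
  have h2 : ∫ s in Metric.closedBall (0 : Torus) (ε / 2), ε / 2 ≤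
      ∫ s in Metric.closedBall (0 : Torus) (ε / 2), tent ε s := by
    refine setIntegral_mono_on (integrable_const _).integrableOn
      (integrable_of_continuous_torus (continuous_tent ε)).integrableOn
      Metric.isClosed_closedBall.measurableSet fun s hs => ?_
    refine le_max_of_le_right ?_
    have := mem_closedBall_zero_iff.1 hs
    linarith
  have h3 : ∫ s in Metric.closedBall (0 : Torus) (ε / 2), tent ε s ≤ ∫ s, tent ε s :=
    setIntegral_le_integral (integrable_of_continuous_torus (continuous_tent ε))
      (Eventually.of_forall fun s => tent_nonneg ε s)
  rw [setIntegral_const, hvol, smul_eq_mul] at h2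
  nlinarith

theorem integral_tent_pos {ε : ℝ} (h0 : 0 < ε) (h1 : ε ≤ 1) : 0 < ∫ s, tent ε s :=
  lt_of_lt_of_le (by positivity) (le_integral_tent h0 h1)

/-- The normalized tent function. -/
def tentDensity (ε : ℝ) (s : Torus) : ℝ := tent ε s / ∫ t, tent ε t

theorem tentDensity_nonneg {ε : ℝ} (h0 : 0 < ε) (h1 : ε ≤ 1) (s : Torus) : 0 ≤ tentDensity ε s :=
  div_nonneg (tent_nonneg ε s) (integral_tent_pos h0 h1).le

theorem tentDensity_le {ε : ℝ} (h0 : 0 < ε) (h1 : ε ≤ 1) (s : Torus) : tentDensity ε s ≤ 2 / ε := by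
  rw [tentDensity, div_le_div_iff₀ (integral_tent_pos h0 h1) h0]
  have h2 := le_integral_tent h0 h1
  have h3 := tent_le h0.le s
  nlinarith

theorem tentDensity_eq_zero {ε : ℝ} {s : Torus} (h : ε ≤ ‖s‖) : tentDensity ε s = 0 := by
  rw [tentDensity, tent_eq_zero h, zero_div]

/-- The probability measure with the normalized tent function as density. -/
def tentMeasure (ε : ℝ) : Measure Torus := densityMeasure (tent ε)

theorem isProbabilityMeasure_tentMeasure {ε : ℝ} (h0 : 0 < ε) (h1 : ε ≤ 1) :
    IsProbabilityMeasure (tentMeasure ε) :=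
  isProbabilityMeasure_densityMeasure (continuous_tent ε) (tent_nonneg ε) (integral_tent_pos h0 h1)

theorem lintegral_tentMeasure (ε : ℝ) {g : Torus → ℝ≥0∞} (hg : Measurable g) :
    ∫⁻ s, g s ∂tentMeasure ε = ∫⁻ s, ENNReal.ofReal (tentDensity ε s) * g s :=
  lintegral_densityMeasure (continuous_tent ε) hg

theorem ofReal_le_mul_inv_enorm_sq {A B : ℝ} (hB : 0 < B) {v : ℂ} (h : A * ‖v‖ ^ 2 ≤ B) :
    ENNReal.ofReal A ≤ ENNReal.ofReal B * (‖v‖ₑ ^ 2)⁻¹ := by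
  by_cases hv : v = 0
  · have : ENNReal.ofReal B ≠ 0 := by
      rw [ne_eq, ENNReal.ofReal_eq_zero, not_le]
      exact hB
    simp [hv, ENNReal.mul_top this]
  · have hv' : 0 < ‖v‖ := norm_pos_iff.2 hv
    rw [← ofReal_norm, ← ENNReal.ofReal_pow (norm_nonneg _),
      ← ENNReal.ofReal_inv_of_pos (by positivity), ← ENNReal.ofReal_mul hB.le]
    refine ENNReal.ofReal_le_ofReal ?_
    rwa [← div_eq_mul_inv, le_div_iff₀ (by positivity)]

variable {V : Type*} [NormedAddCommGroup V] [MeasurableSpace V] [BorelSpace V]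
  [SecondCountableTopology V] {f : Torus → V} {B : ℝ}

/-- The energy of `f` close to the diagonal. -/
def diagonalEnergy {V : Type*} [NormedAddCommGroup V] (f : Torus → V) (ε : ℝ) : ℝ≥0∞ :=
  ∫⁻ z, {z : Torus × Torus | ‖z.1 - z.2‖ < 2 * ε}.indicator
    (fun z => ‖f z.1 - f z.2‖ₑ ^ 2) z ∂circleMeasure

theorem measurable_diagonal_indicator (hf : Measurable f) (ε : ℝ) :
    Measurable ({z : Torus × Torus | ‖z.1 - z.2‖ < 2 * ε}.indicator
      fun z => ‖f z.1 - f z.2‖ₑ ^ 2) :=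
  ((measurable_sub_fst_snd hf).enorm.pow_const 2).indicator
    (isOpen_lt (continuous_fst.sub continuous_snd).norm continuous_const).measurableSet

/-- Off the diagonal the indicator is eventually zero, and on the diagonal the integrand vanishes.
The full integrand dominates. -/
theorem tendsto_diagonalEnergy (hf : Measurable f) (hE : circleEnergy f ≠ ∞) {ε : ℕ → ℝ}
    (hε : Tendsto ε atTop (𝓝 0)) : Tendsto (fun n => diagonalEnergy f (ε n)) atTop (𝓝 0) := by
  have h := tendsto_lintegral_of_dominated_convergence (μ := circleMeasure) (f := fun _ => 0)
    (F := fun n => {z : Torus × Torus | ‖z.1 - z.2‖ < 2 * ε n}.indicator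
      fun z => ‖f z.1 - f z.2‖ₑ ^ 2)
    (fun z => ‖f z.1 - f z.2‖ₑ ^ 2) (fun n => measurable_diagonal_indicator hf (ε n))
    (fun n => Eventually.of_forall fun z => Set.indicator_le_self _ _ z) hE
    (Eventually.of_forall fun z => ?_)
  · simpa [diagonalEnergy] using h
  · by_cases hz : z.1 = z.2
    · have : ‖f z.1 - f z.2‖ₑ ^ 2 = 0 := by simp [hz]
      refine tendsto_const_nhds.congr fun n => ?_
      by_cases hm : z ∈ {z : Torus × Torus | ‖z.1 - z.2‖ < 2 * ε n}
      · rw [Set.indicator_of_mem hm, this]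
      · rw [Set.indicator_of_notMem hm]
    · have h2 : 0 < ‖z.1 - z.2‖ := norm_pos_iff.2 (sub_ne_zero.2 hz)
      have h3 : Tendsto (fun n => 2 * ε n) atTop (𝓝 0) := by simpa using hε.const_mul 2
      refine tendsto_const_nhds.congr' ?_
      filter_upwards [h3.eventually_lt_const h2] with n hn
      rw [Set.indicator_of_notMem]
      exact not_lt.2 hn.le

variable [NormedSpace ℝ V]

/-- Translation moves the variable into the tent function, which is 1-Lipschitz. -/
theorem norm_mollify_tent_sub_le {ε : ℝ} (h0 : 0 < ε) (h1 : ε ≤ 1) (hf : Measurable f)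
    (hB : ∀ a, ‖f a‖ ≤ B) (a a' : Torus) :
    ‖mollify (tentMeasure ε) f a - mollify (tentMeasure ε) f a'‖ ≤
      (∫ t, tent ε t)⁻¹ * (2 * π * B) * ‖a - a'‖ := by
  have hB0 : 0 ≤ B := (norm_nonneg _).trans (hB 0)
  have hZ := integral_tent_pos h0 h1
  have htr : ∀ a, mollify (tentMeasure ε) f a =
      (∫ t, tent ε t)⁻¹ • ∫ b, tent ε (b - a) • f b := by
    intro a
    rw [tentMeasure, mollify_densityMeasure (continuous_tent ε) (tent_nonneg ε) hZ,
      ← integral_add_left_eq_self (fun b => tent ε (b - a) • f b) a]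
    simp only [add_sub_cancel_left]
  have hint : ∀ a, Integrable (fun b => tent ε (b - a) • f b) volume := by
    intro a
    refine Integrable.of_bound (C := ε * B) ?_ (Eventually.of_forall fun b => ?_)
    · exact (((continuous_tent ε).comp (continuous_sub_right a)).measurable.smul
        hf).aestronglyMeasurable
    · rw [norm_smul, Real.norm_eq_abs, abs_of_nonneg (tent_nonneg ε _)]
      exact mul_le_mul (tent_le h0.le _) (hB b) (norm_nonneg _) h0.le
  rw [htr, htr, ← smul_sub, ← integral_sub (hint a) (hint a'), norm_smul, norm_inv,
    Real.norm_eq_abs, abs_of_pos hZ, mul_assoc]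
  refine mul_le_mul_of_nonneg_left ?_ (inv_nonneg.2 hZ.le)
  have h2 : ∀ᵐ b : Torus, ‖tent ε (b - a) • f b - tent ε (b - a') • f b‖ ≤ ‖a - a'‖ * B := by
    refine Eventually.of_forall fun b => ?_
    rw [← sub_smul, norm_smul, Real.norm_eq_abs]
    refine mul_le_mul ?_ (hB b) (norm_nonneg _) (norm_nonneg _)
    refine (abs_tent_sub_le ε _ _).trans (le_of_eq ?_)
    rw [sub_sub_sub_cancel_left, norm_sub_rev]
  refine (norm_integral_le_of_norm_le_const h2).trans (le_of_eq ?_)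
  rw [Measure.real, AddCircle.measure_univ, ENNReal.toReal_ofReal two_pi_pos.le]
  ring

variable [CompleteSpace V]

theorem enorm_sub_mollify_sq_le {μ : Measure Torus} [IsProbabilityMeasure μ] (hf : Measurable f)
    (hB : ∀ a, ‖f a‖ ≤ B) (v : V) (a : Torus) :
    ‖v - mollify μ f a‖ₑ ^ 2 ≤ ∫⁻ s, ‖v - f (a + s)‖ₑ ^ 2 ∂μ := by
  have hint := integrable_translate (μ := μ) hf hB a
  have h : v - mollify μ f a = ∫ s, (v - f (a + s)) ∂μ := by
    rw [integral_sub (integrable_const v) hint, mollify]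
    simp
  rw [h]
  exact enorm_integral_sq_le ((integrable_const v).sub hint).aestronglyMeasurable

/-- The density is at most `2 / ε` and supported where the squared distance is at most `ε²`, so it
is at most `2 ε` times the energy kernel. -/
theorem lintegral_enorm_sub_mollify_le {ε : ℝ} (h0 : 0 < ε) (h1 : ε ≤ 1) (hf : Measurable f)
    (hB : ∀ a, ‖f a‖ ≤ B) :
    ∫⁻ a, ‖f a - mollify (tentMeasure ε) f a‖ₑ ^ 2 ≤ ENNReal.ofReal (2 * ε) * circleEnergy f := by
  have := isProbabilityMeasure_tentMeasure h0 h1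
  have hF : Measurable fun z : Torus × Torus => ‖f z.1 - f z.2‖ₑ ^ 2 :=
    (measurable_sub_fst_snd hf).enorm.pow_const 2
  have hm : Measurable fun z : Torus × Torus =>
      (‖circ z.1 - circ z.2‖ₑ ^ 2)⁻¹ * ‖f z.1 - f z.2‖ₑ ^ 2 := measurable_circleKernel.mul hF
  have hpt : ∀ a, ‖f a - mollify (tentMeasure ε) f a‖ₑ ^ 2 ≤
      ∫⁻ b, ENNReal.ofReal (2 * ε) * ((‖circ a - circ b‖ₑ ^ 2)⁻¹ * ‖f a - f b‖ₑ ^ 2) := by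
    intro a
    have hmeas : Measurable fun s => ‖f a - f (a + s)‖ₑ ^ 2 :=
      (measurable_const.sub (hf.comp (measurable_const_add a))).enorm.pow_const 2
    refine (enorm_sub_mollify_sq_le hf hB (f a) a).trans ?_
    rw [lintegral_tentMeasure ε hmeas]
    conv_rhs => rw [← lintegral_add_left_eq_self _ a]
    refine lintegral_mono fun s => ?_
    rw [← mul_assoc]
    gcongr
    refine ofReal_le_mul_inv_enorm_sq (by positivity) ?_
    have h2 := norm_circ_sub_le a (a + s)
    rw [sub_add_cancel_left, norm_neg] at h2
    rcases le_or_gt ε ‖s‖ with hs | hs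
    · rw [tentDensity_eq_zero hs]
      linarith
    · have h3 : ‖circ a - circ (a + s)‖ ^ 2 ≤ ε ^ 2 :=
        pow_le_pow_left₀ (norm_nonneg _) (h2.trans hs.le) 2
      have h4 := mul_le_mul (tentDensity_le h0 h1 s) h3 (by positivity) (by positivity)
      have h5 : 2 / ε * ε ^ 2 = 2 * ε := by field_simp
      linarith
  calc ∫⁻ a, ‖f a - mollify (tentMeasure ε) f a‖ₑ ^ 2
      ≤ ∫⁻ a, ∫⁻ b, ENNReal.ofReal (2 * ε) *
          ((‖circ a - circ b‖ₑ ^ 2)⁻¹ * ‖f a - f b‖ₑ ^ 2) := lintegral_mono hpt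
    _ = ∫⁻ a, ENNReal.ofReal (2 * ε) *
          ∫⁻ b, (‖circ a - circ b‖ₑ ^ 2)⁻¹ * ‖f a - f b‖ₑ ^ 2 :=
        lintegral_congr fun a => lintegral_const_mul' _ _ ENNReal.ofReal_ne_top
    _ = ENNReal.ofReal (2 * ε) *
          ∫⁻ a, ∫⁻ b, (‖circ a - circ b‖ₑ ^ 2)⁻¹ * ‖f a - f b‖ₑ ^ 2 :=
        lintegral_const_mul' _ _ ENNReal.ofReal_ne_top
    _ = ENNReal.ofReal (2 * ε) * circleEnergy f := by
        rw [circleEnergy, lintegral_circleMeasure hF, lintegral_prod _ hm.aemeasurable]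

/-- Along `ε = 2⁻ⁿ` the squared `L²` errors are summable, so the sum of their integrands is finite
almost everywhere. -/
theorem ae_tendsto_mollify_tent (hf : Measurable f) (hB : ∀ a, ‖f a‖ ≤ B)
    (hE : circleEnergy f ≠ ∞) :
    ∀ᵐ a, Tendsto (fun n : ℕ => mollify (tentMeasure ((1 / 2) ^ n)) f a) atTop (𝓝 (f a)) := by
  have h0 : ∀ n : ℕ, (0 : ℝ) < (1 / 2) ^ n := fun n => by positivity
  have h1 : ∀ n : ℕ, (1 / 2 : ℝ) ^ n ≤ 1 := fun n => pow_le_one₀ (by norm_num) (by norm_num)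
  have hm : ∀ n : ℕ, Measurable fun a => ‖f a - mollify (tentMeasure ((1 / 2) ^ n)) f a‖ₑ ^ 2 := by
    intro n
    have := isProbabilityMeasure_tentMeasure (h0 n) (h1 n)
    exact (hf.sub (measurable_mollify _ hf)).enorm.pow_const 2
  have hsum : ∫⁻ a, ∑' n : ℕ, ‖f a - mollify (tentMeasure ((1 / 2) ^ n)) f a‖ₑ ^ 2 ≠ ∞ := by
    rw [lintegral_tsum fun n => (hm n).aemeasurable]
    have h2 : ∑' n : ℕ, ENNReal.ofReal (2 * (1 / 2) ^ n) * circleEnergy f ≠ ∞ := by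
      rw [ENNReal.tsum_mul_right]
      refine ENNReal.mul_ne_top ?_ hE
      have h3 : Summable fun n : ℕ => 2 * (1 / 2 : ℝ) ^ n := summable_geometric_two.mul_left 2
      rw [← ENNReal.ofReal_tsum_of_nonneg (fun n => by positivity) h3]
      exact ENNReal.ofReal_ne_top
    exact ne_top_of_le_ne_top h2
      (ENNReal.tsum_le_tsum fun n => lintegral_enorm_sub_mollify_le (h0 n) (h1 n) hf hB)
  filter_upwards [ae_lt_top (Measurable.tsum hm) hsum] with a ha
  have h2 := ENNReal.tendsto_atTop_zero_of_tsum_ne_top ha.ne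
  have h3 : Tendsto (fun n : ℕ => ‖f a - mollify (tentMeasure ((1 / 2) ^ n)) f a‖ₑ) atTop (𝓝 0) := by
    have h4 := (ENNReal.continuous_rpow_const (y := 1 / 2)).tendsto 0 |>.comp h2
    rw [ENNReal.zero_rpow_of_pos (by norm_num)] at h4
    refine h4.congr fun n => ?_
    rw [Function.comp, ← ENNReal.rpow_natCast, ← ENNReal.rpow_mul]
    norm_num
  rw [tendsto_iff_edist_tendsto_0]
  refine h3.congr fun n => ?_
  rw [edist_comm, edist_eq_enorm_sub]

/-- Finite energy makes the mean oscillation small uniformly in `a`. Two points of the support have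
squared distance at most `(2ε)²`, and the product density is at most `(2/ε)²`, which gives the
factor `16`. -/
theorem enorm_sq_le_diagonalEnergy {ε : ℝ} (h0 : 0 < ε) (h1 : ε ≤ 1) (hf : Measurable f)
    (hB : ∀ a, ‖f a‖ ≤ B) (a : Torus) :
    ∫⁻ s, ‖f (a + s) - mollify (tentMeasure ε) f a‖ₑ ^ 2 ∂tentMeasure ε ≤
      16 * diagonalEnergy f ε := by
  have := isProbabilityMeasure_tentMeasure h0 h1
  have hfa : Measurable fun s => f (a + s) := hf.comp (measurable_const_add a)
  have hpair : Measurable fun z : Torus × Torus => ‖f (a + z.1) - f (a + z.2)‖ₑ ^ 2 :=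
    (measurable_sub_fst_snd hfa).enorm.pow_const 2
  have hD := measurable_diagonal_indicator hf ε
  set D := {z : Torus × Torus | ‖z.1 - z.2‖ < 2 * ε}.indicator fun z => ‖f z.1 - f z.2‖ₑ ^ 2
    with hDdef
  have hinner : ∀ s, Measurable fun t => ‖f (a + s) - f (a + t)‖ₑ ^ 2 := fun s =>
    (measurable_const.sub hfa).enorm.pow_const 2
  have hpt : ∀ s t, ENNReal.ofReal (tentDensity ε s) *
      (ENNReal.ofReal (tentDensity ε t) * ‖f (a + s) - f (a + t)‖ₑ ^ 2) ≤
      16 * ((‖circ s - circ t‖ₑ ^ 2)⁻¹ * D ((s, t) + (a, a))) := by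
    intro s t
    rcases le_or_gt ε ‖s‖ with hs | hs
    · simp [tentDensity_eq_zero hs]
    rcases le_or_gt ε ‖t‖ with ht | ht
    · simp [tentDensity_eq_zero ht]
    have hst : ‖s - t‖ < 2 * ε := (norm_sub_le s t).trans_lt (by linarith)
    have hDst : D ((s, t) + (a, a)) = ‖f (a + s) - f (a + t)‖ₑ ^ 2 := by
      rw [hDdef, Set.indicator_of_mem]
      · simp [add_comm]
      · simpa using hst
    rw [hDst, ← mul_assoc, ← mul_assoc, ← ENNReal.ofReal_mul (tentDensity_nonneg h0 h1 s)]
    gcongr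
    rw [← ENNReal.ofReal_ofNat 16]
    refine ofReal_le_mul_inv_enorm_sq (by norm_num) ?_
    have h2 : ‖circ s - circ t‖ ^ 2 ≤ (2 * ε) ^ 2 :=
      pow_le_pow_left₀ (norm_nonneg _) ((norm_circ_sub_le s t).trans hst.le) 2
    have h3 := mul_le_mul (tentDensity_le h0 h1 s) (tentDensity_le h0 h1 t)
      (tentDensity_nonneg h0 h1 t) (by positivity)
    have h4 := mul_le_mul h3 h2 (by positivity) (by positivity)
    have h5 : 2 / ε * (2 / ε) * (2 * ε) ^ 2 = 16 := by
      field_simp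
      norm_num
    linarith
  have hD' : Measurable fun z : Torus × Torus => D (z + (a, a)) :=
    hD.comp (measurable_add_const (a, a))
  have hKD : Measurable fun z : Torus × Torus =>
      (‖circ z.1 - circ z.2‖ₑ ^ 2)⁻¹ * D (z + (a, a)) := measurable_circleKernel.mul hD'
  calc ∫⁻ s, ‖f (a + s) - mollify (tentMeasure ε) f a‖ₑ ^ 2 ∂tentMeasure ε
      ≤ ∫⁻ s, ∫⁻ t, ‖f (a + s) - f (a + t)‖ₑ ^ 2 ∂tentMeasure ε ∂tentMeasure ε :=
        lintegral_mono fun s => enorm_sub_mollify_sq_le hf hB (f (a + s)) a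
    _ = ∫⁻ s, ENNReal.ofReal (tentDensity ε s) *
          ∫⁻ t, ‖f (a + s) - f (a + t)‖ₑ ^ 2 ∂tentMeasure ε :=
        lintegral_tentMeasure ε hpair.lintegral_prod_right'
    _ = ∫⁻ s, ∫⁻ t, ENNReal.ofReal (tentDensity ε s) *
          (ENNReal.ofReal (tentDensity ε t) * ‖f (a + s) - f (a + t)‖ₑ ^ 2) := by
        refine lintegral_congr fun s => ?_
        rw [lintegral_tentMeasure ε (hinner s), lintegral_const_mul' _ _ ENNReal.ofReal_ne_top]
    _ ≤ ∫⁻ s, ∫⁻ t, 16 * ((‖circ s - circ t‖ₑ ^ 2)⁻¹ * D ((s, t) + (a, a))) :=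
        lintegral_mono fun s => lintegral_mono fun t => hpt s t
    _ = ∫⁻ s, 16 * ∫⁻ t, (‖circ s - circ t‖ₑ ^ 2)⁻¹ * D ((s, t) + (a, a)) :=
        lintegral_congr fun s => lintegral_const_mul' _ _ (by simp)
    _ = 16 * ∫⁻ s, ∫⁻ t, (‖circ s - circ t‖ₑ ^ 2)⁻¹ * D ((s, t) + (a, a)) :=
        lintegral_const_mul' _ _ (by simp)
    _ = 16 * diagonalEnergy f ε := by
        rw [diagonalEnergy, ← lintegral_circleMeasure_add hD a, lintegral_circleMeasure hD',
          lintegral_prod _ hKD.aemeasurable]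

end TentKernel

/-! ### Sphere-valued approximation with a continuous stereographic coordinate. -/

noncomputable section SphereApproximation

theorem norm_normalize_sub_le {E : Type*} [NormedAddCommGroup E] [NormedSpace ℝ E] {x y : E}
    (hx : 1 / 2 ≤ ‖x‖) (hy : 1 / 2 ≤ ‖y‖) :
    ‖‖x‖⁻¹ • x - ‖y‖⁻¹ • y‖ ≤ 4 * ‖x - y‖ := by
  have hx0 : 0 < ‖x‖ := by linarith
  have hy0 : 0 < ‖y‖ := by linarith
  have h1 : ‖x‖⁻¹ • x - ‖y‖⁻¹ • y = ‖x‖⁻¹ • (x - y) + (‖x‖⁻¹ - ‖y‖⁻¹) • y := by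
    rw [smul_sub, sub_smul]
    abel
  have h2 : ‖x‖⁻¹ ≤ 2 := by
    rw [inv_le_comm₀ hx0 (by norm_num)]
    linarith
  have h3 : ‖(‖x‖⁻¹ - ‖y‖⁻¹) • y‖ ≤ ‖x‖⁻¹ * ‖x - y‖ := by
    rw [norm_smul, Real.norm_eq_abs]
    have h4 : ‖x‖⁻¹ - ‖y‖⁻¹ = ‖x‖⁻¹ * (‖y‖ - ‖x‖) * ‖y‖⁻¹ := by
      field_simp
    rw [h4, abs_mul, abs_mul, abs_of_pos (inv_pos.2 hx0), abs_of_pos (inv_pos.2 hy0), mul_assoc,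
      inv_mul_cancel₀ hy0.ne', mul_one]
    refine mul_le_mul_of_nonneg_left ?_ (inv_nonneg.2 hx0.le)
    rw [norm_sub_rev]
    exact abs_norm_sub_norm_le y x
  rw [h1]
  refine (norm_add_le _ _).trans ?_
  rw [norm_smul, norm_inv, norm_norm]
  have h5 := mul_le_mul_of_nonneg_right h2 (norm_nonneg (x - y))
  linarith

/-- The first two coordinates of a vector, as a complex number. -/
def planar (v : R3) : ℂ := ⟨v 0, -v 1⟩

theorem norm_sq_eq_normSq_planar (v : R3) : ‖v‖ ^ 2 = Complex.normSq (planar v) + v 2 ^ 2 := by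
  rw [EuclideanSpace.norm_sq_eq, Fin.sum_univ_three, Complex.normSq_apply]
  simp only [planar, Real.norm_eq_abs, sq_abs]
  ring

theorem planar_sub (v v' : R3) : planar (v - v') = planar v - planar v' := by
  apply Complex.ext
  · simp [planar]
  · simp [planar]
    ring

theorem norm_planar_le (v : R3) : ‖planar v‖ ≤ ‖v‖ := by
  refine le_of_sq_le_sq ?_ (norm_nonneg v)
  rw [norm_sq_eq_normSq_planar, Complex.sq_norm]
  linarith [sq_nonneg (v 2)]

theorem norm_sub_coord_pos {v : R3} (hv : planar v ≠ 0) : 0 < ‖v‖ - v 2 := by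
  have h1 := norm_sq_eq_normSq_planar v
  have h2 := Complex.normSq_pos.2 hv
  have h3 : |v 2| < ‖v‖ := abs_lt_of_sq_lt_sq (by linarith) (norm_nonneg v)
  linarith [le_abs_self (v 2)]

/-- The stereographic coordinate of `v / |v|`. -/
def stereoCoord (v : R3) : ℂ := planar v / ((‖v‖ - v 2 : ℝ) : ℂ)

theorem stereo_stereoCoord {v : R3} (hv : planar v ≠ 0) : stereo (stereoCoord v) = ‖v‖⁻¹ • v := by
  have h1 := norm_sub_coord_pos hv
  have h2 := norm_sq_eq_normSq_planar v
  have hr : 0 < ‖v‖ := by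
    refine norm_pos_iff.2 ?_
    rintro rfl
    exact hv (by apply Complex.ext <;> simp [planar])
  have h3 : Complex.normSq (stereoCoord v) = (‖v‖ + v 2) / (‖v‖ - v 2) := by
    rw [stereoCoord, Complex.normSq_div, Complex.normSq_ofReal, div_eq_div_iff (by positivity) h1.ne']
    linear_combination -(‖v‖ - v 2) * h2
  have h4 : 1 + Complex.normSq (stereoCoord v) = 2 * ‖v‖ / (‖v‖ - v 2) := by
    rw [h3]
    field_simp
    ring
  have hre : (stereoCoord v).re = v 0 / (‖v‖ - v 2) := by
    rw [stereoCoord, Complex.div_ofReal_re, planar]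
  have him : (stereoCoord v).im = -v 1 / (‖v‖ - v 2) := by
    rw [stereoCoord, Complex.div_ofReal_im, planar]
  ext k
  fin_cases k
  · change 2 * (stereoCoord v).re / (1 + Complex.normSq (stereoCoord v)) = ‖v‖⁻¹ * v 0
    rw [h4, hre]
    field_simp
  · change -2 * (stereoCoord v).im / (1 + Complex.normSq (stereoCoord v)) = ‖v‖⁻¹ * v 1
    rw [h4, him]
    field_simp
  · change (Complex.normSq (stereoCoord v) - 1) / (1 + Complex.normSq (stereoCoord v)) =
      ‖v‖⁻¹ * v 2
    rw [h4, h3]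
    field_simp
    ring

theorem continuous_planar : Continuous planar := by
  refine (LipschitzWith.of_dist_le_mul (K := 1) fun a b => ?_).continuous
  rw [dist_eq_norm, dist_eq_norm, ← planar_sub, NNReal.coe_one, one_mul]
  exact norm_planar_le _

/-- Off the vertical axis the denominator `‖v‖ - v 2` is positive, and compactness of the circle
gives it a positive minimum `d`. -/
theorem exists_norm_stereoCoord_sub_le {v : Torus → R3} (hv : Continuous v)
    (h0 : ∀ a, planar (v a) ≠ 0) :
    Continuous (fun a => stereoCoord (v a)) ∧
      ∃ M : ℝ, ∀ a b, ‖stereoCoord (v a) - stereoCoord (v b)‖ ≤ M * ‖v a - v b‖ := by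
  have hcoord : Continuous fun a => v a 2 := (PiLp.continuous_apply 2 _ 2).comp hv
  have hD : Continuous fun a => ‖v a‖ - v a 2 := hv.norm.sub hcoord
  have hDpos : ∀ a, 0 < ‖v a‖ - v a 2 := fun a => norm_sub_coord_pos (h0 a)
  refine ⟨(continuous_planar.comp hv).div (Complex.continuous_ofReal.comp hD)
    fun a => Complex.ofReal_ne_zero.2 (hDpos a).ne', ?_⟩
  obtain ⟨a₀, -, ha₀⟩ := isCompact_univ.exists_isMinOn (Set.univ_nonempty (α := Torus))
    hD.continuousOn
  set d := ‖v a₀‖ - v a₀ 2 with hd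
  have hd0 : 0 < d := hDpos a₀
  have hdle : ∀ a, d ≤ ‖v a‖ - v a 2 := fun a => ha₀ (Set.mem_univ a)
  obtain ⟨R, hR⟩ := isCompact_univ.exists_bound_of_continuousOn hv.continuousOn
  have hR0 : 0 ≤ R := (norm_nonneg _).trans (hR 0 trivial)
  refine ⟨1 / d + R * 2 / d ^ 2, fun a b => ?_⟩
  have ha := Complex.ofReal_ne_zero.2 (hDpos a).ne'
  have hb := Complex.ofReal_ne_zero.2 (hDpos b).ne'
  have key : stereoCoord (v a) - stereoCoord (v b) =
      (planar (v a) - planar (v b)) / ((‖v a‖ - v a 2 : ℝ) : ℂ) +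
      planar (v b) * (((‖v b‖ - v b 2) - (‖v a‖ - v a 2) : ℝ) : ℂ) /
        (((‖v a‖ - v a 2 : ℝ) : ℂ) * ((‖v b‖ - v b 2 : ℝ) : ℂ)) := by
    rw [stereoCoord, stereoCoord]
    rw [Complex.ofReal_sub (‖v b‖ - v b 2)]
    generalize ((‖v a‖ - v a 2 : ℝ) : ℂ) = A at *
    generalize ((‖v b‖ - v b 2 : ℝ) : ℂ) = B at *
    field_simp
    ring
  have hdiff : |(‖v b‖ - v b 2) - (‖v a‖ - v a 2)| ≤ 2 * ‖v a - v b‖ := by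
    have e1 : |‖v b‖ - ‖v a‖| ≤ ‖v a - v b‖ := by
      rw [norm_sub_rev]
      exact abs_norm_sub_norm_le _ _
    have e2 : |v a 2 - v b 2| ≤ ‖v a - v b‖ := by
      have := PiLp.norm_apply_le (v a - v b) 2
      rwa [PiLp.sub_apply, Real.norm_eq_abs] at this
    have e3 : (‖v b‖ - v b 2) - (‖v a‖ - v a 2) = (‖v b‖ - ‖v a‖) + (v a 2 - v b 2) := by ring
    rw [e3]
    refine (abs_add_le _ _).trans ?_
    linarith
  have h1 : ‖(planar (v a) - planar (v b)) / ((‖v a‖ - v a 2 : ℝ) : ℂ)‖ ≤ 1 / d * ‖v a - v b‖ := by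
    rw [norm_div, Complex.norm_real, Real.norm_eq_abs, abs_of_pos (hDpos a), ← planar_sub,
      one_div_mul_eq_div]
    exact div_le_div₀ (norm_nonneg _) (norm_planar_le _) hd0 (hdle a)
  have h2 : ‖planar (v b) * (((‖v b‖ - v b 2) - (‖v a‖ - v a 2) : ℝ) : ℂ) /
      (((‖v a‖ - v a 2 : ℝ) : ℂ) * ((‖v b‖ - v b 2 : ℝ) : ℂ))‖ ≤ R * 2 / d ^ 2 * ‖v a - v b‖ := by
    rw [norm_div, norm_mul, norm_mul, Complex.norm_real, Complex.norm_real, Complex.norm_real,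
      Real.norm_eq_abs, Real.norm_eq_abs, Real.norm_eq_abs, abs_of_pos (hDpos a),
      abs_of_pos (hDpos b), div_mul_eq_mul_div, mul_assoc R, sq]
    refine div_le_div₀ (by positivity) ?_ (by positivity)
      (mul_le_mul (hdle a) (hdle b) hd0.le (hDpos a).le)
    exact mul_le_mul ((norm_planar_le _).trans (hR b trivial)) hdiff (abs_nonneg _) hR0
  rw [key, add_mul]
  exact (norm_add_le _ _).trans (add_le_add h1 h2)

theorem circleEnergy_le_of_norm_sub_le {V V' : Type*} [NormedAddCommGroup V]
    [NormedAddCommGroup V'] {f : Torus → V} {g : Torus → V'} {M : ℝ}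
    (h : ∀ a b, ‖g a - g b‖ ≤ M * ‖f a - f b‖) :
    circleEnergy g ≤ ENNReal.ofReal M ^ 2 * circleEnergy f := by
  unfold circleEnergy
  rw [← lintegral_const_mul' _ _ (by finiteness)]
  refine lintegral_mono fun z => ?_
  rw [← mul_pow]
  exact pow_le_pow_left' (enorm_le_ofReal_mul_enorm (h _ _)) 2

/-- The horizontal vector with planar part `η`. -/
def horizontal (η : ℂ) : R3 := !₂[η.re, -η.im, 0]

theorem planar_horizontal (η : ℂ) : planar (horizontal η) = η := by
  apply Complex.ext <;> simp [planar, horizontal]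

theorem norm_horizontal (η : ℂ) : ‖horizontal η‖ = ‖η‖ := by
  have h := norm_sq_eq_normSq_planar (horizontal η)
  rw [planar_horizontal, ← Complex.sq_norm] at h
  have h2 : horizontal η 2 = 0 := by simp [horizontal]
  rw [h2] at h
  refine (sq_eq_sq₀ (norm_nonneg _) (norm_nonneg _)).1 ?_
  linarith

/-- The planar projection of a Lipschitz curve has Hausdorff dimension at most one, so its
complement in the plane is dense. -/
theorem exists_planar_ne {v : Torus → R3} {K : ℝ} (hK : ∀ a b, ‖v a - v b‖ ≤ K * ‖a - b‖)
    {τ : ℝ} (hτ : 0 < τ) : ∃ η : ℂ, ‖η‖ < τ ∧ ∀ a, planar (v a) ≠ η := by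
  have hlip : LipschitzWith K.toNNReal fun θ : ℝ => planar (v (θ : Torus)) := by
    refine LipschitzWith.of_dist_le_mul fun θ θ' => ?_
    rw [dist_eq_norm, dist_eq_norm, ← planar_sub]
    refine (norm_planar_le _).trans ((hK _ _).trans ?_)
    refine mul_le_mul (Real.le_coe_toNNReal K) ?_ (norm_nonneg _) NNReal.zero_le_coe
    rw [← AddCircle.coe_sub]
    exact QuotientAddGroup.norm_mk_le_norm
  have hdim : dimH (Set.range fun θ : ℝ => planar (v (θ : Torus))) < Module.finrank ℝ ℂ := by
    refine hlip.dimH_range_le.trans_lt ?_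
    rw [Real.dimH_univ, Complex.finrank_real_complex]
    norm_num
  obtain ⟨η, hη, hη'⟩ := (dense_compl_of_dimH_lt_finrank hdim).exists_mem_open Metric.isOpen_ball
    ⟨0, Metric.mem_ball_self hτ⟩
  refine ⟨η, by simpa using hη', fun a ha => hη ?_⟩
  induction a using QuotientAddGroup.induction_on with
  | H θ => exact ⟨θ, ha⟩

theorem exists_stereo_near {f : Torus → R3} (hf : Measurable f) (hS : ∀ a, f a ∈ S2)
    (hE : circleEnergy f ≠ ∞) {δ : ℝ≥0∞} (hδ : 0 < δ) :
    ∃ w : Torus → ℂ, Continuous w ∧ circleEnergy w ≠ ∞ ∧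
      circleEnergy (fun a => stereo (w a) - f a) < δ := by
  have hnorm : ∀ a, ‖f a‖ = 1 := fun a => mem_sphere_zero_iff_norm.1 (hS a)
  have hB : ∀ a, ‖f a‖ ≤ 1 := fun a => (hnorm a).le
  have h0 : ∀ n : ℕ, (0 : ℝ) < (1 / 2) ^ n := fun n => by positivity
  have h1 : ∀ n : ℕ, (1 / 2 : ℝ) ^ n ≤ 1 := fun n => pow_le_one₀ (by norm_num) (by norm_num)
  have hpow : Tendsto (fun n : ℕ => (1 / 2 : ℝ) ^ n) atTop (𝓝 0) :=
    tendsto_pow_atTop_nhds_zero_of_lt_one (by norm_num) (by norm_num)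
  have hprob : ∀ n : ℕ, IsProbabilityMeasure (tentMeasure ((1 / 2) ^ n)) := fun n =>
    isProbabilityMeasure_tentMeasure (h0 n) (h1 n)
  -- An average of norm below `3/4` would be farther than `1/4` from every `f (a + s)`, against the
  -- small mean oscillation.
  obtain ⟨N, hN⟩ : ∃ N : ℕ, ∀ n ≥ N, ∀ a, 3 / 4 ≤ ‖mollify (tentMeasure ((1 / 2) ^ n)) f a‖ := by
    have h2 : Tendsto (fun n : ℕ => 16 * diagonalEnergy f ((1 / 2) ^ n)) atTop (𝓝 0) := by
      have := ENNReal.Tendsto.const_mul (a := 16) (tendsto_diagonalEnergy hf hE hpow)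
        (Or.inr (by simp))
      simpa using this
    have h3 : (0 : ℝ≥0∞) < ENNReal.ofReal (1 / 4) ^ 2 := by
      have : 0 < ENNReal.ofReal (1 / 4) := ENNReal.ofReal_pos.2 (by norm_num)
      positivity
    obtain ⟨N, hN⟩ := eventually_atTop.1 (h2.eventually_lt_const h3)
    refine ⟨N, fun n hn a => ?_⟩
    by_contra hcon
    have := hprob n
    have h4 := enorm_sq_le_diagonalEnergy (h0 n) (h1 n) hf hB a
    have h5 : ENNReal.ofReal (1 / 4) ^ 2 ≤
        ∫⁻ s, ‖f (a + s) - mollify (tentMeasure ((1 / 2) ^ n)) f a‖ₑ ^ 2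
          ∂tentMeasure ((1 / 2) ^ n) := by
      calc ENNReal.ofReal (1 / 4) ^ 2
          = ∫⁻ _, ENNReal.ofReal (1 / 4) ^ 2 ∂tentMeasure ((1 / 2) ^ n) := by
            rw [lintegral_const, measure_univ, mul_one]
        _ ≤ _ := by
          refine lintegral_mono fun s => pow_le_pow_left' ?_ 2
          rw [← ofReal_norm]
          refine ENNReal.ofReal_le_ofReal ?_
          have h6 := norm_sub_norm_le (f (a + s)) (mollify (tentMeasure ((1 / 2) ^ n)) f a)
          rw [hnorm] at h6
          linarith
    exact absurd (hN n hn) (not_lt.2 (h5.trans h4))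
  -- Starting at scale `N` makes the lower bound hold for every index.
  let v : ℕ → Torus → R3 := fun n => mollify (tentMeasure ((1 / 2) ^ (n + N))) f
  have hvlip : ∀ n a b, ‖v n a - v n b‖ ≤
      (∫ t, tent ((1 / 2) ^ (n + N)) t)⁻¹ * (2 * Real.pi * 1) * ‖a - b‖ := fun n a b =>
    norm_mollify_tent_sub_le (h0 _) (h1 _) hf hB a b
  have hvcont : ∀ n, Continuous (v n) := fun n =>
    (LipschitzWith.of_dist_le' fun a b => by
      rw [dist_eq_norm, dist_eq_norm]
      exact hvlip n a b).continuous
  -- The shifts stay below `1/4`, so norms remain at least `1/2`, and tend to zero, so the limit is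
  -- unaffected.
  choose η hη hηne using fun n : ℕ =>
    exists_planar_ne (hvlip n) (τ := 1 / 4 * (1 / 2) ^ n) (by positivity)
  let v' : ℕ → Torus → R3 := fun n a => v n a - horizontal (η n)
  have hv'cont : ∀ n, Continuous (v' n) := fun n => (hvcont n).sub continuous_const
  have hv'ne : ∀ n a, planar (v' n a) ≠ 0 := by
    intro n a
    rw [planar_sub, planar_horizontal, sub_ne_zero]
    exact hηne n a
  have hv'norm : ∀ n a, 1 / 2 ≤ ‖v' n a‖ := by
    intro n a
    have h2 := hN (n + N) (Nat.le_add_left N n) a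
    have h3 := norm_sub_norm_le (v n a) (horizontal (η n))
    rw [norm_horizontal] at h3
    have h4 := hη n
    have h5 := h1 n
    have h6 : 3 / 4 ≤ ‖v n a‖ := h2
    have h7 : ‖v n a‖ - ‖η n‖ ≤ ‖v' n a‖ := h3
    linarith
  have hv'sub : ∀ n a b, v' n a - v' n b = v n a - v n b := fun n a b =>
    sub_sub_sub_cancel_right _ _ _
  have hlim : ∀ᵐ a, Tendsto (fun n => v n a) atTop (𝓝 (f a)) := by
    filter_upwards [ae_tendsto_mollify_tent hf hB hE] with a ha
    exact ha.comp (tendsto_add_atTop_nat N)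
  have hη0 : Tendsto (fun n => horizontal (η n)) atTop (𝓝 0) := by
    refine squeeze_zero_norm (a := fun n : ℕ => 1 / 4 * (1 / 2 : ℝ) ^ n) (fun n => ?_) ?_
    · rw [norm_horizontal]
      exact (hη n).le
    · have := hpow.const_mul (1 / 4 : ℝ)
      rwa [mul_zero] at this
  have hglim : ∀ᵐ a, Tendsto (fun n => ‖v' n a‖⁻¹ • v' n a) atTop (𝓝 (f a)) := by
    filter_upwards [hlim] with a ha
    have h2 : Tendsto (fun n => v' n a) atTop (𝓝 (f a)) := by simpa using ha.sub hη0
    have h3 := (h2.norm.inv₀ (by rw [hnorm]; exact one_ne_zero)).smul h2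
    rwa [hnorm, inv_one, one_smul] at h3
  have hgcont : ∀ n, Continuous fun a => ‖v' n a‖⁻¹ • v' n a := fun n =>
    ((hv'cont n).norm.inv₀ fun a => by linarith [hv'norm n a]).smul (hv'cont n)
  have hmain := tendsto_circleEnergy_sub (fun n => hprob (n + N)) hf hB hE hlim hf
    (fun n => (hgcont n).measurable) hglim (L := 4)
    (fun n a b => by
      refine (norm_normalize_sub_le (hv'norm n a) (hv'norm n b)).trans (le_of_eq ?_)
      rw [hv'sub])
    (fun a b => by linarith [norm_nonneg (f a - f b)])
  obtain ⟨n, hn⟩ := (hmain.eventually_lt_const hδ).exists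
  obtain ⟨hwc, M, hM⟩ := exists_norm_stereoCoord_sub_le (hv'cont n) (hv'ne n)
  refine ⟨fun a => stereoCoord (v' n a), hwc, ?_, ?_⟩
  · have := hprob (n + N)
    refine ne_top_of_le_ne_top ?_ (circleEnergy_le_of_norm_sub_le (f := v n) (M := M)
      fun a b => by rw [← hv'sub]; exact hM a b)
    exact ENNReal.mul_ne_top (by finiteness)
      (ne_top_of_le_ne_top hE (circleEnergy_mollify_le _ hf hB))
  · simpa only [fun a => stereo_stereoCoord (hv'ne n a)] using hn

end SphereApproximation

/-! ### Assembling the approximations on the line. -/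

noncomputable section Density

theorem lineEnergy_congr_ae {V : Type*} [NormedAddCommGroup V] {u v : ℝ → V}
    (h : u =ᵐ[volume] v) : lineEnergy u = lineEnergy v := by
  refine lintegral_congr_ae ?_
  filter_upwards [h] with x hx
  refine lintegral_congr_ae ?_
  filter_upwards [h] with y hy
  rw [hx, hy]

/-- On the null set where the representative leaves the sphere, any point of it may be used; `stereo
0` is one. -/
theorem exists_measurable_sphere_valued {u : ℝ → R3} (hu : u ∈ energySpace) :
    ∃ u' : ℝ → R3, Measurable u' ∧ (∀ x, u' x ∈ S2) ∧ u =ᵐ[volume] u' := by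
  classical
  obtain ⟨hloc, hS, -⟩ := hu
  have hm := hloc.aestronglyMeasurable
  have hS2 : MeasurableSet S2 := Metric.isClosed_sphere.measurableSet
  have hmeas : Measurable (hm.mk u) := hm.stronglyMeasurable_mk.measurable
  refine ⟨fun x => if hm.mk u x ∈ S2 then hm.mk u x else stereo 0, ?_, fun x => ?_, ?_⟩
  · exact Measurable.ite (hmeas hS2) hmeas measurable_const
  · simp only
    split_ifs with h
    · exact h
    · exact stereo_mem_S2 0
  · filter_upwards [hm.ae_eq_mk, hS] with x h1 h2
    rw [h1] at h2
    rw [if_pos h2, h1]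

theorem lineEnergy_ne_top {u : ℝ → R3} (hu : gagliardoHalf u < ∞) : lineEnergy u ≠ ∞ := by
  intro h
  have hc : ENNReal.ofReal (1 / (2 * Real.pi)) ≠ 0 := by
    rw [ne_eq, ENNReal.ofReal_eq_zero, not_le]
    positivity
  rw [gagliardoHalf_eq, h, ENNReal.mul_top hc, ENNReal.top_rpow_of_pos (by norm_num)] at hu
  exact lt_irrefl _ hu

theorem exists_gagliardoHalf_lt {ε : ℝ≥0∞} (hε : 0 < ε) :
    ∃ δ : ℝ≥0∞, 0 < δ ∧ ∀ u : ℝ → R3, lineEnergy u ≤ δ → gagliardoHalf u < ε := by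
  have hcont : Tendsto (fun E : ℝ≥0∞ => (ENNReal.ofReal (1 / (2 * Real.pi)) * E) ^ (1 / 2 : ℝ))
      (𝓝 0) (𝓝 0) := by
    have h1 : Tendsto (fun E : ℝ≥0∞ => ENNReal.ofReal (1 / (2 * Real.pi)) * E) (𝓝 0) (𝓝 0) := by
      have := ENNReal.Tendsto.const_mul (a := ENNReal.ofReal (1 / (2 * Real.pi)))
        (tendsto_id (x := 𝓝 (0 : ℝ≥0∞))) (Or.inr ENNReal.ofReal_ne_top)
      simpa using this
    have h2 := ((ENNReal.continuous_rpow_const (y := 1 / 2)).tendsto 0).comp h1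
    rwa [ENNReal.zero_rpow_of_pos (by norm_num)] at h2
  obtain ⟨δ, hδ, h⟩ := ENNReal.nhds_zero_basis_Iic.eventually_iff.1 (hcont.eventually_lt_const hε)
  exact ⟨δ, hδ, fun u hu => h hu⟩

theorem mainTheorem3 :
    ratMapsSimple ⊆ energySpace ∧
      ∀ u ∈ energySpace, ∀ ε : ℝ≥0∞, 0 < ε →
        ∃ w ∈ ratMapsSimple, gagliardoHalf (w - u) < ε := by
  refine ⟨fun u hu => ratMaps_subset_energySpace hu.1, fun u hu ε hε => ?_⟩
  obtain ⟨u', hu'm, hu'S, huu'⟩ := exists_measurable_sphere_valued hu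
  obtain ⟨δ, hδ, hδε⟩ := exists_gagliardoHalf_lt hε
  -- Two uses of the factor-two bound for sums turn three errors `e` into `2 (e + 2 (e + e)) = 10
  -- e`.
  have hδ' : 0 < δ / 10 := ENNReal.div_pos hδ.ne' (by simp)
  obtain ⟨f, hfm, hfu, hfv⟩ := exists_comp_cay_eq hu'm
  have hfS : ∀ a, f a ∈ S2 := by
    intro a
    obtain ⟨x, hx⟩ := hfv a
    rw [hx]
    exact hu'S x
  have hfE : circleEnergy f ≠ ∞ := by
    rw [← lineEnergy_comp_cay hfm]
    simp only [hfu]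
    change lineEnergy u' ≠ ∞
    rw [← lineEnergy_congr_ae huu']
    exact lineEnergy_ne_top hu.2.2
  obtain ⟨w, hw, hwE, hwf⟩ := exists_stereo_near hfm hfS hfE hδ'
  obtain ⟨s, p, hs, hp, hpw⟩ := exists_ratU_near hw hwE hδ'
  obtain ⟨r, hr, hrm, hrp⟩ := exists_mem_ratMapsSimple_near hs hp hδ'
  have hstm : Measurable fun a => stereo (w a) := (continuous_stereo.measurable.comp hw.measurable)
  have h3 : lineEnergy (fun x => stereo (w (cay x)) - u' x) < δ / 10 := by
    rw [← lineEnergy_comp_cay (f := fun a => stereo (w a) - f a) (hstm.sub hfm)] at hwf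
    simpa only [hfu] using hwf
  have hqm : Measurable (ratU p (rootPoly s)) :=
    (continuous_of_mem_ratMaps (ratU_mem_ratMaps (eval_rootPoly_ne_zero hs))).measurable
  refine ⟨r, hr, hδε _ ?_⟩
  have h4 : lineEnergy (r - u) = lineEnergy (fun x => (r x - ratU p (rootPoly s) x) +
      ((ratU p (rootPoly s) x - stereo (w (cay x))) + (stereo (w (cay x)) - u' x))) := by
    refine lineEnergy_congr_ae ?_
    filter_upwards [huu'] with x hx
    rw [Pi.sub_apply, hx]
    abel
  rw [h4]
  calc lineEnergy _ ≤ 2 * (lineEnergy (fun x => r x - ratU p (rootPoly s) x) +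
        lineEnergy (fun x => (ratU p (rootPoly s) x - stereo (w (cay x))) +
          (stereo (w (cay x)) - u' x))) := lineEnergy_add_le (hrm.sub hqm)
    _ ≤ 2 * (lineEnergy (fun x => r x - ratU p (rootPoly s) x) +
        2 * (lineEnergy (fun x => ratU p (rootPoly s) x - stereo (w (cay x))) +
          lineEnergy (fun x => stereo (w (cay x)) - u' x))) := by
        gcongr
        exact lineEnergy_add_le (hqm.sub (hstm.comp measurable_cay))
    _ ≤ 2 * (δ / 10 + 2 * (δ / 10 + δ / 10)) := by
        gcongr
    _ = 10 * (δ / 10) := by ring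
    _ = δ := ENNReal.mul_div_cancel (by simp) (by simp)

end Density
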